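/- Let $k$ be a positive even integer and $m$ a positive integer; write $\tau=u+iv\in\mathbb H$, $z=x+iy\in\mathbb C$. **Harmonic Maass--Jacobi forms.** A function $F:\mathbb H\times\mathbb C\to\mathbb C$ that is real-analytic on $\mathbb H\times\mathbb C$ and holomorphic in $z$ is a harmonic Maass--Jacobi form of weight $k$ and index $m$ on $\mathrm{SL}_2(\mathbb Z)$ (written $F\in\hat J_{k,m}$) if 1. $(c\tau+d)^{-k}e^{-2\pi i m cz^2/(c\tau+d)}F\left(\frac{a\tau+b}{c\tau+d},\frac{z}{c\tau+d}\right)=F(\tau,z)$ for all $\begin{pmatrix}a&b\\c&d\end{pmatrix}\in\mathrm{SL}_2(\mathbb Z)$; 2. $e^{2\pi i m(\lambda^2\tau+2\lambda z)}F(\tau,z+\lambda\tau+\mu)=F(\tau,z)$ for all $\lambda,\mu\in\mathbb Z$; 3. $\mathcal C_{k,m}F=0$ for the Casimir operator $$\begin{aligned}\mathcal C_{k,m}=&-2(\tau-\bar\tau)^2\partial_{\tau\bar\tau}-(2k-1)(\tau-\bar\tau)\partial_{\bar\tau}+\tfrac{(\tau-\bar\tau)^2}{4\pi i m}\partial_{\bar\tau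 zz}+\tfrac{k(\tau-\bar\tau)}{4\pi i m}\partial_{z\bar z}+\tfrac{(\tau-\bar\tau)(z-\bar z)}{4\pi i m}\partial_{zz\bar z}-2(\tau-\bar\tau)(z-\bar z)\partial_{\tau\bar z}\\&+(1-k)(z-\bar z)\partial_{\bar z}+\tfrac{(\tau-\bar\tau)^2}{4\pi i m}\partial_{\tau\bar z\bar z}+\left(\tfrac{(z-\bar z)^2}{2}+\tfrac{k(\tau-\bar\tau)}{4\pi i m}\right)\partial_{\bar z\bar z}+\tfrac{(\tau-\bar\tau)(z-\bar z)}{4\pi i m}\partial_{z\bar z\bar z};\end{aligned}$$ 4. there are numbers $c(D,r)$ ($D\in\mathbb Z_{\le 0}$, $r\in\mathbb Z/2m\mathbb Z$), nonzero for only finitely many $D$, such that for some $h>0$, with $P(\tau,z)=\sum_{l,r\in\mathbb Z,\,4ml-r^2\le 0}c(4ml-r^2,r)e^{2\pi i l\tau}e^{2\pi i r z}$, one has $F(\tau,z)-P(\tau,z)=O(e^{-hv}e^{2\pi m y^2/v})$ as $v\to\infty$, uniformly in $u$ and $z$. **Coefficients.** Let $c^+_F(l,r)$ ($l,r\in\mathbb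 Z$, $4ml-r^2\ge -D_0$; put $c_F^+(l,r)=0$ if $4ml-r^2<-D_0$) and $c^-_F(l,r)$ ($4ml-r^2<0$) be complex numbers that depend only on $4ml-r^2$ and on $r$ modulo $2m$, and suppose that for some $C>0$ $$c_F^\pm(l,r)=O\left(e^{C\sqrt{|4ml-r^2|}}\right)\quad\text{as } |4ml-r^2|\to\infty .$$ With $\Gamma(a,w)=\int_w^\infty e^{-t}t^{a-1}dt$, put $$F(\tau,z)=\sum_{l,r\in\mathbb Z}c_F^+(l,r)e^{2\pi i l\tau}e^{2\pi i r z}+\sum_{\substack{l,r\in\mathbb Z\\4ml-r^2<0}}c_F^-(l,r)\,\Gamma\left(\tfrac32-k,-\tfrac{(4ml-r^2)\pi v}{m}\right)e^{2\pi i l\tau}e^{2\pi i r z}.$$ **$L$-series.** For $\varphi:\mathbb R_+\to\mathbb C$ let $\varphi_s(x)=\varphi(x)x^{s-1}$ ($s\in\mathbb C$), $(\mathcal L\varphi)(s)=\int_0^\infty e^{-st}\varphi(t)\,dt$ and $(\varphi|_{5/2-k}S)(x)=x^{k-5/2}\varphi(1/x)$; for an integer $n<0$ let $$I_n(\psi)=\left(-\tfrac{\pi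 n}{m}\right)^{3/2-k}\int_0^\infty\frac{(\mathcal L\psi)\left(-\pi n(2t+1)/(2m)\right)}{(1+t)^{k-1/2}}\,dt .$$ For compactly supported piecewise smooth $\varphi$ on $\mathbb R_+$ define $L_F(\varphi),L_{\alpha_kF}(\varphi)\in\mathbb C^{2m}$ by their components ($1\le j\le 2m$; $n\in\mathbb Z$) $$L_F(\varphi)_j=\sum_{n\equiv -j^2\,(4m)}c_F^+\left(\tfrac{n+j^2}{4m},j\right)(\mathcal L\varphi)\left(\tfrac{\pi n}{2m}\right)+\sum_{\substack{n<0\\ n\equiv -j^2\,(4m)}}c_F^-\left(\tfrac{n+j^2}{4m},j\right)I_n(\varphi_{5/2-k}),$$ $$L_{\alpha_kF}(\varphi)_j=\tfrac{2k-1}{4}L_F(\varphi)_j-2\pi\sum_{n\equiv -j^2\,(4m)}c_F^+\left(\tfrac{n+j^2}{4m},j\right)\tfrac{n}{4m}(\mathcal L\varphi_2)\left(\tfrac{\pi n}{2m}\right)-2\pi\sum_{\substack{n<0\\ n\equiv -j^2\,(4m)}}c_F^-\left(\tfrac{n+j^2}{4m},j\right)\tfrac{n}{4m}I_n(\varphi_{7/2-k}).$$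 Let $\rho_m(S)$ be the $2m\times 2m$ matrix with $\rho_m(S)\mathbf e_l=\frac1{\sqrt{2im}}\sum_{l'=1}^{2m}e^{-2\pi i ll'/(2m)}\mathbf e_{l'}$ and $\overline{\rho_m}(S)$ its complex conjugate (roots and powers are principal). **Test functions.** A function on $\mathbb R_+$ is piecewise smooth if near every point it agrees on either side with a function smooth across that point and its value at the point is one of the two one-sided limits. Let $S_c(\mathbb R_+)$ be a set of compactly supported piecewise smooth functions $\mathbb R_+\to\mathbb C$ such that $\varphi_s\in S_c(\mathbb R_+)$ whenever $\varphi\in S_c(\mathbb R_+)$, $s\in\mathbb C$, and such that for every $y>0$ some $\varphi\in S_c(\mathbb R_+)$ has $\varphi(y)\ne0$ (for example, the set of all compactly supported piecewise smooth functions). **Theorem.** Suppose that for every $\varphi\in S_c(\mathbb R_+)$ $$L_F(\varphi)=i^{k-\frac12}\,\overline{\rho_m}(S)\,L_F(\varphi|_{5/2-k}S)\qquad\text{and}\qquad L_{\alpha_kF}(\varphi)=-i^{k-\frac12}\,\overline{\rho_m}(S)\,L_{\alpha_kF}(\varphi|_{5/2-k}S).$$ Then $F$ is a harmonic Maass--Jacobi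 form of weight $k$ and index $m$, i.e. $F\in\hat J_{k,m}$. -/

import Mathlib

open Complex

noncomputable section

namespace JacobiConverse

/-! ### Harmonic Maass-Jacobi forms

Functions on `ℍ × ℂ` are written as functions on `ℂ × ℂ`, and only their restriction to
`{(τ, z) | 0 < Im τ}` is ever used. -/

/-- The domain `ℍ × ℂ`. -/
def domain : Set (ℂ × ℂ) := {p | 0 < p.1.im}

/-- The Wirtinger derivative `∂/∂τ = (∂/∂u - i ∂/∂v) / 2`, where `τ = u + iv`. -/
def dTau (F : ℂ × ℂ → ℂ) (p : ℂ × ℂ) : ℂ :=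
  (fderiv ℝ F p (1, 0) - I * fderiv ℝ F p (I, 0)) / 2

/-- The Wirtinger derivative `∂/∂τ̄ = (∂/∂u + i ∂/∂v) / 2`. -/
def dTauBar (F : ℂ × ℂ → ℂ) (p : ℂ × ℂ) : ℂ :=
  (fderiv ℝ F p (1, 0) + I * fderiv ℝ F p (I, 0)) / 2

/-- The Wirtinger derivative `∂/∂z = (∂/∂x - i ∂/∂y) / 2`, where `z = x + iy`. -/
def dZ (F : ℂ × ℂ → ℂ) (p : ℂ × ℂ) : ℂ :=
  (fderiv ℝ F p (0, 1) - I * fderiv ℝ F p (0, I)) / 2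

/-- The Wirtinger derivative `∂/∂z̄ = (∂/∂x + i ∂/∂y) / 2`. -/
def dZBar (F : ℂ × ℂ → ℂ) (p : ℂ × ℂ) : ℂ :=
  (fderiv ℝ F p (0, 1) + I * fderiv ℝ F p (0, I)) / 2

/-- The Casimir operator `C_{k,m}`. -/
def casimir (k m : ℕ) (F : ℂ × ℂ → ℂ) (p : ℂ × ℂ) : ℂ :=
  let T : ℂ := p.1 - (starRingEnd ℂ) p.1
  let Z : ℂ := p.2 - (starRingEnd ℂ) p.2
  let w : ℂ := 4 * Real.pi * I * m
  (-2 : ℂ) * T ^ 2 * dTau (dTauBar F) p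
    - (2 * k - 1) * T * dTauBar F p
    + T ^ 2 / w * dTauBar (dZ (dZ F)) p
    + k * T / w * dZ (dZBar F) p
    + T * Z / w * dZ (dZ (dZBar F)) p
    - 2 * T * Z * dTau (dZBar F) p
    + (1 - k) * Z * dZBar F p
    + T ^ 2 / w * dTau (dZBar (dZBar F)) p
    + (Z ^ 2 / 2 + k * T / w) * dZBar (dZBar F) p
    + T * Z / w * dZ (dZBar (dZBar F)) p

/-- The action `F|_{k,m} γ` of `γ ∈ SL₂(ℤ)`. -/
def slash (k m : ℕ) (F : ℂ × ℂ → ℂ) (γ : Matrix.SpecialLinearGroup (Fin 2) ℤ)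
    (p : ℂ × ℂ) : ℂ :=
  let j : ℂ := (γ 1 0 : ℂ) * p.1 + (γ 1 1 : ℂ)
  j ^ (-(k : ℤ)) * exp (-(2 * Real.pi * I * m * ((γ 1 0 : ℂ) * p.2 ^ 2 / j))) *
    F (((γ 0 0 : ℂ) * p.1 + (γ 0 1 : ℂ)) / j, p.2 / j)

/-- The action `F|_m (λ, μ)` of `(λ, μ) ∈ ℤ²`. -/
def heisenberg (m : ℕ) (F : ℂ × ℂ → ℂ) (a b : ℤ) (p : ℂ × ℂ) : ℂ :=
  exp (2 * Real.pi * I * m * ((a : ℂ) ^ 2 * p.1 + 2 * a * p.2)) * F (p.1, p.2 + a * p.1 + b)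

/-- The discriminant `4ml - r²`. -/
def disc (m : ℕ) (l r : ℤ) : ℤ := 4 * m * l - r ^ 2

/-- The monomial `e^{2πilτ} e^{2πirz}`. -/
def monomial (l r : ℤ) (p : ℂ × ℂ) : ℂ :=
  exp (2 * Real.pi * I * l * p.1) * exp (2 * Real.pi * I * r * p.2)

/-- The series `∑ c(4ml - r², r mod 2m) e^{2πilτ} e^{2πirz}` over all `(l, r)` with
`4ml - r² ≤ 0`. -/
def principalPart (m : ℕ) (c : ℤ → ZMod (2 * m) → ℂ) (p : ℂ × ℂ) : ℂ :=
  ∑' a : ℤ × ℤ, if disc m a.1 a.2 ≤ 0 then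
    c (disc m a.1 a.2) (a.2 : ZMod (2 * m)) * monomial a.1 a.2 p else 0

/-- `F` is a harmonic Maass-Jacobi form of weight `k` and index `m` on `SL₂(ℤ)`. -/
structure IsHarmonicMaassJacobiForm (k m : ℕ) (F : ℂ × ℂ → ℂ) : Prop where
  realAnalytic : AnalyticOnNhd ℝ F domain
  holomorphic : ∀ τ : ℂ, 0 < τ.im → Differentiable ℂ fun z => F (τ, z)
  slash_eq : ∀ γ : Matrix.SpecialLinearGroup (Fin 2) ℤ, ∀ p ∈ domain, slash k m F γ p = F p
  heisenberg_eq : ∀ a b : ℤ, ∀ p ∈ domain, heisenberg m F a b p = F p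
  casimir_eq : ∀ p ∈ domain, casimir k m F p = 0
  growth : ∃ c : ℤ → ZMod (2 * m) → ℂ, {D : ℤ | D ≤ 0 ∧ ∃ r, c D r ≠ 0}.Finite ∧
    ∃ h : ℝ, 0 < h ∧ ∃ A V : ℝ, ∀ p ∈ domain, V ≤ p.1.im →
      ‖F p - principalPart m c p‖ ≤
        A * (Real.exp (-h * p.1.im) * Real.exp (2 * Real.pi * m * p.2.im ^ 2 / p.1.im))

/-! ### The Fourier series -/

/-- The incomplete gamma function `Γ(a, w) = ∫_w^∞ e^{-t} t^{a-1} dt` for `w > 0`. -/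
def incGamma (a w : ℝ) : ℝ := ∫ t in Set.Ioi w, Real.exp (-t) * t ^ (a - 1)

/-- The Fourier series with coefficients `c⁺(l, r)` in the holomorphic part and `c⁻(l, r)`,
`4ml - r² < 0`, in the non-holomorphic part. -/
def fourierSeries (k m : ℕ) (cp cm : ℤ → ℤ → ℂ) (p : ℂ × ℂ) : ℂ :=
  (∑' a : ℤ × ℤ, cp a.1 a.2 * monomial a.1 a.2 p) +
    ∑' a : ℤ × ℤ, if disc m a.1 a.2 < 0 then
      cm a.1 a.2 *
        (incGamma (3 / 2 - k) (-(disc m a.1 a.2 : ℝ) * Real.pi * p.1.im / m) : ℂ) *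
        monomial a.1 a.2 p else 0

/-! ### Test functions -/

/-- Piecewise smooth functions on `ℝ₊`: on either side of every point the function agrees near
that point with a smooth function, and its value there is one of the two one-sided limits. -/
def PiecewiseSmooth (φ : ℝ → ℂ) : Prop :=
  ∀ y : ℝ, 0 < y → ∃ ε : ℝ, 0 < ε ∧ ∃ g h : ℝ → ℂ,
    ContDiff ℝ (⊤ : ℕ∞) g ∧ ContDiff ℝ (⊤ : ℕ∞) h ∧
    (∀ x ∈ Set.Ioo (y - ε) y, φ x = g x) ∧ (∀ x ∈ Set.Ioo y (y + ε), φ x = h x) ∧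
    (φ y = g y ∨ φ y = h y)

/-- Complex-valued, compactly supported, piecewise smooth functions on `ℝ₊` (extended by `0`). -/
def IsTestFunction (φ : ℝ → ℂ) : Prop :=
  PiecewiseSmooth φ ∧ ∃ a b : ℝ, 0 < a ∧ ∀ x, x ∉ Set.Icc a b → φ x = 0

/-- `φ_s(x) = φ(x) x^{s-1}`. -/
def twist (φ : ℝ → ℂ) (s : ℂ) (x : ℝ) : ℂ := φ x * (x : ℂ) ^ (s - 1)

/-- `(φ|_{2-κ} S)(x) = x^{κ-2} φ(1/x)`, here for the weight `κ = k - 1/2`. -/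
def slashS (k : ℕ) (φ : ℝ → ℂ) (x : ℝ) : ℂ := (x : ℂ) ^ ((k : ℂ) - 5 / 2) * φ (1 / x)

/-- The Laplace transform. -/
def laplace (φ : ℝ → ℂ) (s : ℂ) : ℂ := ∫ t in Set.Ioi (0 : ℝ), exp (-(s * t)) * φ t

/-! ### The `L`-series

Components are indexed by `j = 1, …, 2m`. The numbers `n` with `n + j² ≡ 0 (mod 4m)` are
`n = 4ml - j²` with `l = (n + j²) / (4m) ∈ ℤ`, and the sums run over `l`. -/

/-- The label `1, …, 2m` of an element of `Fin (2 * m)`. -/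
def label {m : ℕ} (j : Fin (2 * m)) : ℤ := (j : ℤ) + 1

/-- The integral `(-πn/m)^{3/2-k} ∫_0^∞ (ℒψ)(-πn(2t+1)/(2m)) (1+t)^{-(k-1/2)} dt`, for `n < 0`. -/
def nonholTerm (k m : ℕ) (n : ℤ) (ψ : ℝ → ℂ) : ℂ :=
  ((-(Real.pi * n / m) : ℝ) : ℂ) ^ ((3 / 2 : ℂ) - k) *
    ∫ t in Set.Ioi (0 : ℝ),
      laplace ψ ((-(Real.pi * n * (2 * t + 1) / (2 * m)) : ℝ) : ℂ) /
        ((1 + t : ℝ) : ℂ) ^ ((k : ℂ) - 1 / 2)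

/-- The vector-valued `L`-series `L_F(φ)`. -/
def LSer (k m : ℕ) (cp cm : ℤ → ℤ → ℂ) (φ : ℝ → ℂ) (j : Fin (2 * m)) : ℂ :=
  (∑' l : ℤ, cp l (label j) *
      laplace φ ((Real.pi * disc m l (label j) / (2 * m) : ℝ) : ℂ)) +
    ∑' l : ℤ, if disc m l (label j) < 0 then
      cm l (label j) * nonholTerm k m (disc m l (label j)) (twist φ (5 / 2 - k)) else 0

/-- The vector-valued `L`-series `L_{α_k F}(φ)`. -/
def LSerAlpha (k m : ℕ) (cp cm : ℤ → ℤ → ℂ) (φ : ℝ → ℂ) (j : Fin (2 * m)) : ℂ :=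
  (2 * k - 1) / 4 * LSer k m cp cm φ j
    - 2 * Real.pi * (∑' l : ℤ, cp l (label j) * ((disc m l (label j) : ℂ) / (4 * m)) *
        laplace (twist φ 2) ((Real.pi * disc m l (label j) / (2 * m) : ℝ) : ℂ))
    - 2 * Real.pi * ∑' l : ℤ, if disc m l (label j) < 0 then
        cm l (label j) * ((disc m l (label j) : ℂ) / (4 * m)) *
          nonholTerm k m (disc m l (label j)) (twist φ (7 / 2 - k)) else 0

/-- The matrix of `ρ_m(S) : e_l ↦ (2im)^{-1/2} ∑_{l'} e^{-2πi l l' / (2m)} e_{l'}` for the Weil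
representation `ρ_m`. -/
def weilS (m : ℕ) : Matrix (Fin (2 * m)) (Fin (2 * m)) ℂ :=
  Matrix.of fun l' l =>
    1 / (2 * I * m : ℂ) ^ (1 / 2 : ℂ) *
      exp (-(2 * Real.pi * I * (label l * label l' : ℂ) / (2 * m)))

/-- The complex conjugate `ρ̄_m(S)`. -/
def weilSBar (m : ℕ) : Matrix (Fin (2 * m)) (Fin (2 * m)) ℂ :=
  (weilS m).map (starRingEnd ℂ)

end JacobiConverse

end

open Complex

noncomputable section

namespace JacobiConverse

open MeasureTheory Topology Filter

/-! The proof is a theta decomposition followed by a uniqueness argument. Grouping the Fourier terms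
by D = 4ml - r² and by r mod 2m gives F = Σ_s h_s(τ) θ_{m,s}(τ, z), where h_s is a q-series plus a
series of incomplete gamma terms over D < 0 (`fourierSeries_eq`). The theta functions carry all of
the dependence on z. Invariance under ℤ² is a shift of the theta sum, and invariance under T is
visible term by term, so only the behaviour of the vector (h_s) under S, in weight k - 1/2, has to
be extracted from the hypotheses.

Unfolding Laplace transforms turns L_F(φ)_j into ∫ h_j(it) φ(t) dt (`LSer_eq`), and L_{α_k F}(φ)_j
into the same integral of (2k-1)/4 h_j(it) + it ∂_u h_j(it) (`LSerAlpha_eq`). The substitution t ↦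
1/t moves φ|S onto h. Since the test functions are stable under φ ↦ φ(x) x^n, all moments of a
compactly supported function vanish, and Weierstrass approximation gives the functional equations
pointwise on the imaginary axis (`functional_equation_of_integrals`).

Two equations on the axis suffice because the h_s have ∂/∂τ̄ of the form v^{1/2-k} times an
antiholomorphic function, a shape preserved by S. The difference E of the two sides of the desired
law vanishes on the axis together with its normal derivative. Hence ∂E/∂τ̄ = 0 there, the identity
theorem kills the shadow of E, so E is holomorphic, and the identity theorem applies once more
(`eq_zero_of_cauchy_data`, `modular_of_axis`).

Applying S twice yields h_{-s} = h_s for even k. Combined with Poisson summation for the theta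
functions (`theta_S`) this gives invariance of F under S (`sum_theta_S`), and S, T generate SL₂(ℤ).
The Casimir equation follows from the heat equation for theta and the shape of ∂h_s/∂τ̄
(`casimir_sum_theta`). Real analyticity comes from writing the gamma terms as v^a times a
superposition of exponentials of linear forms. Growth holds because only the terms with D ≤ 0 of the
holomorphic part fail to decay. -/

/-! ### Real analyticity of superpositions of exponentials. -/

/-- Superpositions of exponentials of linear forms are analytic where they converge with room. -/
theorem analyticAt_integral_exp {X E : Type*} [MeasurableSpace X] {μ : Measure X}
    [NormedAddCommGroup E] [NormedSpace ℝ E]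
    {c : X → ℂ} {L : X → E →L[ℝ] ℂ} {x : E} {R : ℝ} (hR : 0 < R)
    (hc : AEStronglyMeasurable c μ) (hL : AEStronglyMeasurable L μ)
    (hint : Integrable (fun a => ‖c a‖ * Real.exp ((L a x).re + R * ‖L a‖)) μ) :
    AnalyticAt ℝ (fun y => ∫ a, c a * exp (L a y) ∂μ) x := by
  classical
  -- The degree n Taylor term of y ↦ c(a) exp(L_a y) at x; integrating over a gives the power series
  -- of the integral.
  let T (n : ℕ) (a : X) : ContinuousMultilinearMap ℝ (fun _ : Fin n => E) ℂ :=
    (c a * exp (L a x) / (n.factorial : ℂ)) •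
      (ContinuousMultilinearMap.mkPiAlgebraFin ℝ n ℂ).compContinuousLinearMap (fun _ => L a)
  have hTapp (n : ℕ) (a : X) (y : E) :
      T n a (fun _ => y) = c a * exp (L a x) / (n.factorial : ℂ) * (L a y) ^ n := by
    simp [T, ContinuousMultilinearMap.compContinuousLinearMap_apply]
  have hexpm : AEStronglyMeasurable (fun a => exp (L a x)) μ :=
    Complex.continuous_exp.comp_aestronglyMeasurable (hL.apply_continuousLinearMap x)
  have hTm (n : ℕ) : AEStronglyMeasurable (T n) μ := by
    refine AEStronglyMeasurable.smul (f := fun a => c a * exp (L a x) / (n.factorial : ℂ)) ?_ ?_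
    · simp_rw [div_eq_mul_inv]
      exact (hc.mul hexpm).mul_const _
    have : Continuous fun l : E →L[ℝ] ℂ =>
        (ContinuousMultilinearMap.mkPiAlgebraFin ℝ n ℂ).compContinuousLinearMap
          (fun _ : Fin n => l) := by
      have h1 := (ContinuousMultilinearMap.compContinuousLinearMapContinuousMultilinear ℝ
        (fun _ : Fin n => E) (fun _ : Fin n => ℂ) ℂ).cont
      have h2 : Continuous fun l : E →L[ℝ] ℂ => (fun _ : Fin n => l) :=
        continuous_pi fun _ => continuous_id
      have h3 := h1.comp h2
      exact (ContinuousLinearMap.apply ℝ _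
        (ContinuousMultilinearMap.mkPiAlgebraFin ℝ n ℂ)).continuous.comp h3
    exact this.comp_aestronglyMeasurable hL
  have hTn (n : ℕ) (a : X) : ‖T n a‖ ≤
      ‖c a‖ * Real.exp (L a x).re * (‖L a‖ ^ n / n.factorial) := by
    simp only [T, norm_smul]
    have h1 : ‖(ContinuousMultilinearMap.mkPiAlgebraFin ℝ n ℂ).compContinuousLinearMap
          (fun _ : Fin n => L a)‖ ≤ ‖L a‖ ^ n := by
      refine (ContinuousMultilinearMap.norm_compContinuousLinearMap_le _ _).trans ?_
      simp
    rw [norm_div, norm_mul, Complex.norm_exp, Complex.norm_natCast]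
    calc _ ≤ ‖c a‖ * Real.exp (L a x).re / n.factorial * ‖L a‖ ^ n := by gcongr
      _ = _ := by ring
  -- One term of the exponential series is at most its sum, so a single integrable majorant serves
  -- every n.
  have hTR (n : ℕ) (a : X) : ‖T n a‖ * R ^ n ≤
      ‖c a‖ * Real.exp ((L a x).re + R * ‖L a‖) := by
    calc _ ≤ ‖c a‖ * Real.exp (L a x).re * (‖L a‖ ^ n / n.factorial) * R ^ n := by
          gcongr; exact hTn n a
      _ = ‖c a‖ * Real.exp (L a x).re * ((R * ‖L a‖) ^ n / n.factorial) := by ring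
      _ ≤ ‖c a‖ * Real.exp (L a x).re * Real.exp (R * ‖L a‖) := by
          gcongr; exact Real.pow_div_factorial_le_exp _ (by positivity) n
      _ = _ := by rw [Real.exp_add]; ring
  have hTi (n : ℕ) : Integrable (T n) μ := by
    refine (hint.div_const (R ^ n)).mono' (hTm n) (Filter.Eventually.of_forall fun a => ?_)
    rw [le_div_iff₀ (by positivity)]
    exact hTR n a
  let p : FormalMultilinearSeries ℝ E ℂ := fun n => ∫ a, T n a ∂μ
  let r : NNReal := ⟨R, hR.le⟩
  refine ⟨p, (r : ENNReal), ?_, by exact_mod_cast (show (0 : NNReal) < r from hR), ?_⟩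
  · refine p.le_radius_of_bound (∫ a, ‖c a‖ * Real.exp ((L a x).re + R * ‖L a‖) ∂μ) fun n => ?_
    calc ‖p n‖ * (r : ℝ) ^ n ≤ (∫ a, ‖T n a‖ ∂μ) * R ^ n := by
          gcongr; exacts [norm_integral_le_integral_norm _, le_rfl]
      _ = ∫ a, ‖T n a‖ * R ^ n ∂μ := by rw [integral_mul_const]
      _ ≤ _ := integral_mono ((hTi n).norm.mul_const _) hint (hTR n)
  · intro y hy
    have hyR : ‖y‖ < R := by
      have : ‖y‖₊ < r := by
        simpa [enorm_eq_nnnorm] using (mem_eball_zero_iff.1 hy)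
      exact this
    have happ (n : ℕ) : p n (fun _ => y) = ∫ a, T n a (fun _ => y) ∂μ :=
      ContinuousMultilinearMap.integral_apply (hTi n) _
    have hint2 (n : ℕ) : Integrable (fun a => T n a (fun _ => y)) μ :=
      (ContinuousMultilinearMap.apply ℝ (fun _ : Fin n => E) ℂ
        (fun _ => y)).integrable_comp (hTi n)
    -- Being strictly inside the ball gains a geometric factor, which justifies exchanging sum and
    -- integral.
    have hbd2 (n : ℕ) (a : X) : ‖T n a (fun _ => y)‖ ≤
        (‖y‖ / R) ^ n * (‖c a‖ * Real.exp ((L a x).re + R * ‖L a‖)) := by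
      refine ((T n a).le_opNorm _).trans ?_
      simp only [Finset.prod_const, Finset.card_univ, Fintype.card_fin]
      calc ‖T n a‖ * ‖y‖ ^ n = (‖y‖ / R) ^ n * (‖T n a‖ * R ^ n) := by
            rw [div_pow]; field_simp
        _ ≤ _ := mul_le_mul_of_nonneg_left (hTR n a) (by positivity)
    have hsum : Summable fun n => ∫ a, ‖T n a (fun _ => y)‖ ∂μ := by
      refine Summable.of_nonneg_of_le (fun n => integral_nonneg fun a => norm_nonneg _)
        (fun n => (integral_mono (hint2 n).norm (hint.const_mul _) (hbd2 n)).trans_eq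
          (integral_const_mul _ _)) ?_
      refine Summable.mul_right _ (summable_geometric_of_lt_one (by positivity) ?_)
      rwa [div_lt_one hR]
    have := hasSum_integral_of_summable_integral_norm hint2 hsum
    simp only [happ]
    convert this using 2
    ext a
    rw [map_add, Complex.exp_add]
    simp_rw [hTapp]
    have h1 : HasSum (fun n : ℕ => (L a y) ^ n / n.factorial) (exp (L a y)) := by
      rw [Complex.exp_eq_exp_ℂ]
      exact NormedSpace.expSeries_div_hasSum_exp _
    rw [← mul_assoc, ← (h1.mul_left (c a * exp (L a x))).tsum_eq]
    congr 1; ext n; ring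

/-- The discrete case of `analyticAt_integral_exp`. -/
theorem analyticAt_tsum_exp {ι E : Type*} [Countable ι]
    [NormedAddCommGroup E] [NormedSpace ℝ E]
    {c : ι → ℂ} {L : ι → E →L[ℝ] ℂ} {x : E} {R : ℝ} (hR : 0 < R)
    (hsum : ∀ y ∈ Metric.ball x R, Summable fun a => ‖c a * exp (L a y)‖)
    (hint : Summable (fun a => ‖c a‖ * Real.exp ((L a x).re + R * ‖L a‖))) :
    AnalyticAt ℝ (fun y => ∑' a, c a * exp (L a y)) x := by
  let _ : MeasurableSpace ι := ⊤
  have : MeasurableSingletonClass ι := ⟨fun _ => trivial⟩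
  have h := analyticAt_integral_exp (μ := Measure.count) (c := c) (L := L) (x := x) hR
    (by fun_prop) StronglyMeasurable.of_discrete.aestronglyMeasurable ?_
  · refine h.congr ?_
    filter_upwards [Metric.ball_mem_nhds x hR] with y hy
    rw [integral_countable]
    · simp
    · rw [integrable_count_iff]; exact hsum y hy
  · rw [integrable_count_iff]; exact hint.norm

/-! ### Wirtinger derivatives in one variable -/

/-- The real-linear map `w ↦ a w + b w̄`. -/
def wirtingerCLM (a b : ℂ) : ℂ →L[ℝ] ℂ :=
  a • (ContinuousLinearMap.id ℝ ℂ) + b • (conjCLE : ℂ →L[ℝ] ℂ)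

@[simp] theorem wirtingerCLM_apply (a b w : ℂ) :
    wirtingerCLM a b w = a * w + b * (starRingEnd ℂ) w := by
  simp [wirtingerCLM]

theorem norm_wirtingerCLM_le (a b : ℂ) : ‖wirtingerCLM a b‖ ≤ ‖a‖ + ‖b‖ := by
  refine ContinuousLinearMap.opNorm_le_bound _ (by positivity) fun w => ?_
  rw [wirtingerCLM_apply, add_mul]
  refine (norm_add_le _ _).trans ?_
  simp

/-- `f` is real differentiable at `τ` with `∂f/∂τ = a` and `∂f/∂τ̄ = b`. -/
def HasWirtinger (f : ℂ → ℂ) (a b τ : ℂ) : Prop := HasFDerivAt f (wirtingerCLM a b) τ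

namespace HasWirtinger

variable {f g : ℂ → ℂ} {a b a' b' τ : ℂ}

theorem congr_coeff (h : HasWirtinger f a b τ) (ha : a = a') (hb : b = b') :
    HasWirtinger f a' b' τ := by subst ha hb; exact h

theorem of_hasDerivAt (h : HasDerivAt f a τ) : HasWirtinger f a 0 τ := by
  have := h.hasFDerivAt.restrictScalars ℝ
  refine this.congr_fderiv ?_
  ext
  simp [mul_comm]

theorem hasDerivAt (h : HasWirtinger f a 0 τ) : HasDerivAt f a τ := by
  rw [hasDerivAt_iff_hasFDerivAt]
  refine hasFDerivAt_of_restrictScalars ℝ h ?_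
  ext
  simp [mul_comm]

theorem add (hf : HasWirtinger f a b τ) (hg : HasWirtinger g a' b' τ) :
    HasWirtinger (fun x => f x + g x) (a + a') (b + b') τ := by
  refine (HasFDerivAt.add hf hg).congr_fderiv ?_
  ext
  simp
  ring

theorem sub (hf : HasWirtinger f a b τ) (hg : HasWirtinger g a' b' τ) :
    HasWirtinger (fun x => f x - g x) (a - a') (b - b') τ := by
  refine (HasFDerivAt.sub hf hg).congr_fderiv ?_
  ext
  simp
  ring

theorem mul (hf : HasWirtinger f a b τ) (hg : HasWirtinger g a' b' τ) :
    HasWirtinger (fun x => f x * g x) (a * g τ + f τ * a') (b * g τ + f τ * b') τ := by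
  refine (HasFDerivAt.mul hf hg).congr_fderiv ?_
  ext
  simp
  ring

theorem const_mul (c : ℂ) (hf : HasWirtinger f a b τ) :
    HasWirtinger (fun x => c * f x) (c * a) (c * b) τ := by
  refine (HasFDerivAt.const_mul hf c).congr_fderiv ?_
  ext
  simp
  ring

theorem sum {ι : Type*} {s : Finset ι} {f : ι → ℂ → ℂ} {a b : ι → ℂ}
    (h : ∀ i ∈ s, HasWirtinger (f i) (a i) (b i) τ) :
    HasWirtinger (fun x => ∑ i ∈ s, f i x) (∑ i ∈ s, a i) (∑ i ∈ s, b i) τ := by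
  refine (HasFDerivAt.fun_sum h).congr_fderiv ?_
  ext
  simp [Finset.sum_add_distrib, Finset.sum_mul]

theorem conj (h : HasWirtinger f a b τ) :
    HasWirtinger (fun x => (starRingEnd ℂ) (f x)) ((starRingEnd ℂ) b) ((starRingEnd ℂ) a) τ := by
  have := (conjCLE : ℂ →L[ℝ] ℂ).hasFDerivAt.comp τ (show HasFDerivAt f _ τ from h)
  refine this.congr_fderiv ?_
  ext
  simp
  ring

theorem comp_hasDerivAt {φ : ℂ → ℂ} {φ' : ℂ} (h : HasWirtinger f a b (φ τ))
    (hφ : HasDerivAt φ φ' τ) :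
    HasWirtinger (fun x => f (φ x)) (a * φ') (b * (starRingEnd ℂ) φ') τ := by
  have := HasFDerivAt.comp τ h (hφ.hasFDerivAt.restrictScalars ℝ)
  refine this.congr_fderiv ?_
  ext
  simp
  ring

/-- Because v = (τ - τ̄)/(2i), the two Wirtinger derivatives of a function of v are opposite. -/
theorem comp_im {g : ℝ → ℂ} {g' : ℂ} (h : HasDerivAt g g' τ.im) :
    HasWirtinger (fun x => g x.im) (g' / (2 * I)) (-(g' / (2 * I))) τ := by
  have := h.hasFDerivAt.comp τ (imCLM.hasFDerivAt (x := τ))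
  refine this.congr_fderiv ?_
  ext w
  have hw : (w.im : ℂ) * (2 * I) = w - (starRingEnd ℂ) w := by
    rw [sub_conj]; push_cast; ring
  simp only [ContinuousLinearMap.coe_comp, Function.comp_apply, imCLM_apply,
    ContinuousLinearMap.toSpanSingleton_apply, real_smul, wirtingerCLM_apply]
  have : (w.im : ℂ) = (w - (starRingEnd ℂ) w) / (2 * I) := by
    rw [← hw]; field_simp
  rw [this]; ring

/-- The real differential in the direction I is aI + b·conj I. This tangential derivative
complements a + b, the derivative normal to the axis. -/
theorem hasDerivAt_axis {t : ℝ} (h : HasWirtinger f a b (t * I)) :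
    HasDerivAt (fun s : ℝ => f (s * I)) (I * (a - b)) t := by
  have h1 : HasDerivAt (fun s : ℝ => (s : ℂ) * I) I t := by
    simpa using (ofRealCLM.hasDerivAt (x := t)).mul_const I
  have := (show HasFDerivAt f (wirtingerCLM a b) ((fun s : ℝ => (s : ℂ) * I) t) from h).comp_hasDerivAt t h1
  refine this.congr_deriv ?_
  simp; ring

theorem tsum {ι : Type*} {f : ι → ℂ → ℂ} {a b : ι → ℂ → ℂ} {u : ι → ℝ} {s : Set ℂ} (hu : Summable u)
    (hs : IsOpen s) (hs' : IsPreconnected s)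
    (h : ∀ i, ∀ x ∈ s, HasWirtinger (f i) (a i x) (b i x) x)
    (ha : ∀ i, ∀ x ∈ s, ‖a i x‖ ≤ u i) (hb : ∀ i, ∀ x ∈ s, ‖b i x‖ ≤ u i)
    (hτ : τ ∈ s) (hf : Summable fun i => f i τ) :
    HasWirtinger (fun x => ∑' i, f i x) (∑' i, a i τ) (∑' i, b i τ) τ := by
  have := hasFDerivAt_tsum_of_isPreconnected (hu.add hu) hs hs'
    (fun i x hx => (h i x hx : HasFDerivAt _ _ _))
    (fun i x hx => (norm_wirtingerCLM_le _ _).trans (add_le_add (ha i x hx) (hb i x hx))) hτ hf hτ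
  refine this.congr_fderiv ?_
  have hsum : Summable fun i => wirtingerCLM (a i τ) (b i τ) :=
    Summable.of_norm_bounded (hu.add hu) fun i =>
      (norm_wirtingerCLM_le _ _).trans (add_le_add (ha i τ hτ) (hb i τ hτ))
  have hsa : Summable fun i => a i τ := Summable.of_norm_bounded hu fun i => ha i τ hτ
  have hsb : Summable fun i => b i τ := Summable.of_norm_bounded hu fun i => hb i τ hτ
  refine ContinuousLinearMap.ext fun w => ?_
  have happ := (ContinuousLinearMap.apply ℝ ℂ w).map_tsum hsum
  simp only [ContinuousLinearMap.apply_apply] at happ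
  rw [happ, wirtingerCLM_apply, ← tsum_mul_right, ← tsum_mul_right,
    ← (hsa.mul_right _).tsum_add (hsb.mul_right _)]
  simp

end HasWirtinger

/-! ### Uniqueness -/

/-- The upper half plane as a subset of `ℂ`. -/
def upperHalf : Set ℂ := {τ | 0 < τ.im}

theorem isOpen_upperHalf : IsOpen upperHalf := isOpen_lt continuous_const continuous_im

theorem convex_upperHalf : Convex ℝ upperHalf := convex_halfSpace_im_gt 0

theorem ofReal_mul_I_mem_upperHalf {t : ℝ} (ht : 0 < t) : (t : ℂ) * I ∈ upperHalf := by
  simpa [upperHalf] using ht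

/-- Identity theorem: the zeros on the axis accumulate at i. -/
theorem eq_zero_of_axis {f : ℂ → ℂ} (hf : DifferentiableOn ℂ f upperHalf)
    (h0 : ∀ t : ℝ, 0 < t → f (t * I) = 0) {τ : ℂ} (hτ : τ ∈ upperHalf) : f τ = 0 := by
  have han := hf.analyticOnNhd isOpen_upperHalf
  have h1 := ofReal_mul_I_mem_upperHalf one_pos
  refine han.eqOn_zero_of_preconnected_of_frequently_eq_zero convex_upperHalf.isPreconnected h1 ?_ hτ
  have ht : Tendsto (fun t : ℝ => (t : ℂ) * I) (𝓝[≠] 1) (𝓝[≠] (((1 : ℝ) : ℂ) * I)) := by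
    refine tendsto_nhdsWithin_of_tendsto_nhds_of_eventually_within _ ?_ ?_
    · exact ((continuous_ofReal.mul continuous_const).tendsto 1).mono_left nhdsWithin_le_nhds
    · filter_upwards [self_mem_nhdsWithin] with t ht
      simpa using ht
  refine ht.frequently (Eventually.frequently ?_)
  filter_upwards [nhdsWithin_le_nhds (Ioi_mem_nhds zero_lt_one)] with t ht using h0 t ht

/-- A function whose `τ̄`-derivative is `v^q` times an antiholomorphic function vanishes when it
does so on the imaginary axis together with its normal derivative. -/
theorem eq_zero_of_cauchy_data {f a b g : ℂ → ℂ} {q : ℝ}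
    (hf : ∀ τ ∈ upperHalf, HasWirtinger f (a τ) (b τ) τ)
    (hb : ∀ τ ∈ upperHalf, b τ = (τ.im ^ q : ℝ) * (starRingEnd ℂ) (g τ))
    (hg : DifferentiableOn ℂ g upperHalf)
    (h0 : ∀ t : ℝ, 0 < t → f (t * I) = 0)
    (h1 : ∀ t : ℝ, 0 < t → a (t * I) + b (t * I) = 0) {τ : ℂ} (hτ : τ ∈ upperHalf) :
    f τ = 0 := by
  have hg0 : ∀ τ ∈ upperHalf, g τ = 0 := fun τ hτ => by
    refine eq_zero_of_axis hg (fun t ht => ?_) hτ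
    have hm := ofReal_mul_I_mem_upperHalf ht
    -- The tangential derivative gives a - b = 0 and the normal one a + b = 0, so b vanishes on the
    -- axis and hence so does g.
    have h2 := (hf _ hm).hasDerivAt_axis
    have h3 : HasDerivAt (fun s : ℝ => f (s * I)) 0 t := by
      refine (hasDerivAt_const t (0 : ℂ)).congr_of_eventuallyEq ?_
      filter_upwards [Ioi_mem_nhds ht] with s hs using h0 s hs
    have h4 := h2.unique h3
    have h5 : a (t * I) - b (t * I) = 0 := by simpa using h4
    have h6 : b (t * I) = 0 := by linear_combination (h1 t ht - h5) / 2
    rw [hb _ hm] at h6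
    simpa [Real.rpow_eq_zero_iff_of_nonneg ht.le, ht.ne', ← ofReal_cpow ht.le] using h6
  refine eq_zero_of_axis (fun x hx => ?_) h0 hτ
  have h7 := hf x hx
  rw [hb x hx, hg0 x hx, map_zero, mul_zero] at h7
  exact h7.hasDerivAt.differentiableAt.differentiableWithinAt

/-! ### The incomplete gamma function -/

/-- For a ≤ 1 the factor t^(a-1) is at most w^(a-1) on (w, ∞). The relevant parameter a = 3/2 - k
satisfies this. -/
theorem integrableOn_exp_neg_mul_rpow {a w : ℝ} (ha : a ≤ 1) (hw : 0 < w) :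
    IntegrableOn (fun t : ℝ => Real.exp (-t) * t ^ (a - 1)) (Set.Ioi w) := by
  refine ((integrableOn_exp_neg_Ioi w).mul_const (w ^ (a - 1))).mono' ?_ ?_
  · exact Measurable.aestronglyMeasurable (by fun_prop)
  · filter_upwards [ae_restrict_mem measurableSet_Ioi] with t ht
    have ht0 : 0 < t := hw.trans ht
    rw [Real.norm_eq_abs, abs_of_nonneg (by positivity)]
    gcongr ?_ * ?_
    exact Real.rpow_le_rpow_of_nonpos hw (le_of_lt ht) (by linarith)

theorem incGamma_nonneg {a w : ℝ} (hw : 0 < w) : 0 ≤ incGamma a w :=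
  setIntegral_nonneg measurableSet_Ioi fun t ht => by
    have : 0 < t := hw.trans ht
    positivity

theorem incGamma_le {a w : ℝ} (ha : a ≤ 1) (hw : 0 < w) :
    incGamma a w ≤ w ^ (a - 1) * Real.exp (-w) := by
  calc incGamma a w ≤ ∫ t in Set.Ioi w, Real.exp (-t) * w ^ (a - 1) := by
        refine setIntegral_mono_on (integrableOn_exp_neg_mul_rpow ha hw)
          ((integrableOn_exp_neg_Ioi w).mul_const _) measurableSet_Ioi fun t ht => ?_
        gcongr ?_ * ?_
        exact Real.rpow_le_rpow_of_nonpos hw (le_of_lt ht) (by linarith)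
    _ = _ := by rw [integral_mul_const, integral_exp_neg_Ioi, mul_comm]

theorem hasDerivAt_incGamma {a w : ℝ} (ha : a ≤ 1) (hw : 0 < w) :
    HasDerivAt (incGamma a) (-(Real.exp (-w) * w ^ (a - 1))) w := by
  have hc : 0 < w / 2 := by positivity
  have hii : IntegrableOn (fun t : ℝ => Real.exp (-t) * t ^ (a - 1)) (Set.Ioi (w / 2)) :=
    integrableOn_exp_neg_mul_rpow ha hc
  have hcont : ContinuousAt (fun t : ℝ => Real.exp (-t) * t ^ (a - 1)) w :=
    (by fun_prop : ContinuousAt (fun t : ℝ => Real.exp (-t)) w).mul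
      (Real.continuousAt_rpow_const _ _ (Or.inl hw.ne'))
  have h1 : HasDerivAt (fun y => incGamma a (w / 2) -
      ∫ t in (w / 2)..y, Real.exp (-t) * t ^ (a - 1)) (-(Real.exp (-w) * w ^ (a - 1))) w := by
    refine HasDerivAt.const_sub _ (intervalIntegral.integral_hasDerivAt_right ?_ ?_ hcont)
    · rw [intervalIntegrable_iff_integrableOn_Ioc_of_le (by linarith)]
      exact hii.mono_set Set.Ioc_subset_Ioi_self
    · exact Measurable.stronglyMeasurable (by fun_prop) |>.stronglyMeasurableAtFilter
  refine h1.congr_of_eventuallyEq ?_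
  filter_upwards [Ioi_mem_nhds (show w / 2 < w by linarith)] with y hy
  rw [← intervalIntegral.integral_Ioi_sub_Ioi hii (le_of_lt hy)]
  simp [incGamma]

/-- Substitute t = w(1 + s). In this form w enters only through a power and a linear exponent, which
serves both the comparison with the integrals in the L-series and real analyticity in τ. -/
theorem incGamma_eq {a w : ℝ} (hw : 0 < w) :
    incGamma a w = w ^ a * ∫ s in Set.Ioi (0 : ℝ), Real.exp (-w * (1 + s)) * (1 + s) ^ (a - 1) := by
  have h1 : incGamma a w = ∫ x in Set.Ioi (0 : ℝ), Real.exp (-(w + x)) * (w + x) ^ (a - 1) := by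
    have := (measurePreserving_add_left volume w).setIntegral_preimage_emb
      (measurableEmbedding_addLeft w) (fun t : ℝ => Real.exp (-t) * t ^ (a - 1)) (Set.Ioi w)
    simpa [incGamma] using this.symm
  have h2 := integral_comp_mul_left_Ioi
    (fun x : ℝ => Real.exp (-(w + x)) * (w + x) ^ (a - 1)) 0 hw
  rw [mul_zero, ← h1, smul_eq_mul] at h2
  have h3 : incGamma a w = w * ∫ x in Set.Ioi (0 : ℝ),
      Real.exp (-(w + w * x)) * (w + w * x) ^ (a - 1) := by
    rw [h2]; field_simp
  rw [h3, ← integral_const_mul, ← integral_const_mul]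
  refine setIntegral_congr_fun measurableSet_Ioi fun s hs => ?_
  have hs0 : 0 < 1 + s := by linarith [Set.mem_Ioi.1 hs]
  have e1 : w + w * s = w * (1 + s) := by ring
  have e2 : w ^ a = w * w ^ (a - 1) := by
    rw [Real.rpow_sub_one hw.ne']; field_simp
  simp only [e1, e2, neg_mul]
  rw [Real.mul_rpow hw.le hs0.le]; ring

/-! ### Subexponential coefficients -/

/-- Coefficients for which the associated `q`-series converge. -/
def Subexp (b : ℤ → ℂ) : Prop :=
  ∀ δ : ℝ, 0 < δ → Summable fun D : ℤ => ‖b D‖ * Real.exp (-δ * |(D : ℝ)|)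

theorem summable_exp_neg_abs_int {δ : ℝ} (hδ : 0 < δ) :
    Summable fun D : ℤ => Real.exp (-δ * |(D : ℝ)|) := by
  have hn : Summable fun n : ℕ => Real.exp (-δ * n) := by
    have := Real.summable_exp_nat_mul_iff.2 (show -δ < 0 by linarith)
    simpa [mul_comm] using this
  refine Summable.of_nat_of_neg ?_ ?_ <;> simpa using hn

theorem Subexp.of_bound {b : ℤ → ℂ} {A C : ℝ}
    (h : ∀ D, ‖b D‖ ≤ A * Real.exp (C * √|(D : ℝ)|)) : Subexp b := by
  intro δ hδ
  have h2 := (summable_exp_neg_abs_int (half_pos hδ)).mul_left (|A| * Real.exp (C ^ 2 / (2 * δ)))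
  refine Summable.of_nonneg_of_le (fun D => by positivity) (fun D => ?_) h2
  -- Completing the square in √|D| spends half of the decay rate δ.
  have hx : C * √|(D : ℝ)| ≤ C ^ 2 / (2 * δ) + δ / 2 * |(D : ℝ)| := by
    have hs := Real.sq_sqrt (abs_nonneg (D : ℝ))
    set x := √|(D : ℝ)|
    have : C ^ 2 / (2 * δ) + δ / 2 * x ^ 2 - C * x = (C - δ * x) ^ 2 / (2 * δ) := by
      field_simp; ring
    have h3 : 0 ≤ (C - δ * x) ^ 2 / (2 * δ) := by positivity
    rw [← hs]; linarith
  calc ‖b D‖ * Real.exp (-δ * |(D : ℝ)|)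
      ≤ |A| * Real.exp (C ^ 2 / (2 * δ) + δ / 2 * |(D : ℝ)|) * Real.exp (-δ * |(D : ℝ)|) := by
        gcongr
        refine (h D).trans ?_
        gcongr
        exact le_abs_self A
    _ = _ := by
        rw [mul_assoc, ← Real.exp_add, mul_assoc, ← Real.exp_add]
        congr 2; ring

theorem Subexp.of_norm_le {b b' : ℤ → ℂ} (hb : Subexp b) {K : ℝ}
    (h : ∀ D, ‖b' D‖ ≤ K * ‖b D‖) : Subexp b' := fun δ hδ =>
  Summable.of_nonneg_of_le (fun D => by positivity)
    (fun D => (mul_le_mul_of_nonneg_right (h D) (Real.exp_pos _).le).trans_eq (mul_assoc _ _ _))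
    ((hb δ hδ).mul_left K)

/-- A linear factor in D costs only half of the exponential decay; this covers differentiated and
shadow coefficients. -/
theorem Subexp.of_norm_le_mul_abs {b b' : ℤ → ℂ} (hb : Subexp b) {K : ℝ}
    (h : ∀ D, ‖b' D‖ ≤ K * |(D : ℝ)| * ‖b D‖) : Subexp b' := fun δ hδ => by
  refine Summable.of_nonneg_of_le (fun D => by positivity) (fun D => ?_)
    ((hb (δ / 2) (half_pos hδ)).mul_left (|K| * (2 / δ)))
  have h1 : |(D : ℝ)| ≤ 2 / δ * Real.exp (δ / 2 * |(D : ℝ)|) := by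
    have := Real.add_one_le_exp (δ / 2 * |(D : ℝ)|)
    rw [div_mul_eq_mul_div, le_div_iff₀ hδ]
    nlinarith
  calc ‖b' D‖ * Real.exp (-δ * |(D : ℝ)|)
      ≤ |K| * |(D : ℝ)| * ‖b D‖ * Real.exp (-δ * |(D : ℝ)|) := by
        gcongr
        refine (h D).trans ?_
        gcongr
        exact le_abs_self K
    _ ≤ |K| * (2 / δ * Real.exp (δ / 2 * |(D : ℝ)|)) * ‖b D‖ * Real.exp (-δ * |(D : ℝ)|) := by
        gcongr
    _ = |K| * (2 / δ) * (‖b D‖ * (Real.exp (δ / 2 * |(D : ℝ)|) * Real.exp (-δ * |(D : ℝ)|))) := by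
        ring
    _ = _ := by rw [← Real.exp_add]; congr 3; ring

theorem Subexp.comp_neg {b : ℤ → ℂ} (hb : Subexp b) : Subexp fun D => b (-D) := fun δ hδ => by
  have := (Equiv.neg ℤ).summable_iff.2 (hb δ hδ)
  refine this.congr fun D => ?_
  simp

/-! ### The component series -/

/-- `e^{2πi D τ / 4m}`. -/
def qExp (m : ℕ) (D : ℤ) (τ : ℂ) : ℂ := exp (2 * Real.pi * I * (D / (4 * m)) * τ)

/-- The series `∑ b(D) e^{2πi D τ / 4m}`. -/
def holSeries (m : ℕ) (b : ℤ → ℂ) (τ : ℂ) : ℂ := ∑' D : ℤ, b D * qExp m D τ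

/-- The series `∑ b(D) Γ(a, -Dπv/m) e^{2πi D τ / 4m}`. -/
def nonSeries (a : ℝ) (m : ℕ) (b : ℤ → ℂ) (τ : ℂ) : ℂ :=
  ∑' D : ℤ, b D * (incGamma a (-(D : ℝ) * Real.pi * τ.im / m) : ℂ) * qExp m D τ

/-- The coefficients of `∂/∂u` of a series. -/
def derivCoeff (m : ℕ) (b : ℤ → ℂ) (D : ℤ) : ℂ := 2 * Real.pi * I * (D / (4 * m)) * b D

/-- The coefficients of the shadow of `nonSeries a m b`. -/
def shadowCoeff (a : ℝ) (m : ℕ) (b : ℤ → ℂ) (D : ℤ) : ℂ :=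
  (starRingEnd ℂ) (b (-D)) * (I / 2) * ((Real.pi * D / m : ℝ) ^ a : ℝ)

theorem norm_qExp (m : ℕ) (D : ℤ) (τ : ℂ) :
    ‖qExp m D τ‖ = Real.exp (-(Real.pi / (2 * m)) * D * τ.im) := by
  rw [qExp, Complex.norm_exp]
  congr 1
  have : (2 * Real.pi * I * (D / (4 * m)) * τ : ℂ) = ((2 * Real.pi * (D / (4 * m)) : ℝ) : ℂ) * (I * τ) := by
    push_cast; ring
  rw [this, re_ofReal_mul, I_mul_re]
  ring

theorem hasDerivAt_qExp (m : ℕ) (D : ℤ) (τ : ℂ) :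
    HasDerivAt (qExp m D) (2 * Real.pi * I * (D / (4 * m)) * qExp m D τ) τ := by
  have := ((hasDerivAt_id τ).const_mul (2 * Real.pi * I * (D / (4 * m)) : ℂ)).cexp
  refine this.congr_deriv ?_
  simp [qExp]; ring

theorem norm_derivCoeff_le (m : ℕ) (b : ℤ → ℂ) (D : ℤ) :
    ‖derivCoeff m b D‖ ≤ 2 * Real.pi / (4 * m) * |(D : ℝ)| * ‖b D‖ := by
  rw [derivCoeff]
  simp only [norm_mul, norm_div, Complex.norm_ofNat, Complex.norm_real, Complex.norm_I,
    Complex.norm_intCast, Complex.norm_natCast, Real.norm_eq_abs, abs_of_pos Real.pi_pos]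
  apply le_of_eq
  ring

theorem Subexp.derivCoeff {b : ℤ → ℂ} (hb : Subexp b) (m : ℕ) : Subexp (derivCoeff m b) :=
  hb.of_norm_le_mul_abs (norm_derivCoeff_le m b)

/-! ### The holomorphic series. -/

section Hol

variable {m : ℕ} {b : ℤ → ℂ} {N : ℕ}

/-- Terms with D ≥ 0 decay at least at the rate of the lower edge δ. The finitely many terms with -N
≤ D < 0 grow with v, so an upper edge M is needed, and the constant e^{π(M+δ)N/(2m)} absorbs them.
-/
theorem norm_holSeries_term_le (hN : ∀ D : ℤ, D < -N → b D = 0) {τ : ℂ} {δ M : ℝ}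
    (hδ : 0 < δ) (h1 : δ ≤ τ.im) (h2 : τ.im ≤ M) (D : ℤ) :
    ‖b D * qExp m D τ‖ ≤ Real.exp (Real.pi / (2 * m) * (M + δ) * N) *
      (‖b D‖ * Real.exp (-(Real.pi / (2 * m) * δ) * |(D : ℝ)|)) := by
  by_cases hD : D < -N
  · simp [hN D hD]
  have hD' : -(N : ℝ) ≤ D := by exact_mod_cast not_lt.1 hD
  rw [norm_mul, norm_qExp, mul_left_comm, ← Real.exp_add]
  gcongr
  set α := Real.pi / (2 * m)
  have hα : 0 ≤ α := by positivity
  have hN0 : (0 : ℝ) ≤ N := by positivity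
  have key : -(D : ℝ) * τ.im ≤ (M + δ) * N - δ * |(D : ℝ)| := by
    rcases le_total 0 (D : ℝ) with h | h
    · rw [abs_of_nonneg h]
      have : 0 ≤ (M + δ) * N := mul_nonneg (by linarith) hN0
      nlinarith
    · rw [abs_of_nonpos h]
      nlinarith [mul_nonneg (show 0 ≤ -(D : ℝ) by linarith) (show 0 ≤ M - τ.im by linarith),
        mul_nonneg (show 0 ≤ N + (D : ℝ) by linarith) (show 0 ≤ M + δ by linarith)]
  nlinarith [mul_le_mul_of_nonneg_left key hα]

theorem summable_holSeries (hm : 0 < m) (hb : Subexp b) (hN : ∀ D : ℤ, D < -N → b D = 0) {τ : ℂ}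
    (hτ : τ ∈ upperHalf) : Summable fun D => ‖b D * qExp m D τ‖ := by
  have hv : 0 < τ.im := hτ
  have hα : 0 < Real.pi / (2 * m) * τ.im := by positivity
  exact Summable.of_nonneg_of_le (fun _ => norm_nonneg _)
    (norm_holSeries_term_le hN hv le_rfl le_rfl) ((hb _ hα).mul_left _)

theorem isOpen_strip (δ M : ℝ) : IsOpen {x : ℂ | δ < x.im ∧ x.im < M} :=
  (isOpen_lt continuous_const continuous_im).inter (isOpen_lt continuous_im continuous_const)

theorem isPreconnected_strip (δ M : ℝ) : IsPreconnected {x : ℂ | δ < x.im ∧ x.im < M} :=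
  ((convex_halfSpace_im_gt δ).inter (convex_halfSpace_im_lt M)).isPreconnected

theorem derivCoeff_eq_zero (hN : ∀ D : ℤ, D < -N → b D = 0) (D : ℤ) (hD : D < -N) :
    derivCoeff m b D = 0 := by simp [derivCoeff, hN D hD]

theorem hasDerivAt_holSeries (hm : 0 < m) (hb : Subexp b) (hN : ∀ D : ℤ, D < -N → b D = 0) {τ : ℂ}
    (hτ : τ ∈ upperHalf) :
    HasDerivAt (holSeries m b) (holSeries m (derivCoeff m b) τ) τ := by
  have hv : 0 < τ.im := hτ
  have hα : 0 < Real.pi / (2 * m) * (τ.im / 2) := by positivity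
  have hmem : τ ∈ {x : ℂ | τ.im / 2 < x.im ∧ x.im < τ.im + 1} := ⟨by linarith, by linarith⟩
  have := hasDerivAt_tsum_of_isPreconnected (t := {x : ℂ | τ.im / 2 < x.im ∧ x.im < τ.im + 1})
    (g := fun D x => b D * qExp m D x) (g' := fun D x => derivCoeff m b D * qExp m D x)
    (((hb.derivCoeff m) _ hα).mul_left
      (Real.exp (Real.pi / (2 * m) * (τ.im + 1 + τ.im / 2) * N)))
    (isOpen_strip _ _) (isPreconnected_strip _ _)
    (fun D x _ => ((hasDerivAt_qExp m D x).const_mul (b D)).congr_deriv (by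
      simp only [derivCoeff]; ring))
    (fun D x hx => norm_holSeries_term_le (derivCoeff_eq_zero hN) (half_pos hv) hx.1.le hx.2.le D)
    hmem (summable_holSeries hm hb hN hτ).of_norm hmem
  exact this

theorem differentiableOn_holSeries (hm : 0 < m) (hb : Subexp b)
    (hN : ∀ D : ℤ, D < -N → b D = 0) : DifferentiableOn ℂ (holSeries m b) upperHalf :=
  fun _ hτ => (hasDerivAt_holSeries hm hb hN hτ).differentiableAt.differentiableWithinAt

theorem analyticAt_holSeries (hm : 0 < m) (hb : Subexp b)
    (hN : ∀ D : ℤ, D < -N → b D = 0) {τ : ℂ} (hτ : τ ∈ upperHalf) :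
    AnalyticAt ℝ (holSeries m b) τ :=
  ((differentiableOn_holSeries hm hb hN).analyticOnNhd isOpen_upperHalf τ hτ).restrictScalars

end Hol

/-! ### The non-holomorphic series and its shadow. -/

section Non

variable {a : ℝ} {m : ℕ} {b : ℤ → ℂ}

/-- A bound for `w^{a-1} e^{-w} |e^{2πi D τ / 4m}|`, `w = -Dπv/m`. -/
theorem rpow_mul_exp_mul_norm_qExp_le (ha : a ≤ 1) (hm : 0 < m) {D : ℤ} (hD : D < 0) {τ : ℂ} {δ : ℝ}
    (hδ : 0 < δ) (h1 : δ ≤ τ.im) :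
    (-(D : ℝ) * Real.pi * τ.im / m) ^ (a - 1) * Real.exp (-(-(D : ℝ) * Real.pi * τ.im / m)) *
      ‖qExp m D τ‖ ≤
      (Real.pi * δ / m) ^ (a - 1) * Real.exp (-(Real.pi / (2 * m) * δ) * |(D : ℝ)|) := by
  have hD1 : (D : ℝ) ≤ -1 := by exact_mod_cast (show D ≤ -1 by omega)
  have hv : 0 < τ.im := hδ.trans_le h1
  rw [mul_assoc, norm_qExp, ← Real.exp_add]
  gcongr ?_ * Real.exp ?_
  · refine Real.rpow_le_rpow_of_nonpos (by positivity) ?_ (by linarith)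
    gcongr
    all_goals nlinarith [Real.pi_pos]
  · rw [abs_of_neg (by linarith)]
    -- The gamma factor decays at twice the rate at which |q^D| grows for D < 0, so half of its
    -- decay survives.
    have : -(-(D : ℝ) * Real.pi * τ.im / m) + -(Real.pi / (2 * m)) * D * τ.im =
        Real.pi / (2 * m) * (D * τ.im) := by field_simp; ring
    rw [this]
    have h3 : (D : ℝ) * τ.im ≤ D * δ := mul_le_mul_of_nonpos_left h1 (by linarith)
    nlinarith [mul_le_mul_of_nonneg_left h3 (show 0 ≤ Real.pi / (2 * m) by positivity)]

theorem weight_pos (hm : 0 < m) {D : ℤ} (hD : D < 0) {v : ℝ} (hv : 0 < v) :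
    0 < -(D : ℝ) * Real.pi * v / m := by
  have hD1 : 0 < -(D : ℝ) := by exact_mod_cast (show 0 < -D by omega)
  positivity

theorem norm_nonSeries_term_le (ha : a ≤ 1) (hm : 0 < m) (hN : ∀ D : ℤ, 0 ≤ D → b D = 0) {τ : ℂ}
    {δ : ℝ} (hδ : 0 < δ) (h1 : δ ≤ τ.im) (D : ℤ) :
    ‖b D * (incGamma a (-(D : ℝ) * Real.pi * τ.im / m) : ℂ) * qExp m D τ‖ ≤
      (Real.pi * δ / m) ^ (a - 1) * (‖b D‖ * Real.exp (-(Real.pi / (2 * m) * δ) * |(D : ℝ)|)) := by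
  rcases le_or_gt 0 D with hD | hD
  · simp [hN D hD]
  have hw := weight_pos hm hD (hδ.trans_le h1)
  rw [norm_mul, norm_mul, norm_real, Real.norm_eq_abs, abs_of_nonneg (incGamma_nonneg hw)]
  calc _ ≤ ‖b D‖ * ((-(D : ℝ) * Real.pi * τ.im / m) ^ (a - 1) *
        Real.exp (-(-(D : ℝ) * Real.pi * τ.im / m))) * ‖qExp m D τ‖ := by
        gcongr; exact incGamma_le ha hw
    _ = ‖b D‖ * ((-(D : ℝ) * Real.pi * τ.im / m) ^ (a - 1) *
        Real.exp (-(-(D : ℝ) * Real.pi * τ.im / m)) * ‖qExp m D τ‖) := by ring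
    _ ≤ ‖b D‖ * _ := mul_le_mul_of_nonneg_left
        (rpow_mul_exp_mul_norm_qExp_le ha hm hD hδ h1) (norm_nonneg _)
    _ = _ := by ring

theorem summable_nonSeries (ha : a ≤ 1) (hm : 0 < m) (hb : Subexp b)
    (hN : ∀ D : ℤ, 0 ≤ D → b D = 0) {τ : ℂ} (hτ : τ ∈ upperHalf) :
    Summable fun D => ‖b D * (incGamma a (-(D : ℝ) * Real.pi * τ.im / m) : ℂ) * qExp m D τ‖ := by
  have hv : 0 < τ.im := hτ
  exact Summable.of_nonneg_of_le (fun _ => norm_nonneg _)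
    (norm_nonSeries_term_le ha hm hN hv le_rfl) ((hb _ (by positivity)).mul_left _)

/-- The exponential factor produced by differentiating Γ turns q^D into an antiholomorphic
exponential, as v = (τ - τ̄)/(2i). This makes the τ̄-derivative of the series a power of v times a
conjugate holomorphic series. -/
theorem exp_mul_qExp (hm : 0 < m) (D : ℤ) (τ : ℂ) :
    (Real.exp (-(-(D : ℝ) * Real.pi * τ.im / m)) : ℂ) * qExp m D τ =
      (starRingEnd ℂ) (qExp m (-D) τ) := by
  rw [qExp, qExp, ← exp_conj, ofReal_exp, ← exp_add]
  congr 1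
  have h1 : (τ.im : ℂ) * (2 * I) = τ - (starRingEnd ℂ) τ := by
    rw [sub_conj]; push_cast; ring
  have h2 : (τ.im : ℂ) = (τ - (starRingEnd ℂ) τ) / (2 * I) := by rw [← h1]; field_simp
  simp only [map_mul, map_div₀, conj_ofReal, conj_I, map_ofNat, map_natCast, map_intCast]
  push_cast
  rw [h2]
  have hm' : (m : ℂ) ≠ 0 := by exact_mod_cast hm.ne'
  field_simp
  ring_nf
  simp

/-- Only D ≥ 1 contributes, and there D^a ≤ D since a ≤ 1. -/
theorem norm_shadowCoeff_le (ha : a ≤ 1) (hm : 0 < m) (hN : ∀ D : ℤ, 0 ≤ D → b D = 0) (D : ℤ) :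
    ‖shadowCoeff a m b D‖ ≤ (Real.pi / m) ^ a * |(D : ℝ)| * ‖b (-D)‖ := by
  rcases le_or_gt D 0 with hD | hD
  · simp [shadowCoeff, hN (-D) (by omega)]
  have hD1 : (1 : ℝ) ≤ D := by exact_mod_cast hD
  have hD0 : (0 : ℝ) < D := by linarith
  simp only [shadowCoeff, norm_mul, norm_div, RCLike.norm_conj, Complex.norm_I, norm_real,
    Complex.norm_ofNat, Real.norm_eq_abs]
  rw [abs_of_nonneg (by positivity), abs_of_pos hD0, mul_div_right_comm,
    Real.mul_rpow (by positivity) (by positivity)]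
  have h1 : (D : ℝ) ^ a ≤ D := by
    calc (D : ℝ) ^ a ≤ (D : ℝ) ^ (1 : ℝ) := Real.rpow_le_rpow_of_exponent_le hD1 ha
      _ = D := Real.rpow_one _
  have h2 : (Real.pi / m) ^ a * (D : ℝ) ^ a ≤ (Real.pi / m) ^ a * D := by gcongr
  have h3 : 0 ≤ (Real.pi / m) ^ a * (D : ℝ) ^ a := by positivity
  have h4 := norm_nonneg (b (-D))
  nlinarith [mul_le_mul_of_nonneg_left h2 h4, mul_nonneg h4 h3]

theorem Subexp.shadowCoeff (ha : a ≤ 1) (hm : 0 < m) (hb : Subexp b)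
    (hN : ∀ D : ℤ, 0 ≤ D → b D = 0) : Subexp (shadowCoeff a m b) :=
  hb.comp_neg.of_norm_le_mul_abs (norm_shadowCoeff_le ha hm hN)

/-- The bound is written with a natural number so as to be the support hypothesis of the holomorphic
series with N = 0. -/
theorem shadowCoeff_eq_zero (hN : ∀ D : ℤ, 0 ≤ D → b D = 0) (D : ℤ) (hD : D < -(0 : ℕ)) :
    JacobiConverse.shadowCoeff a m b D = 0 := by
  simp at hD
  simp [JacobiConverse.shadowCoeff, hN (-D) (by omega)]

theorem conj_holSeries_shadowCoeff (τ : ℂ) :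
    (starRingEnd ℂ) (holSeries m (shadowCoeff a m b) τ) =
      ∑' D : ℤ, b D * (-(I / 2)) * ((Real.pi * -(D : ℝ) / m : ℝ) ^ a : ℝ) *
        (starRingEnd ℂ) (qExp m (-D) τ) := by
  rw [holSeries, conj_tsum, ← (Equiv.neg ℤ).tsum_eq]
  refine tsum_congr fun D => ?_
  simp only [JacobiConverse.shadowCoeff, Equiv.neg_apply, neg_neg, map_mul, conj_conj, map_div₀, conj_I, map_ofNat,
    conj_ofReal, Int.cast_neg]
  ring

/-- The τ̄-derivative falls only on the gamma factor. The sum of the two Wirtinger derivatives is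
∂/∂u, which does not see v and so acts only on the exponentials; this determines the τ-derivative.
-/
theorem hasWirtinger_nonSeries (ha : a ≤ 1) (hm : 0 < m) (hb : Subexp b)
    (hN : ∀ D : ℤ, 0 ≤ D → b D = 0) {τ : ℂ} (hτ : τ ∈ upperHalf) :
    HasWirtinger (nonSeries a m b)
      (nonSeries a m (derivCoeff m b) τ -
        (τ.im ^ (a - 1) : ℝ) * (starRingEnd ℂ) (holSeries m (shadowCoeff a m b) τ))
      ((τ.im ^ (a - 1) : ℝ) * (starRingEnd ℂ) (holSeries m (shadowCoeff a m b) τ)) τ := by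
  have hv : 0 < τ.im := hτ
  let G (D : ℤ) (v : ℝ) : ℝ := incGamma a (-(D : ℝ) * Real.pi * v / m)
  let W (D : ℤ) (v : ℝ) : ℝ := -(D : ℝ) * Real.pi * v / m
  let G' (D : ℤ) (v : ℝ) : ℝ :=
    -(Real.exp (-W D v) * W D v ^ (a - 1)) * (-(D : ℝ) * Real.pi / m)
  -- The τ̄-derivative of one term; A is its τ-derivative, written as ∂/∂u minus B.
  let B (D : ℤ) (x : ℂ) : ℂ := b D * (-((G' D x.im : ℂ) / (2 * I)) * qExp m D x)
  let A (D : ℤ) (x : ℂ) : ℂ := derivCoeff m b D * (G D x.im : ℂ) * qExp m D x - B D x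
  have hNd : ∀ D : ℤ, 0 ≤ D → derivCoeff m b D = 0 := fun D hD => by simp [derivCoeff, hN D hD]
  have hG (D : ℤ) (hD : D < 0) (v : ℝ) (hv : 0 < v) : HasDerivAt (G D) (G' D v) v := by
    have h1 := hasDerivAt_incGamma ha (weight_pos hm hD hv)
    have h2 : HasDerivAt (W D) (-(D : ℝ) * Real.pi / m) v := by
      have := ((hasDerivAt_id v).const_mul (-(D : ℝ) * Real.pi)).div_const (m : ℝ)
      rw [mul_one] at this
      exact this
    exact h1.comp v h2
  have hterm (D : ℤ) (x : ℂ) (hx : 0 < x.im) :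
      HasWirtinger (fun y => b D * (G D y.im : ℂ) * qExp m D y) (A D x) (B D x) x := by
    rcases le_or_gt 0 D with hD | hD
    · have : HasWirtinger (fun _ => (0 : ℂ)) 0 0 x :=
        HasWirtinger.of_hasDerivAt (hasDerivAt_const x 0)
      refine HasWirtinger.congr_coeff (by simpa [hN D hD] using this) ?_ ?_
      · simp [A, B, hN D hD, hNd D hD]
      · simp [B, hN D hD]
    · have h1 := HasWirtinger.comp_im (τ := x) (hG D hD x.im hx).ofReal_comp
      have h2 := (h1.mul (HasWirtinger.of_hasDerivAt (hasDerivAt_qExp m D x))).const_mul (b D)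
      refine HasWirtinger.congr_coeff (by simpa [mul_assoc] using h2) ?_ ?_
      · simp only [A, B, derivCoeff]; ring
      · simp only [B]; ring
  have hB (D : ℤ) {x : ℂ} {δ : ℝ} (hδ : 0 < δ) (hx : δ ≤ x.im) : ‖B D x‖ ≤
      Real.pi / m * (Real.pi * δ / m) ^ (a - 1) * (‖((|(D : ℝ)| : ℝ) : ℂ) * b D‖ *
        Real.exp (-(Real.pi / (2 * m) * δ) * |(D : ℝ)|)) := by
    rcases le_or_gt 0 D with hD | hD
    · simp [B, hN D hD]
    have hw := weight_pos hm hD (hδ.trans_le hx)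
    have hD1 : (D : ℝ) < 0 := by exact_mod_cast hD
    have e1 : ‖B D x‖ = ‖b D‖ * (Real.pi / (2 * m)) * |(D : ℝ)| *
        (W D x.im ^ (a - 1) * Real.exp (-W D x.im) * ‖qExp m D x‖) := by
      simp only [B, G', norm_mul, norm_neg, norm_div, norm_real, Complex.norm_I, Complex.norm_ofNat,
        Real.norm_eq_abs, Real.abs_exp, abs_of_pos Real.pi_pos,
        Nat.abs_cast]
      rw [abs_of_nonneg (show 0 ≤ W D x.im ^ (a - 1) from Real.rpow_nonneg hw.le _)]
      field_simp
    rw [e1]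
    have h2 := rpow_mul_exp_mul_norm_qExp_le ha hm hD hδ hx
    calc _ ≤ ‖b D‖ * (Real.pi / (2 * m)) * |(D : ℝ)| * ((Real.pi * δ / m) ^ (a - 1) *
          Real.exp (-(Real.pi / (2 * m) * δ) * |(D : ℝ)|)) := by gcongr
      _ ≤ ‖b D‖ * (Real.pi / m) * |(D : ℝ)| * ((Real.pi * δ / m) ^ (a - 1) *
          Real.exp (-(Real.pi / (2 * m) * δ) * |(D : ℝ)|)) := by
          gcongr
          have : (0 : ℝ) < m := by exact_mod_cast hm
          linarith
      _ = _ := by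
          rw [norm_mul, norm_real, Real.norm_eq_abs, abs_abs]; ring
  have hDb : Subexp fun D => ((|(D : ℝ)| : ℝ) : ℂ) * b D :=
    hb.of_norm_le_mul_abs (K := 1) fun D => by
      rw [norm_mul, norm_real, Real.norm_eq_abs, abs_abs, one_mul]
  -- Termwise differentiation takes place on v > Im τ / 2, where the bounds are uniform.
  let δ := τ.im / 2
  have hδ : 0 < δ := half_pos hv
  have hα : 0 < Real.pi / (2 * m) * δ := by positivity
  let uB (D : ℤ) : ℝ := Real.pi / m * (Real.pi * δ / m) ^ (a - 1) * (‖((|(D : ℝ)| : ℝ) : ℂ) * b D‖ *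
        Real.exp (-(Real.pi / (2 * m) * δ) * |(D : ℝ)|))
  let uA (D : ℤ) : ℝ := (Real.pi * δ / m) ^ (a - 1) *
    (‖derivCoeff m b D‖ * Real.exp (-(Real.pi / (2 * m) * δ) * |(D : ℝ)|))
  have huA0 (D : ℤ) : 0 ≤ uA D := by positivity
  have hsum : Summable fun D => uA D + uB D :=
    (((hb.derivCoeff m) _ hα).mul_left _).add ((hDb _ hα).mul_left _)
  have hconv : Convex ℝ {x : ℂ | δ < x.im} := convex_halfSpace_im_gt δ
  have hmem : τ ∈ {x : ℂ | δ < x.im} := by simp only [Set.mem_ofPred_eq, δ]; linarith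
  have hA (D : ℤ) (x : ℂ) (hx : δ ≤ x.im) : ‖A D x‖ ≤ uA D + uB D :=
    (norm_sub_le _ _).trans (add_le_add (norm_nonSeries_term_le ha hm hNd hδ hx D) (hB D hδ hx))
  have hBsum : Summable fun D => B D τ :=
    Summable.of_norm_bounded ((hDb _ hα).mul_left _) fun D => hB D hδ hmem.le
  have main := HasWirtinger.tsum (τ := τ) hsum (isOpen_lt continuous_const continuous_im)
    hconv.isPreconnected (fun D x hx => hterm D x (hδ.trans hx)) (fun D x hx => hA D x hx.le)
    (fun D x hx => (hB D hδ hx.le).trans (le_add_of_nonneg_left (huA0 D))) hmem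
    (summable_nonSeries ha hm hb hN hτ).of_norm
  have eB : ∑' D, B D τ =
      (τ.im ^ (a - 1) : ℝ) * (starRingEnd ℂ) (holSeries m (shadowCoeff a m b) τ) := by
    rw [conj_holSeries_shadowCoeff, ← tsum_mul_left]
    refine tsum_congr fun D => ?_
    rcases le_or_gt 0 D with hD | hD
    · simp [B, hN D hD]
    have hD1 : 0 < -(D : ℝ) := by exact_mod_cast (show 0 < -D by omega)
    rw [← exp_mul_qExp hm]
    simp only [B, G', W]
    have e2 : -(D : ℝ) * Real.pi * τ.im / m = τ.im * (Real.pi * -(D : ℝ) / m) := by ring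
    have e3 : (Real.pi * -(D : ℝ) / m) ^ a =
        (Real.pi * -(D : ℝ) / m) * (Real.pi * -(D : ℝ) / m) ^ (a - 1) := by
      rw [Real.rpow_sub_one (by positivity), mul_div_cancel₀]; positivity
    rw [e2, Real.mul_rpow hv.le (by positivity), e3]
    push_cast
    have hI : (1 : ℂ) / (2 * I) = -(I / 2) := by
      field_simp; simp
    linear_combination (b D * exp (-(τ.im * (Real.pi * -(D : ℂ) / m))) * ((τ.im ^ (a - 1) : ℝ) : ℂ) *
      (((Real.pi * -(D : ℝ) / m) ^ (a - 1) : ℝ) : ℂ) * (Real.pi * -(D : ℂ) / m) * qExp m D τ) * hI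
  rw [← eB]
  refine main.congr_coeff ?_ rfl
  rw [Summable.tsum_sub (Summable.of_norm_bounded hsum fun D => ?_) hBsum]
  · rfl
  · exact (norm_nonSeries_term_le ha hm hNd hδ hmem.le D).trans
      (le_add_of_nonneg_right ((norm_nonneg _).trans (hB D hδ hmem.le)))

end Non

/-! ### Analyticity of the non-holomorphic series -/

section

variable {a : ℝ} {m : ℕ} {b : ℤ → ℂ}

/-- The linear form in the integral representation of `nonSeries`. -/
def expForm (m : ℕ) (x : ℤ × ℝ) : ℂ →L[ℝ] ℂ :=
  (-(-(x.1 : ℝ) * Real.pi / m * (1 + x.2))) • (ofRealCLM.comp imCLM) +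
    (2 * Real.pi * I * (x.1 / (4 * m)) : ℂ) • ContinuousLinearMap.id ℝ ℂ

/-- The density in the integral representation of `nonSeries`. -/
def expDensity (a : ℝ) (m : ℕ) (b : ℤ → ℂ) (x : ℤ × ℝ) : ℂ :=
  b x.1 * ((-(x.1 : ℝ) * Real.pi / m : ℝ) ^ a : ℝ) * ((1 + x.2) ^ (a - 1) : ℝ)

theorem exp_expForm (m : ℕ) (x : ℤ × ℝ) (τ : ℂ) :
    exp (expForm m x τ) =
      (Real.exp (-(-(x.1 : ℝ) * Real.pi * τ.im / m) * (1 + x.2)) : ℂ) * qExp m x.1 τ := by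
  rw [qExp, ofReal_exp, ← exp_add]
  congr 1
  simp [expForm]
  ring

theorem expForm_re (hm : 0 < m) (x : ℤ × ℝ) (τ : ℂ) :
    (expForm m x τ).re = (x.1 : ℝ) * Real.pi / m * τ.im * (1 / 2 + x.2) := by
  have h : Real.exp (expForm m x τ).re = Real.exp ((x.1 : ℝ) * Real.pi / m * τ.im * (1 / 2 + x.2)) := by
    rw [← Complex.norm_exp, exp_expForm, norm_mul, norm_qExp, norm_real, Real.norm_eq_abs,
      Real.abs_exp, ← Real.exp_add]
    congr 1
    field_simp
    ring
  exact Real.exp_injective h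

theorem norm_expForm_le (x : ℤ × ℝ) (hx : 0 ≤ x.2) :
    ‖expForm m x‖ ≤ |(x.1 : ℝ)| * Real.pi / m * (3 / 2 + x.2) := by
  have hre : ‖ofRealCLM.comp imCLM‖ ≤ 1 := by
    refine ContinuousLinearMap.opNorm_le_bound _ zero_le_one fun w => ?_
    simpa using abs_im_le_norm w
  refine (norm_add_le _ _).trans ?_
  rw [norm_smul, norm_smul]
  have h2 : ‖(2 * Real.pi * I * (x.1 / (4 * m)) : ℂ)‖ = |(x.1 : ℝ)| * Real.pi / m * (1 / 2) := by
    simp only [norm_mul, norm_div, Complex.norm_ofNat, Complex.norm_real, Complex.norm_I,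
      Complex.norm_intCast, Complex.norm_natCast, Real.norm_eq_abs, abs_of_pos Real.pi_pos]
    ring
  have h3 : ‖-(-(x.1 : ℝ) * Real.pi / m * (1 + x.2))‖ = |(x.1 : ℝ)| * Real.pi / m * (1 + x.2) := by
    rw [Real.norm_eq_abs, abs_neg, abs_mul, abs_div, abs_mul, abs_neg, abs_of_pos Real.pi_pos,
      Nat.abs_cast, abs_of_nonneg (by linarith : 0 ≤ 1 + x.2)]
  have h4 : ‖ContinuousLinearMap.id ℝ ℂ‖ ≤ 1 := ContinuousLinearMap.norm_id_le
  rw [h2, h3]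
  have h5 : 0 ≤ |(x.1 : ℝ)| * Real.pi / m := by positivity
  have h6 : 0 ≤ |(x.1 : ℝ)| * Real.pi / m * (1 + x.2) := by positivity
  nlinarith [mul_le_mul_of_nonneg_left hre h6, mul_le_mul_of_nonneg_left h4 h5]

theorem measurable_expDensity : Measurable (expDensity a m b) := by
  have h1 : Measurable fun x : ℤ × ℝ => b x.1 := (Measurable.of_discrete (f := b)).comp measurable_fst
  have h2 : Measurable fun D : ℤ => (((-(D : ℝ) * Real.pi / m : ℝ) ^ a : ℝ) : ℂ) :=
    Measurable.of_discrete
  refine (h1.mul (h2.comp measurable_fst)).mul ?_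
  fun_prop

theorem continuous_expForm : Continuous (expForm m) := by
  unfold expForm
  fun_prop

/-- Counting measure times Lebesgue measure on `(0, ∞)`. -/
def expMeasure : Measure (ℤ × ℝ) := Measure.count.prod (volume.restrict (Set.Ioi 0))

theorem ae_expMeasure : ∀ᵐ x ∂expMeasure, 0 < x.2 :=
  Measure.quasiMeasurePreserving_snd.ae (ae_restrict_mem measurableSet_Ioi)

/-- At height v the exponent has real part -|D|πv/m·(1/2 + s), while the form has norm at most
|D|π/m·(3/2 + s). The radius v/6 therefore leaves the decay |D|πv/(4m)·(1 + 10s/3), which is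
integrable in s and summable in D. -/
theorem integrable_expDensity (ha : a ≤ 1) (hm : 0 < m) (hb : Subexp b)
    (hN : ∀ D : ℤ, 0 ≤ D → b D = 0) {τ : ℂ} (hτ : τ ∈ upperHalf) :
    Integrable (fun x => ‖expDensity a m b x‖ *
      Real.exp ((expForm m x τ).re + τ.im / 6 * ‖expForm m x‖)) expMeasure := by
  have hv : 0 < τ.im := hτ
  have hm' : (0 : ℝ) < m := by exact_mod_cast hm
  let b' (D : ℤ) : ℂ := b D * ((-(D : ℝ) * Real.pi / m : ℝ) ^ a : ℝ)
  -- Up to the sign of D and the factor I/2 these are the shadow coefficients in absolute value.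
  have hb' : Subexp b' := by
    refine (hb.shadowCoeff ha hm hN).comp_neg.of_norm_le (K := 2) fun D => ?_
    simp only [b', shadowCoeff, norm_mul, norm_div, RCLike.norm_conj, Complex.norm_I, neg_neg,
      Complex.norm_ofNat, Int.cast_neg]
    rw [mul_comm (-(D : ℝ)) Real.pi]
    apply le_of_eq
    ring
  let δ := Real.pi * τ.im / (4 * m)
  have hδ : 0 < δ := by positivity
  have h1 : Integrable (fun D : ℤ => ‖b' D‖ * Real.exp (-δ * |(D : ℝ)|)) Measure.count := by
    rw [integrable_count_iff]
    exact (hb' δ hδ).norm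
  have h2 : Integrable (fun s : ℝ => Real.exp (-δ * s)) (volume.restrict (Set.Ioi 0)) :=
    exp_neg_integrableOn_Ioi 0 hδ
  refine (h1.mul_prod h2).mono' ?_ ?_
  · have hc : Continuous fun x => Real.exp ((expForm m x τ).re + τ.im / 6 * ‖expForm m x‖) := by
      have := continuous_expForm (m := m)
      fun_prop
    exact (measurable_expDensity.norm.mul hc.measurable).aestronglyMeasurable
  · filter_upwards [ae_expMeasure] with x hx
    rcases le_or_gt 0 x.1 with hD | hD
    · simp [expDensity, b', hN _ hD]
    have hD1 : (x.1 : ℝ) ≤ -1 := by exact_mod_cast (show x.1 ≤ -1 by omega)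
    have hn : ‖expDensity a m b x‖ ≤ ‖b' x.1‖ := by
      have : ‖(((1 + x.2) ^ (a - 1) : ℝ) : ℂ)‖ ≤ 1 := by
        rw [norm_real, Real.norm_eq_abs, abs_of_nonneg (by positivity)]
        exact Real.rpow_le_one_of_one_le_of_nonpos (by linarith) (by linarith)
      calc ‖expDensity a m b x‖ = ‖b' x.1‖ * ‖(((1 + x.2) ^ (a - 1) : ℝ) : ℂ)‖ := by
            rw [← norm_mul]; rfl
        _ ≤ ‖b' x.1‖ * 1 := by gcongr
        _ = _ := mul_one _
    rw [Real.norm_eq_abs, abs_of_nonneg (by positivity), mul_assoc, ← Real.exp_add]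
    refine mul_le_mul hn (Real.exp_le_exp.2 ?_) (Real.exp_pos _).le (norm_nonneg _)
    rw [expForm_re hm]
    have h3 := norm_expForm_le (m := m) x hx.le
    rw [abs_of_neg (by linarith)] at h3 ⊢
    have h4 : τ.im / 6 * ‖expForm m x‖ ≤ τ.im / 6 * (-(x.1 : ℝ) * Real.pi / m * (3 / 2 + x.2)) := by
      gcongr
    have h5 : (x.1 : ℝ) * Real.pi / m * τ.im * (1 / 2 + x.2) +
        τ.im / 6 * (-(x.1 : ℝ) * Real.pi / m * (3 / 2 + x.2)) =
        δ * (x.1 * (1 + 10 / 3 * x.2)) := by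
      simp only [δ]; field_simp; ring
    -- D ≤ -1 separates the variables, so that the majorant is a product.
    have h6 : δ * (x.1 * (1 + 10 / 3 * x.2)) ≤ δ * (x.1 - x.2) := by
      gcongr
      nlinarith
    linarith

/-- Expand each gamma value by `incGamma_eq`; its power of v is common to all terms and comes out.
-/
theorem nonSeries_eq_integral (hm : 0 < m)
    (hN : ∀ D : ℤ, 0 ≤ D → b D = 0) {τ : ℂ} (hτ : τ ∈ upperHalf)
    (hi : Integrable (fun x => expDensity a m b x * exp (expForm m x τ)) expMeasure) :
    nonSeries a m b τ = (τ.im ^ a : ℝ) *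
      ∫ x, expDensity a m b x * exp (expForm m x τ) ∂expMeasure := by
  have hv : 0 < τ.im := hτ
  unfold expMeasure at hi ⊢
  rw [integral_prod _ hi, integral_countable hi.integral_prod_left, nonSeries, ← tsum_mul_left]
  refine tsum_congr fun D => ?_
  simp only [measureReal_def, Measure.count_singleton, ENNReal.toReal_one, one_smul]
  rcases le_or_gt 0 D with hD | hD
  · simp [expDensity, hN D hD]
  have hD1 : 0 < -(D : ℝ) := by exact_mod_cast (show 0 < -D by omega)
  rw [incGamma_eq (weight_pos hm hD hv)]
  have e1 : -(D : ℝ) * Real.pi * τ.im / m = τ.im * (-(D : ℝ) * Real.pi / m) := by ring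
  have e2 : ∀ s : ℝ, expDensity a m b (D, s) * exp (expForm m (D, s) τ) =
      b D * ((-(D : ℝ) * Real.pi / m : ℝ) ^ a : ℝ) * qExp m D τ *
        ((Real.exp (-(-(D : ℝ) * Real.pi * τ.im / m) * (1 + s)) * (1 + s) ^ (a - 1) : ℝ) : ℂ) := by
    intro s
    rw [exp_expForm, expDensity]
    push_cast
    ring
  simp_rw [e2]
  rw [integral_const_mul, integral_complex_ofReal]
  rw [e1, Real.mul_rpow hv.le (by positivity)]
  push_cast
  ring

theorem analyticAt_nonSeries (ha : a ≤ 1) (hm : 0 < m) (hb : Subexp b)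
    (hN : ∀ D : ℤ, 0 ≤ D → b D = 0) {τ : ℂ} (hτ : τ ∈ upperHalf) :
    AnalyticAt ℝ (nonSeries a m b) τ := by
  have hv : 0 < τ.im := hτ
  have hint := integrable_expDensity ha hm hb hN hτ
  have h1 := analyticAt_integral_exp (show 0 < τ.im / 6 by positivity)
    measurable_expDensity.aestronglyMeasurable
    (continuous_expForm (m := m)).aestronglyMeasurable hint
  have h2 : AnalyticAt ℝ (fun y : ℂ => ((y.im ^ a : ℝ) : ℂ)) τ := by
    have h3 : AnalyticAt ℝ (fun y : ℂ => y.im) τ := imCLM.analyticAt τ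
    have h4 : AnalyticAt ℝ (fun y : ℂ => Real.exp (Real.log y.im * a)) τ :=
      AnalyticAt.rexp (f := fun y : ℂ => Real.log y.im * a)
        (AnalyticAt.mul ((analyticAt_log hv).comp h3) analyticAt_const)
    refine (ofRealCLM.analyticAt _).comp (h4.congr ?_)
    filter_upwards [isOpen_upperHalf.mem_nhds hτ] with y hy
    exact (Real.rpow_def_of_pos hy a).symm
  refine (h2.mul h1).congr ?_
  filter_upwards [isOpen_upperHalf.mem_nhds hτ, Metric.ball_mem_nhds τ
    (show 0 < τ.im / 6 by positivity)] with y hy hyb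
  refine (nonSeries_eq_integral hm hN hy ?_).symm
  refine hint.mono' ?_ (Eventually.of_forall fun x => ?_)
  · have hc : Continuous fun x => exp (expForm m x y) := by
      have := continuous_expForm (m := m)
      fun_prop
    exact (measurable_expDensity.mul hc.measurable).aestronglyMeasurable
  · rw [norm_mul, Complex.norm_exp]
    gcongr
    -- A displacement smaller than v/6 is paid for by the extra norm term in the majorant at τ.
    have e1 : expForm m x y = expForm m x τ + expForm m x (y - τ) := by rw [← map_add]; simp
    rw [e1, add_re]
    gcongr
    refine (re_le_norm _).trans (((expForm m x).le_opNorm _).trans ?_)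
    rw [mul_comm]
    gcongr
    exact (mem_ball_iff_norm.1 hyb).le

end

/-! ### Test functions -/

/-- Bounded measurable functions with support in a compact subset of `(0, ∞)`. -/
structure BoundedTest (φ : ℝ → ℂ) : Prop where
  measurable : Measurable φ
  bounded : ∃ M, ∀ x, ‖φ x‖ ≤ M
  support : ∃ a b : ℝ, 0 < a ∧ ∀ x, x ∉ Set.Icc a b → φ x = 0

/-- Near each point the function is glued from two smooth pieces and one value, hence bounded and
measurable; compactness of the support reduces to finitely many such neighbourhoods. -/
theorem IsTestFunction.boundedTest {φ : ℝ → ℂ} (hφ : IsTestFunction φ) : BoundedTest φ := by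
  classical
  obtain ⟨hps, a, b, ha, hsupp⟩ := hφ
  have key : ∃ t : Set ℝ, ∃ g : ℝ → ℂ, MeasurableSet t ∧ Set.Icc a b ⊆ t ∧ Measurable g ∧
      (∃ M, ∀ x, ‖g x‖ ≤ M) ∧ ∀ x ∈ t, φ x = g x := by
    refine isCompact_Icc.induction_on (p := fun s => ∃ t : Set ℝ, ∃ g : ℝ → ℂ, MeasurableSet t ∧
      s ⊆ t ∧ Measurable g ∧ (∃ M, ∀ x, ‖g x‖ ≤ M) ∧ ∀ x ∈ t, φ x = g x) ?_ ?_ ?_ ?_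
    · exact ⟨∅, 0, MeasurableSet.empty, subset_rfl, measurable_zero, ⟨0, by simp⟩, by simp⟩
    · rintro s s' hss ⟨t, g, h1, h2, h3⟩
      exact ⟨t, g, h1, hss.trans h2, h3⟩
    · rintro s s' ⟨t, g, h1, h2, h3, ⟨M, hM⟩, h4⟩ ⟨t', g', h1', h2', h3', ⟨M', hM'⟩, h4'⟩
      refine ⟨t ∪ t', t.piecewise g g', h1.union h1', Set.union_subset_union h2 h2',
        h3.piecewise h1 h3', ⟨max M M', fun x => ?_⟩, fun x hx => ?_⟩
      · by_cases hx : x ∈ t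
        · simp [hx, hM x]
        · simp [hx, hM' x]
      · by_cases hxt : x ∈ t
        · simp [hxt, h4 x hxt]
        · simp [hxt, h4' x (hx.resolve_left hxt)]
    · intro y hy
      obtain ⟨ε, hε, g, h, hg, hh, hgl, hhr, -⟩ := hps y (ha.trans_le hy.1)
      obtain ⟨Mg, hMg⟩ := (isCompact_Icc (a := y - ε) (b := y + ε)).exists_bound_of_continuousOn
        hg.continuous.continuousOn
      obtain ⟨Mh, hMh⟩ := (isCompact_Icc (a := y - ε) (b := y + ε)).exists_bound_of_continuousOn
        hh.continuous.continuousOn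
      refine ⟨Set.Ioo (y - ε) (y + ε), mem_nhdsWithin_of_mem_nhds
        (Ioo_mem_nhds (by linarith) (by linarith)), Set.Ioo (y - ε) (y + ε),
        fun x => (Set.Ioo (y - ε) y).indicator g x + ((Set.Ioo y (y + ε)).indicator h x +
          ({y} : Set ℝ).indicator (fun _ => φ y) x), measurableSet_Ioo, subset_rfl, ?_, ?_, ?_⟩
      · exact (hg.continuous.measurable.indicator measurableSet_Ioo).add
          ((hh.continuous.measurable.indicator measurableSet_Ioo).add
            (measurable_const.indicator (measurableSet_singleton y)))
      · refine ⟨|Mg| + (|Mh| + ‖φ y‖), fun x => ?_⟩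
        refine (norm_add_le _ _).trans (add_le_add ?_ ((norm_add_le _ _).trans (add_le_add ?_ ?_)))
        · by_cases hx : x ∈ Set.Ioo (y - ε) y
          · rw [Set.indicator_of_mem hx]
            exact (hMg x ⟨hx.1.le, by linarith [hx.2]⟩).trans (le_abs_self _)
          · rw [Set.indicator_of_notMem hx]; simp
        · by_cases hx : x ∈ Set.Ioo y (y + ε)
          · rw [Set.indicator_of_mem hx]
            exact (hMh x ⟨by linarith [hx.1], hx.2.le⟩).trans (le_abs_self _)
          · rw [Set.indicator_of_notMem hx]; simp
        · by_cases hx : x ∈ ({y} : Set ℝ)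
          · rw [Set.indicator_of_mem hx]
          · rw [Set.indicator_of_notMem hx]; simp
      · intro x hx
        rcases lt_trichotomy x y with hxy | rfl | hxy
        · have h1 : x ∈ Set.Ioo (y - ε) y := ⟨hx.1, hxy⟩
          have h2 : x ∉ Set.Ioo y (y + ε) := fun h => absurd h.1 (by linarith)
          simp [Set.indicator_of_mem h1, Set.indicator_of_notMem h2, hxy.ne, hgl x h1]
        · simp
        · have h1 : x ∉ Set.Ioo (y - ε) y := fun h => absurd h.2 (by linarith)
          have h2 : x ∈ Set.Ioo y (y + ε) := ⟨hxy, hx.2⟩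
          simp [Set.indicator_of_notMem h1, Set.indicator_of_mem h2, hxy.ne', hhr x h2]
  obtain ⟨t, g, -, h2, h3, ⟨M, hM⟩, h4⟩ := key
  have hφ : φ = (Set.Icc a b).indicator g := by
    ext x
    by_cases hx : x ∈ Set.Icc a b
    · rw [Set.indicator_of_mem hx, h4 x (h2 hx)]
    · rw [Set.indicator_of_notMem hx, hsupp x hx]
  refine ⟨hφ ▸ h3.indicator measurableSet_Icc, ⟨M, fun x => ?_⟩, a, b, ha, hsupp⟩
  rw [hφ]
  exact (norm_indicator_le_norm_self _ _).trans (hM x)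

namespace BoundedTest

variable {φ : ℝ → ℂ}

/-- Test functions may be multiplied by functions that are locally bounded on `(0, ∞)`. -/
theorem mul (hφ : BoundedTest φ) {g : ℝ → ℂ} (hgm : Measurable g)
    (hg : ContinuousOn g (Set.Ioi 0)) : BoundedTest fun x => φ x * g x := by
  obtain ⟨hm, ⟨M, hM⟩, a, b, ha, hs⟩ := hφ
  obtain ⟨K, hK⟩ := (isCompact_Icc (a := a) (b := b)).exists_bound_of_continuousOn
    (hg.mono fun x hx => ha.trans_le hx.1)
  refine ⟨hm.mul hgm, ⟨M * |K|, fun x => ?_⟩, a, b, ha, fun x hx => by simp [hs x hx]⟩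
  have hM0 : 0 ≤ M := (norm_nonneg _).trans (hM x)
  by_cases hx : x ∈ Set.Icc a b
  · rw [norm_mul]
    exact mul_le_mul (hM x) ((hK x hx).trans (le_abs_self K)) (norm_nonneg _) hM0
  · simp only [hs x hx, zero_mul, norm_zero]; positivity

theorem continuousOn_ofReal_cpow (s : ℂ) :
    ContinuousOn (fun x : ℝ => (x : ℂ) ^ s) (Set.Ioi 0) := fun x hx =>
  (continuousAt_ofReal_cpow_const x s (Or.inr (ne_of_gt hx))).continuousWithinAt

theorem measurable_ofReal_cpow (s : ℂ) : Measurable fun x : ℝ => (x : ℂ) ^ s :=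
  measurable_ofReal.pow_const s

theorem twist (hφ : BoundedTest φ) (s : ℂ) : BoundedTest (twist φ s) :=
  hφ.mul (measurable_ofReal_cpow _) (continuousOn_ofReal_cpow _)

theorem comp_inv (hφ : BoundedTest φ) : BoundedTest fun x => φ (1 / x) := by
  obtain ⟨hm, ⟨M, hM⟩, a, b, ha, hs⟩ := hφ
  refine ⟨hm.comp (measurable_const.div measurable_id), ⟨M, fun x => hM _⟩, ?_⟩
  rcases lt_or_ge b a with hab | hab
  · exact ⟨a, b, ha, fun x _ => hs _ fun h => absurd (h.1.trans h.2) (not_le.2 hab)⟩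
  refine ⟨1 / b, 1 / a, by have := ha.trans_le hab; positivity, fun x hx => hs _ fun h => hx ?_⟩
  have hx0 : 0 < x := by
    have := ha.trans_le h.1
    exact one_div_pos.1 this
  refine ⟨?_, ?_⟩
  · rw [one_div_le (ha.trans_le hab) hx0]; exact h.2
  · rw [le_one_div hx0 ha]; exact h.1

theorem slashS (hφ : BoundedTest φ) (k : ℕ) : BoundedTest (slashS k φ) := by
  have := hφ.comp_inv.mul (measurable_ofReal_cpow ((k : ℂ) - 5 / 2)) (continuousOn_ofReal_cpow _)
  refine (funext fun x => ?_ : JacobiConverse.slashS k φ = _) ▸ this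
  simp [JacobiConverse.slashS, mul_comm]

theorem integrable (hφ : BoundedTest φ) : Integrable φ := by
  obtain ⟨hm, ⟨M, hM⟩, a, b, ha, hs⟩ := hφ
  have h1 : IntegrableOn φ (Set.Icc a b) :=
    Measure.integrableOn_of_bounded (M := M) (by simp) hm.aestronglyMeasurable
      (Eventually.of_forall hM)
  exact (integrableOn_iff_integrable_of_support_subset fun x hx => by
    by_contra h; exact hx (hs x h)).1 h1

theorem integrableOn_mul (hφ : BoundedTest φ) {g : ℝ → ℂ} (hg : ContinuousOn g (Set.Ioi 0)) :
    IntegrableOn (fun t => g t * φ t) (Set.Ioi 0) := by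
  obtain ⟨M, hM⟩ := hφ.bounded
  obtain ⟨a, b, ha, hs⟩ := hφ.support
  have hss : Set.Icc a b ⊆ Set.Ioi (0 : ℝ) := fun x hx => ha.trans_le hx.1
  have h1 : IntegrableOn (fun t => g t * φ t) (Set.Icc a b) := by
    have := (hg.mono hss).integrableOn_compact (μ := volume) isCompact_Icc
    exact this.mul_bdd (c := M) hφ.measurable.aestronglyMeasurable (Eventually.of_forall hM)
  refine Integrable.integrableOn ?_
  exact (integrableOn_iff_integrable_of_support_subset fun x hx => by
    by_contra h; exact hx (by simp [hs x h])).1 h1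

/-- The support is compact in (0, ∞), so a majorant on each compact interval suffices for dominated
summation. -/
theorem tsum_integral (hφ : BoundedTest φ) {f : ℤ → ℝ → ℂ}
    (hf : ∀ D, ContinuousOn (f D) (Set.Ioi 0))
    (hu : ∀ a b : ℝ, 0 < a → a ≤ b → ∃ u : ℤ → ℝ, Summable u ∧ ∀ D, ∀ t ∈ Set.Icc a b, ‖f D t‖ ≤ u D) :
    ∑' D, ∫ t in Set.Ioi (0 : ℝ), f D t * φ t = ∫ t in Set.Ioi (0 : ℝ), (∑' D, f D t) * φ t := by
  obtain ⟨a, b, ha, hs⟩ := hφ.support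
  rcases lt_or_ge b a with hab | hab
  · have : φ = 0 := funext fun x => hs x fun h => absurd (h.1.trans h.2) (not_le.2 hab)
    simp [this]
  obtain ⟨u, hus, hu⟩ := hu a b ha hab
  have h1 := hasSum_integral_of_summable_integral_norm
    (μ := volume.restrict (Set.Ioi (0 : ℝ))) (F := fun D t => f D t * φ t)
    (fun D => hφ.integrableOn_mul (hf D)) ?_
  · rw [h1.tsum_eq]
    refine integral_congr_ae (Eventually.of_forall fun t => ?_)
    simp only [tsum_mul_right]
  · have hφn := hφ.integrable.norm.integrableOn (s := Set.Ioi (0 : ℝ))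
    refine Summable.of_nonneg_of_le (fun D => integral_nonneg fun t => norm_nonneg _) (fun D => ?_)
      (hus.mul_right (∫ t in Set.Ioi (0 : ℝ), ‖φ t‖))
    rw [← integral_const_mul]
    refine integral_mono (hφ.integrableOn_mul (hf D)).norm (hφn.const_mul _) fun t => ?_
    simp only [norm_mul]
    by_cases ht : t ∈ Set.Icc a b
    · gcongr; exact hu D t ht
    · simp [hs t ht]

end BoundedTest

/-- `∫ H(t) (φ|S)(t) dt = ∫ t^{1/2-k} H(1/t) φ(t) dt`. -/
theorem integral_mul_slashS (k : ℕ) (H φ : ℝ → ℂ) :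
    ∫ t in Set.Ioi (0 : ℝ), H t * slashS k φ t =
      ∫ t in Set.Ioi (0 : ℝ), (t : ℂ) ^ ((1 / 2 : ℂ) - k) * H (1 / t) * φ t := by
  rw [← integral_comp_rpow_Ioi _ (show (-1 : ℝ) ≠ 0 by norm_num)]
  refine setIntegral_congr_fun measurableSet_Ioi fun t ht => ?_
  have ht0 : (0 : ℝ) < t := ht
  have htc : (t : ℂ) ≠ 0 := by exact_mod_cast ht0.ne'
  simp only [slashS, Real.rpow_neg_one, one_div, inv_inv, real_smul, abs_neg, abs_one, one_mul]
  have e1 : ((t ^ (-1 - 1 : ℝ) : ℝ) : ℂ) = (t : ℂ) ^ (-2 : ℂ) := by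
    rw [ofReal_cpow ht0.le]; norm_num
  have e2 : ((t⁻¹ : ℝ) : ℂ) ^ ((k : ℂ) - 5 / 2) = (t : ℂ) ^ (-((k : ℂ) - 5 / 2)) := by
    rw [cpow_neg, ofReal_inv, inv_cpow]
    rw [arg_ofReal_of_nonneg ht0.le]; exact Real.pi_pos.ne
  rw [e1, e2]
  -- The Jacobian t^{-2} and the factor of the slash action at 1/t combine to t^{1/2-k}.
  have e3 : (t : ℂ) ^ ((2 : ℂ)⁻¹ - k) = (t : ℂ) ^ (-2 : ℂ) * (t : ℂ) ^ (-((k : ℂ) - 5 / 2)) := by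
    rw [← cpow_add _ _ htc]; congr 1; ring
  rw [e3]; ring

/-- A compactly supported integrable function all of whose moments vanish is zero. -/
theorem ae_eq_zero_of_moments {f : ℝ → ℂ} (hf : Integrable f) {a b : ℝ}
    (hs : ∀ x, x ∉ Set.Icc a b → f x = 0)
    (hmom : ∀ n : ℕ, ∫ x, f x * (x : ℂ) ^ n = 0) : f =ᵐ[volume] 0 := by
  have hint (g : ℝ → ℝ) (hg : Continuous g) : Integrable fun x => (g x : ℂ) * f x := by
    have h1 : IntegrableOn (fun x => (g x : ℂ) * f x) (Set.Icc a b) := by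
      obtain ⟨M, hM⟩ := (isCompact_Icc (a := a) (b := b)).exists_bound_of_continuousOn
        (f := fun x => (g x : ℂ)) (by fun_prop)
      refine (hf.integrableOn (s := Set.Icc a b)).bdd_mul (c := M) ?_ ?_
      · exact Continuous.aestronglyMeasurable (by fun_prop)
      · filter_upwards [ae_restrict_mem measurableSet_Icc] with x hx using hM x hx
    exact (integrableOn_iff_integrable_of_support_subset fun x hx => by
      by_contra h; exact hx (by simp [hs x h])).1 h1
  have hpoly (p : Polynomial ℝ) : ∫ x, ((p.eval x : ℝ) : ℂ) * f x = 0 := by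
    induction p using Polynomial.induction_on' with
    | add p q hp hq =>
      simp only [Polynomial.eval_add, ofReal_add, add_mul]
      rw [integral_add (hint _ p.continuous) (hint _ q.continuous), hp, hq, add_zero]
    | monomial n c =>
      have := hmom n
      simp only [Polynomial.eval_monomial]
      calc _ = ∫ x, (c : ℂ) * (f x * (x : ℂ) ^ n) := by
            congr 1; ext x; push_cast; ring
        _ = 0 := by rw [integral_const_mul, this, mul_zero]
  refine ae_eq_zero_of_integral_contDiff_smul_eq_zero hf.locallyIntegrable fun g hg _ => ?_
  have hgc : Continuous g := hg.continuous
  refine norm_le_zero_iff.1 (le_of_forall_pos_le_add fun ε hε => ?_)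
  rw [zero_add]
  set I0 := ∫ x, ‖f x‖
  have hI0 : 0 ≤ I0 := integral_nonneg fun x => norm_nonneg _
  -- Weierstrass approximation on the support; the + 1 keeps the tolerance meaningful when f has
  -- zero integral norm.
  obtain ⟨p, hp⟩ := exists_polynomial_near_of_continuousOn a b g hgc.continuousOn
    (ε / (I0 + 1)) (by positivity)
  have e1 : ∫ x, g x • f x = ∫ x, ((g x : ℂ) * f x - ((p.eval x : ℝ) : ℂ) * f x) := by
    rw [integral_sub (hint _ hgc) (hint _ p.continuous), hpoly, sub_zero]
    simp [real_smul]
  rw [e1]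
  calc _ ≤ ∫ x, ε / (I0 + 1) * ‖f x‖ := by
        refine norm_integral_le_of_norm_le (hf.norm.const_mul _) (Eventually.of_forall fun x => ?_)
        by_cases hx : x ∈ Set.Icc a b
        · rw [← sub_mul, norm_mul, ← ofReal_sub, norm_real, Real.norm_eq_abs, abs_sub_comm]
          gcongr
          exact (hp x hx).le
        · simp [hs x hx]
    _ = ε / (I0 + 1) * I0 := integral_const_mul _ _
    _ ≤ ε := by
        rw [div_mul_eq_mul_div, div_le_iff₀ (by positivity)]
        nlinarith

/-- A continuous function on `(0, ∞)` orthogonal to all twists of a piecewise smooth test function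
vanishes where the test function does not. -/
theorem eq_zero_of_integral_twist {φ H : ℝ → ℂ} (hφ : IsTestFunction φ)
    (hH : ContinuousOn H (Set.Ioi 0))
    (hint : ∀ n : ℕ, ∫ t in Set.Ioi (0 : ℝ), H t * twist φ (n + 1) t = 0) {y : ℝ} (hy : 0 < y)
    (hφy : φ y ≠ 0) : H y = 0 := by
  have hb := hφ.boundedTest
  obtain ⟨a, b, ha, hs⟩ := hb.support
  let f : ℝ → ℂ := (Set.Ioi 0).indicator fun t => H t * φ t
  have hf : Integrable f := (hb.integrableOn_mul hH).integrable_indicator measurableSet_Ioi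
  have hf0 : f =ᵐ[volume] 0 := by
    refine ae_eq_zero_of_moments (a := a) (b := b) hf (fun x hx => ?_) fun n => ?_
    · by_cases h : x ∈ Set.Ioi (0 : ℝ)
      · simp [f, Set.indicator_of_mem h, hs x hx]
      · simp only [f, Set.indicator_of_notMem h]
    · rw [← hint n, ← integral_indicator measurableSet_Ioi]
      congr 1; ext x
      by_cases h : x ∈ Set.Ioi (0 : ℝ)
      · simp only [f, Set.indicator_of_mem h, twist, add_sub_cancel_right, cpow_natCast]; ring
      · simp only [f, Set.indicator_of_notMem h, zero_mul]
  obtain ⟨ε, hε, g, h, hg, hh, hgl, hhr, hgh⟩ := hφ.1 y hy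
  have hHy : ContinuousAt H y := hH.continuousAt (Ioi_mem_nhds hy)
  by_contra hne
  -- If φ agrees with a continuous G on one side of y and G(y) = φ(y) ≠ 0, then Hφ is nonzero on a
  -- one-sided interval, a set of positive measure. The requirement that φ(y) be a one-sided limit
  -- selects the side.
  have aux (G : ℝ → ℂ) (hG : Continuous G) (hGy : φ y = G y) (S : ℝ → Set ℝ)
      (hS : ∀ r : ℝ, 0 < r → IsOpen (S r) ∧ (S r).Nonempty ∧ ∀ x ∈ S r, |x - y| < r)
      (hSφ : ∀ r, r ≤ ε → ∀ x ∈ S r, φ x = G x) : False := by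
    have hc : ContinuousAt (fun x => H x * G x) y := hHy.mul hG.continuousAt
    have hne' : H y * G y ≠ 0 := mul_ne_zero hne (hGy ▸ hφy)
    obtain ⟨r, hr, hball⟩ := Metric.eventually_nhds_iff.1
      ((hc.eventually_ne hne').and (Ioi_mem_nhds hy))
    obtain ⟨hSo, hSn, hSd⟩ := hS (min r ε) (lt_min hr hε)
    have hpos := hSo.measure_pos volume hSn
    have hnull : volume (S (min r ε)) = 0 := by
      refine measure_mono_null (fun x hx => ?_) (ae_iff.1 hf0)
      have h1 := hball (y := x) (by rw [Real.dist_eq]; exact (hSd x hx).trans_le (min_le_left _ _))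
      have h2 := hSφ _ (min_le_right _ _) x hx
      have h3 : x ∈ Set.Ioi (0 : ℝ) := h1.2
      simp only [Set.mem_ofPred_eq, f, Set.indicator_of_mem h3, h2]
      exact h1.1
    exact hpos.ne' hnull
  rcases hgh with hgy | hhy
  · refine aux g hg.continuous hgy (fun r => Set.Ioo (y - r) y) (fun r hr => ⟨isOpen_Ioo,
      Set.nonempty_Ioo.2 (by linarith), fun x hx => ?_⟩) fun r hr x hx => hgl x ⟨?_, hx.2⟩
    · rw [abs_lt]; constructor <;> linarith [hx.1, hx.2]
    · linarith [hx.1]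
  · refine aux h hh.continuous hhy (fun r => Set.Ioo y (y + r)) (fun r hr => ⟨isOpen_Ioo,
      Set.nonempty_Ioo.2 (by linarith), fun x hx => ?_⟩) fun r hr x hx => hhr x ⟨hx.1, ?_⟩
    · rw [abs_lt]; constructor <;> linarith [hx.1, hx.2]
    · linarith [hx.2]

/-- From functional equations of the integral transforms to pointwise functional equations. -/
theorem functional_equation_of_integrals {ι : Type*} [Fintype ι] (k : ℕ) {Sc : Set (ℝ → ℂ)}
    (hSc : ∀ φ ∈ Sc, IsTestFunction φ) (hSc_twist : ∀ φ ∈ Sc, ∀ s : ℂ, twist φ s ∈ Sc)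
    (hSc_ne : ∀ y : ℝ, 0 < y → ∃ φ ∈ Sc, φ y ≠ 0) {H : ι → ℝ → ℂ}
    (hH : ∀ j, ContinuousOn (H j) (Set.Ioi 0)) (w : ι → ι → ℂ)
    (heq : ∀ φ ∈ Sc, ∀ j, ∫ t in Set.Ioi (0 : ℝ), H j t * φ t =
      ∑ l, w j l * ∫ t in Set.Ioi (0 : ℝ), H l t * slashS k φ t) (j : ι) {t : ℝ} (ht : 0 < t) :
    H j t = ∑ l, w j l * ((t : ℂ) ^ ((1 / 2 : ℂ) - k) * H l (1 / t)) := by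
  have hcont (l : ι) : ContinuousOn (fun t : ℝ => (t : ℂ) ^ ((1 / 2 : ℂ) - k) * H l (1 / t))
      (Set.Ioi 0) := by
    refine (BoundedTest.continuousOn_ofReal_cpow _).mul ((hH l).comp ?_ ?_)
    · exact continuousOn_const.div continuousOn_id fun x hx => ne_of_gt hx
    · intro x hx
      exact one_div_pos.2 (show 0 < x from hx)
  obtain ⟨φ, hφ, hφt⟩ := hSc_ne t ht
  have hdiff := eq_zero_of_integral_twist (hSc φ hφ)
    (H := fun t => H j t - ∑ l, w j l * ((t : ℂ) ^ ((1 / 2 : ℂ) - k) * H l (1 / t)))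
    ((hH j).sub (continuousOn_finsetSum _ fun l _ => continuousOn_const.mul (hcont l)))
    (fun n => ?_) ht hφt
  · exact sub_eq_zero.1 hdiff
  · have hψ := hSc_twist φ hφ (n + 1)
    have hb := (hSc _ hψ).boundedTest
    have h1 := heq _ hψ j
    simp only [sub_mul, Finset.sum_mul]
    rw [integral_sub (hb.integrableOn_mul (hH j)), integral_finsetSum, h1, sub_eq_zero]
    · refine Finset.sum_congr rfl fun l _ => ?_
      rw [integral_mul_slashS, ← integral_const_mul]
      simp only [mul_assoc]
    · intro l _
      simpa only [mul_assoc] using (hb.integrableOn_mul (hcont l)).const_mul (w j l)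
    · refine integrable_finsetSum _ fun l _ => ?_
      simpa only [mul_assoc] using (hb.integrableOn_mul (hcont l)).const_mul (w j l)

/-! ### The `L`-series as integrals -/

section

variable {m : ℕ} {b : ℤ → ℂ} {φ : ℝ → ℂ}

theorem qExp_axis (m : ℕ) (D : ℤ) (t : ℝ) :
    qExp m D (t * I) = exp (-(((Real.pi * D / (2 * m) : ℝ) : ℂ) * t)) := by
  rw [qExp]
  congr 1
  push_cast
  linear_combination (2 * Real.pi * (D / (4 * m)) * t : ℂ) * I_mul_I

theorem tsum_laplace {N : ℕ} (hm : 0 < m) (hb : Subexp b) (hN : ∀ D : ℤ, D < -N → b D = 0)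
    (hφ : BoundedTest φ) :
    ∑' D : ℤ, b D * laplace φ ((Real.pi * D / (2 * m) : ℝ) : ℂ) =
      ∫ t in Set.Ioi (0 : ℝ), holSeries m b (t * I) * φ t := by
  rw [show (∫ t in Set.Ioi (0 : ℝ), holSeries m b (t * I) * φ t) = _ from
    (hφ.tsum_integral (f := fun D t => b D * qExp m D (t * I)) (fun D => ?_)
      fun α β hα hβ => ?_).symm]
  · refine tsum_congr fun D => ?_
    rw [laplace, ← integral_const_mul]
    refine integral_congr_ae (Eventually.of_forall fun t => ?_)
    simp only [qExp_axis]
    ring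
  · unfold qExp
    fun_prop
  · refine ⟨_, (hb (Real.pi / (2 * m) * α) (by positivity)).mul_left
      (Real.exp (Real.pi / (2 * m) * (β + α) * N)), fun D t ht => ?_⟩
    exact norm_holSeries_term_le hN hα (by simpa using ht.1) (by simpa using ht.2) D

/-- Fubini, then `incGamma_eq` read backwards. The twist by 5/2 - k supplies t^{3/2-k}, which
completes the prefactor β^{3/2-k} to (βt)^{3/2-k}. -/
theorem nonholTerm_eq (k : ℕ) (hm : 0 < m) (hk : 0 < k) {D : ℤ} (hD : D < 0) (hφ : BoundedTest φ) :
    nonholTerm k m D (twist φ (5 / 2 - k)) = ∫ t in Set.Ioi (0 : ℝ),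
      (incGamma (3 / 2 - k) (-(D : ℝ) * Real.pi * t / m) : ℂ) * qExp m D (t * I) * φ t := by
  set β : ℝ := -(Real.pi * D / m) with hβdef
  have hm' : (0 : ℝ) < m := by exact_mod_cast hm
  have hD1 : (0 : ℝ) < -D := by exact_mod_cast (show 0 < -D by omega)
  have hβ : 0 < β := by
    have : β = Real.pi * -(D : ℝ) / m := by rw [hβdef]; ring
    rw [this]; positivity
  set ψ := twist φ (5 / 2 - k) with hψdef
  have hψ : BoundedTest ψ := hφ.twist _
  obtain ⟨a, c, ha, hs⟩ := hψ.support
  have e1 : ∀ s : ℝ, ((-(Real.pi * D * (2 * s + 1) / (2 * m)) : ℝ) : ℂ) =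
      ((β * (2 * s + 1) / 2 : ℝ) : ℂ) := fun s => by
    congr 1; rw [hβdef]; field_simp
  have e2 : ((β : ℝ) : ℂ) ^ ((3 / 2 : ℂ) - k) = ((β ^ (3 / 2 - k : ℝ) : ℝ) : ℂ) := by
    rw [ofReal_cpow hβ.le]; push_cast; rfl
  have e3 : ∀ s : ℝ, 0 < s → ((1 + s : ℝ) : ℂ) ^ ((k : ℂ) - 1 / 2) =
      (((1 + s) ^ (k - 1 / 2 : ℝ) : ℝ) : ℂ) := fun s hs => by
    rw [ofReal_cpow (by linarith)]; push_cast; rfl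
  have e4 : nonholTerm k m D ψ = ((β ^ (3 / 2 - k : ℝ) : ℝ) : ℂ) *
      ∫ s in Set.Ioi (0 : ℝ), ∫ t in Set.Ioi (0 : ℝ),
        ((Real.exp (-(β * (2 * s + 1) / 2 * t)) * (1 + s) ^ (1 / 2 - k : ℝ) : ℝ) : ℂ) * ψ t := by
    rw [nonholTerm, e2]
    congr 1
    refine setIntegral_congr_fun measurableSet_Ioi fun s hs0 => ?_
    have hs1 : 0 < s := hs0
    simp only [e1, e3 s hs1, laplace]
    rw [← integral_div]
    refine integral_congr_ae (Eventually.of_forall fun t => ?_)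
    have : (1 + s) ^ (1 / 2 - k : ℝ) = ((1 + s) ^ (k - 1 / 2 : ℝ))⁻¹ := by
      rw [← Real.rpow_neg (by linarith)]; congr 1; ring
    simp only [this]
    push_cast
    ring
  rw [e4, integral_integral_swap]
  · rw [← integral_const_mul]
    refine setIntegral_congr_fun measurableSet_Ioi fun t ht => ?_
    have ht0 : (0 : ℝ) < t := ht
    have htc : (t : ℂ) ≠ 0 := by exact_mod_cast ht0.ne'
    rw [integral_mul_const, integral_complex_ofReal]
    have e5 : -(D : ℝ) * Real.pi * t / m = β * t := by rw [hβdef]; ring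
    rw [e5, incGamma_eq (mul_pos hβ ht0), qExp_axis, Real.mul_rpow hβ.le ht0.le]
    -- Splitting (2s + 1)/2 = (1 + s) - 1/2 separates the gamma integrand from e^{βt/2}, the value
    -- of q^D at it.
    have e6 : ∫ s in Set.Ioi (0 : ℝ), Real.exp (-(β * (2 * s + 1) / 2 * t)) *
        (1 + s) ^ (1 / 2 - k : ℝ) = Real.exp (β * t / 2) * ∫ s in Set.Ioi (0 : ℝ),
        Real.exp (-(β * t) * (1 + s)) * (1 + s) ^ ((3 / 2 - k : ℝ) - 1) := by
      rw [← integral_const_mul]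
      refine integral_congr_ae (Eventually.of_forall fun s => ?_)
      simp only
      rw [← mul_assoc, ← Real.exp_add]
      congr 2 <;> ring
    have e7 : exp (-(((Real.pi * D / (2 * m) : ℝ) : ℂ) * t)) = ((Real.exp (β * t / 2) : ℝ) : ℂ) := by
      rw [ofReal_exp, hβdef]; congr 1; push_cast; field_simp
    have e8 : ψ t = φ t * ((t ^ (3 / 2 - k : ℝ) : ℝ) : ℂ) := by
      rw [hψdef, twist, ofReal_cpow ht0.le]
      congr 2; push_cast; ring
    rw [e6, e7, e8]
    push_cast
    ring
  · obtain ⟨M, hM⟩ := hψ.bounded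
    -- The support of ψ stays at t ≥ a > 0, which provides the decay e^{-βas} in s for Fubini.
    have hI : Integrable (fun x : ℝ × ℝ => Real.exp (-(β * a) * x.1) * ‖ψ x.2‖)
        ((volume.restrict (Set.Ioi 0)).prod (volume.restrict (Set.Ioi 0))) :=
      (exp_neg_integrableOn_Ioi 0 (mul_pos hβ ha)).mul_prod hψ.integrable.norm.integrableOn
    refine hI.mono' ?_ ?_
    · refine Measurable.aestronglyMeasurable ?_
      have := hψ.measurable
      fun_prop
    · have hae : ∀ᵐ x : ℝ × ℝ ∂((volume.restrict (Set.Ioi (0 : ℝ))).prod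
          (volume.restrict (Set.Ioi (0 : ℝ)))), 0 < x.1 :=
        Measure.quasiMeasurePreserving_fst.ae (ae_restrict_mem measurableSet_Ioi)
      filter_upwards [hae] with x hx
      simp only [Function.uncurry, norm_mul, norm_real, Real.norm_eq_abs]
      by_cases hxs : x.2 ∈ Set.Icc a c
      · rw [Real.abs_exp, abs_of_nonneg (Real.rpow_nonneg (by linarith) _)]
        have h1 : (1 + x.1) ^ (1 / 2 - k : ℝ) ≤ 1 := by
          refine Real.rpow_le_one_of_one_le_of_nonpos (by linarith) ?_
          have : (1 : ℝ) ≤ k := by exact_mod_cast hk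
          linarith
        have h2 : -(β * (2 * x.1 + 1) / 2 * x.2) ≤ -(β * a) * x.1 := by
          have h3 : a * x.1 ≤ x.2 * ((2 * x.1 + 1) / 2) :=
            mul_le_mul hxs.1 (by linarith) hx.le (ha.le.trans hxs.1)
          nlinarith
        have h4 : 0 ≤ (1 + x.1) ^ (1 / 2 - k : ℝ) := Real.rpow_nonneg (by linarith) _
        gcongr
        calc _ ≤ Real.exp (-(β * a) * x.1) * 1 := by gcongr
          _ = _ := mul_one _
      · simp [hs _ hxs]

theorem tsum_nonholTerm (k : ℕ) (hm : 0 < m) (hk : 0 < k) (hb : Subexp b)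
    (hN : ∀ D : ℤ, 0 ≤ D → b D = 0) (hφ : BoundedTest φ) :
    ∑' D : ℤ, b D * nonholTerm k m D (twist φ (5 / 2 - k)) =
      ∫ t in Set.Ioi (0 : ℝ), nonSeries (3 / 2 - k) m b (t * I) * φ t := by
  have hk1 : (1 : ℝ) ≤ k := by exact_mod_cast hk
  have ha : (3 / 2 - k : ℝ) ≤ 1 := by linarith
  rw [show (∫ t in Set.Ioi (0 : ℝ), nonSeries (3 / 2 - k) m b (t * I) * φ t) = _ from
    (hφ.tsum_integral (f := fun D t => b D * (incGamma (3 / 2 - k)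
      (-(D : ℝ) * Real.pi * ((t : ℂ) * I).im / m) : ℂ) * qExp m D (t * I)) (fun D => ?_)
      fun α β hα hβ => ?_).symm]
  · refine tsum_congr fun D => ?_
    rcases le_or_gt 0 D with hD | hD
    · simp [hN D hD]
    rw [nonholTerm_eq k hm hk hD hφ, ← integral_const_mul]
    refine integral_congr_ae (Eventually.of_forall fun t => ?_)
    simp only [mul_im, ofReal_re, I_im, mul_one, ofReal_im, I_re, mul_zero, add_zero]
    ring
  · rcases le_or_gt 0 D with hD | hD
    · simp only [hN D hD, zero_mul]; exact continuousOn_const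
    simp only [mul_im, ofReal_re, I_im, mul_one, ofReal_im, I_re, mul_zero, add_zero]
    refine (continuousOn_const.mul fun t ht => ?_).mul (by unfold qExp; fun_prop)
    have h1 := (hasDerivAt_incGamma ha (weight_pos hm hD ht)).continuousAt
    have h2 : ContinuousAt (fun t : ℝ => -(D : ℝ) * Real.pi * t / m) t := by fun_prop
    exact (continuous_ofReal.continuousAt.comp
      (ContinuousAt.comp (f := fun t : ℝ => -(D : ℝ) * Real.pi * t / m) h1 h2)).continuousWithinAt
  · refine ⟨_, (hb (Real.pi / (2 * m) * α) (by positivity)).mul_left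
      ((Real.pi * α / m) ^ ((3 / 2 - k : ℝ) - 1)), fun D t ht => ?_⟩
    exact norm_nonSeries_term_le ha hm hN hα (by simpa using ht.1) D

end

/-! ### Coefficients indexed by discriminant and residue class -/

open Classical in
/-- The coefficient `c(l, r)` with `4ml - r² = D` and `r ≡ s mod 2m`, and `0` if there is none. -/
def coeff (m : ℕ) (c : ℤ → ℤ → ℂ) (s : ZMod (2 * m)) (D : ℤ) : ℂ :=
  if h : ∃ a : ℤ × ℤ, disc m a.1 a.2 = D ∧ (a.2 : ZMod (2 * m)) = s then
    c h.choose.1 h.choose.2 else 0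

/-- `c(l, r)` depends only on `4ml - r²` and `r mod 2m`. -/
def DiscInvariant (m : ℕ) (c : ℤ → ℤ → ℂ) : Prop :=
  ∀ l r l' r' : ℤ, disc m l r = disc m l' r' → r ≡ r' [ZMOD (2 * m)] → c l r = c l' r'

section Coeff

variable {m : ℕ} {c : ℤ → ℤ → ℂ}

theorem coeff_disc (hc : DiscInvariant m c) (l r : ℤ) :
    coeff m c (r : ZMod (2 * m)) (disc m l r) = c l r := by
  have h : ∃ a : ℤ × ℤ, disc m a.1 a.2 = disc m l r ∧ (a.2 : ZMod (2 * m)) = (r : ZMod (2 * m)) :=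
    ⟨(l, r), rfl, rfl⟩
  rw [coeff, dif_pos h]
  refine hc _ _ _ _ h.choose_spec.1 ?_
  have := (ZMod.intCast_eq_intCast_iff _ _ _).1 h.choose_spec.2
  exact_mod_cast this

theorem exists_of_coeff_ne_zero {s : ZMod (2 * m)} {D : ℤ} (h : coeff m c s D ≠ 0) :
    ∃ l r : ℤ, disc m l r = D ∧ (r : ZMod (2 * m)) = s ∧ coeff m c s D = c l r := by
  by_cases h' : ∃ a : ℤ × ℤ, disc m a.1 a.2 = D ∧ (a.2 : ZMod (2 * m)) = s
  · exact ⟨_, _, h'.choose_spec.1, h'.choose_spec.2, by rw [coeff, dif_pos h']⟩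
  · exact absurd (by rw [coeff, dif_neg h']) h

/-- The discriminant is unchanged when r moves by 2mn and l is corrected by nr' + mn², so every
integer in the residue class represents D. -/
theorem exists_disc_of_coeff_ne_zero {r D : ℤ} (h : coeff m c (r : ZMod (2 * m)) D ≠ 0) :
    ∃ l : ℤ, disc m l r = D := by
  obtain ⟨l, r', h1, h2, -⟩ := exists_of_coeff_ne_zero h
  rw [ZMod.intCast_eq_intCast_iff_dvd_sub] at h2
  obtain ⟨n, hn⟩ := h2
  push_cast at hn
  refine ⟨l + n * r' + m * n ^ 2, ?_⟩
  have : r = r' + 2 * m * n := by linarith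
  rw [← h1, this, disc, disc]
  ring

theorem disc_injective (hm : 0 < m) (r : ℤ) : Function.Injective fun l => disc m l r := by
  intro l l' h
  have hm' : (4 * m : ℤ) ≠ 0 := by positivity
  have h' : 4 * m * l - r ^ 2 = 4 * m * l' - r ^ 2 := h
  exact mul_left_cancel₀ hm' (by linarith)

theorem tsum_disc (hm : 0 < m) (hc : DiscInvariant m c) (r : ℤ) (G : ℤ → ℂ) :
    ∑' l : ℤ, c l r * G (disc m l r) = ∑' D : ℤ, coeff m c (r : ZMod (2 * m)) D * G D := by
  rw [← (disc_injective hm r).tsum_eq (f := fun D => coeff m c (r : ZMod (2 * m)) D * G D)]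
  · exact tsum_congr fun l => by rw [coeff_disc hc]
  · intro D hD
    exact exists_disc_of_coeff_ne_zero (left_ne_zero_of_mul hD)

/-- For fixed r the discriminant determines l, and pairs (D, r) not of this form have zero
coefficient; this is a reindexing without any summability assumption. -/
theorem tsum_disc_prod (hm : 0 < m) (hc : DiscInvariant m c) (G : ℤ → ℤ → ℂ) :
    ∑' a : ℤ × ℤ, c a.1 a.2 * G (disc m a.1 a.2) a.2 =
      ∑' x : ℤ × ℤ, coeff m c (x.2 : ZMod (2 * m)) x.1 * G x.1 x.2 := by
  have hinj : Function.Injective fun a : ℤ × ℤ => (disc m a.1 a.2, a.2) := by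
    rintro ⟨l, r⟩ ⟨l', r'⟩ h
    simp only [Prod.mk.injEq] at h
    obtain ⟨h1, rfl⟩ := h
    rw [disc_injective hm r h1]
  rw [← hinj.tsum_eq (f := fun x : ℤ × ℤ => coeff m c (x.2 : ZMod (2 * m)) x.1 * G x.1 x.2)]
  · exact tsum_congr fun a => by rw [coeff_disc hc]
  · rintro ⟨D, r⟩ hx
    obtain ⟨l, hl⟩ := exists_disc_of_coeff_ne_zero (left_ne_zero_of_mul hx)
    exact ⟨(l, r), by simp [hl]⟩

/-- The growth bound says nothing for |D| < N, but once the residue class is fixed only finitely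
many values are left; their sum K repairs the constant. -/
theorem subexp_coeff {A C N : ℝ}
    (h : ∀ l r : ℤ, N ≤ |(disc m l r : ℝ)| →
      ‖c l r‖ ≤ A * Real.exp (C * √|(disc m l r : ℝ)|)) (s : ZMod (2 * m)) :
    Subexp (coeff m c s) := by
  let S : Finset ℤ := Finset.Icc (-⌈N⌉) ⌈N⌉
  let K := ∑ D ∈ S, ‖coeff m c s D‖
  have hK : 0 ≤ K := Finset.sum_nonneg fun _ _ => norm_nonneg _
  refine Subexp.of_bound (A := |A| + K) (C := |C|) fun D => ?_
  have hexp : 1 ≤ Real.exp (|C| * √|(D : ℝ)|) := Real.one_le_exp (by positivity)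
  by_cases h0 : coeff m c s D = 0
  · rw [h0, norm_zero]; positivity
  rcases le_or_gt N |(D : ℝ)| with hN | hN
  · obtain ⟨l, r, h1, h2, h3⟩ := exists_of_coeff_ne_zero h0
    have h4 := h l r (by rwa [h1])
    rw [h3]
    rw [h1] at h4
    calc _ ≤ _ := h4
      _ ≤ |A| * Real.exp (|C| * √|(D : ℝ)|) := by
        gcongr
        · exact le_abs_self A
        · exact le_abs_self C
      _ ≤ _ := by gcongr; linarith
  · have hD : D ∈ S := by
      have h1 : |(D : ℝ)| ≤ ⌈N⌉ := hN.le.trans (Int.le_ceil N)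
      have h2 := abs_le.1 h1
      exact Finset.mem_Icc.2 ⟨by exact_mod_cast h2.1, by exact_mod_cast h2.2⟩
    have h5 : ‖coeff m c s D‖ ≤ K :=
      Finset.single_le_sum (f := fun D => ‖coeff m c s D‖) (fun _ _ => norm_nonneg _) hD
    calc _ ≤ K * 1 := by rw [mul_one]; exact h5
      _ ≤ K * Real.exp (|C| * √|(D : ℝ)|) := by gcongr
      _ ≤ _ := by gcongr; linarith [abs_nonneg A]

end Coeff

/-! ### The components of the theta decomposition -/

/-- The sum of a holomorphic and a non-holomorphic series. -/
def compSeries (k m : ℕ) (bp bn : ℤ → ℂ) (τ : ℂ) : ℂ :=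
  holSeries m bp τ + nonSeries (3 / 2 - k) m bn τ

/-- The conditions on coefficients under which `compSeries` converges. -/
structure Admissible (bp bn : ℤ → ℂ) : Prop where
  hol : Subexp bp
  non : Subexp bn
  hol_support : ∃ N : ℕ, ∀ D : ℤ, D < -N → bp D = 0
  non_support : ∀ D : ℤ, 0 ≤ D → bn D = 0

namespace Admissible

variable {k m : ℕ} {bp bn : ℤ → ℂ}

theorem derivCoeff (h : Admissible bp bn) (m : ℕ) :
    Admissible (derivCoeff m bp) (derivCoeff m bn) where
  hol := h.hol.derivCoeff m
  non := h.non.derivCoeff m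
  hol_support := by
    obtain ⟨N, hN⟩ := h.hol_support
    exact ⟨N, fun D hD => derivCoeff_eq_zero hN D hD⟩
  non_support D hD := by simp [JacobiConverse.derivCoeff, h.non_support D hD]

theorem weight_le (hk : 0 < k) : (3 / 2 - k : ℝ) ≤ 1 := by
  have : (1 : ℝ) ≤ k := by exact_mod_cast hk
  linarith

/-- The holomorphic part adds nothing to ∂/∂τ̄, so the shadow is that of the gamma part alone, with
exponent (3/2 - k) - 1. -/
theorem hasWirtinger (h : Admissible bp bn) (hk : 0 < k) (hm : 0 < m) {τ : ℂ} (hτ : τ ∈ upperHalf) :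
    HasWirtinger (compSeries k m bp bn)
      (compSeries k m (JacobiConverse.derivCoeff m bp) (JacobiConverse.derivCoeff m bn) τ -
        (τ.im ^ (1 / 2 - k : ℝ) : ℝ) *
          (starRingEnd ℂ) (holSeries m (shadowCoeff (3 / 2 - k) m bn) τ))
      ((τ.im ^ (1 / 2 - k : ℝ) : ℝ) *
        (starRingEnd ℂ) (holSeries m (shadowCoeff (3 / 2 - k) m bn) τ)) τ := by
  obtain ⟨N, hN⟩ := h.hol_support
  have h1 := HasWirtinger.of_hasDerivAt (hasDerivAt_holSeries hm h.hol hN hτ)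
  have h2 := hasWirtinger_nonSeries (weight_le hk) hm h.non h.non_support hτ
  have e : (3 / 2 - k : ℝ) - 1 = 1 / 2 - k := by ring
  rw [e] at h2
  refine (h1.add h2).congr_coeff ?_ (zero_add _)
  rw [compSeries]; ring

theorem differentiableOn_shadow (h : Admissible bp bn) (hk : 0 < k) (hm : 0 < m) :
    DifferentiableOn ℂ (holSeries m (shadowCoeff (3 / 2 - k) m bn)) upperHalf :=
  differentiableOn_holSeries hm (Subexp.shadowCoeff (weight_le hk) hm h.non h.non_support)
    (shadowCoeff_eq_zero h.non_support)

theorem analyticAt (h : Admissible bp bn) (hk : 0 < k) (hm : 0 < m) {τ : ℂ} (hτ : τ ∈ upperHalf) :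
    AnalyticAt ℝ (compSeries k m bp bn) τ := by
  obtain ⟨N, hN⟩ := h.hol_support
  exact (analyticAt_holSeries hm h.hol hN hτ).add
    (analyticAt_nonSeries (weight_le hk) hm h.non h.non_support hτ)

theorem continuousOn_axis {f : ℂ → ℂ} (hf : ∀ τ ∈ upperHalf, ContinuousAt f τ) :
    ContinuousOn (fun t : ℝ => f (t * I)) (Set.Ioi 0) := fun t ht =>
  (ContinuousAt.comp (f := fun t : ℝ => (t : ℂ) * I) (hf _ (ofReal_mul_I_mem_upperHalf ht))
    (by fun_prop)).continuousWithinAt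

theorem holSeries_continuousOn_axis (h : Admissible bp bn) (hm : 0 < m) :
    ContinuousOn (fun t : ℝ => holSeries m bp (t * I)) (Set.Ioi 0) := by
  obtain ⟨N, hN⟩ := h.hol_support
  exact continuousOn_axis fun _ hτ => (analyticAt_holSeries hm h.hol hN hτ).continuousAt

theorem nonSeries_continuousOn_axis (h : Admissible bp bn) (hk : 0 < k) (hm : 0 < m) :
    ContinuousOn (fun t : ℝ => nonSeries (3 / 2 - k) m bn (t * I)) (Set.Ioi 0) :=
  continuousOn_axis fun _ hτ =>
    (analyticAt_nonSeries (weight_le hk) hm h.non h.non_support hτ).continuousAt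

theorem compSeries_continuousOn_axis (h : Admissible bp bn) (hk : 0 < k) (hm : 0 < m) :
    ContinuousOn (fun t : ℝ => compSeries k m bp bn (t * I)) (Set.Ioi 0) :=
  (h.holSeries_continuousOn_axis hm).add (h.nonSeries_continuousOn_axis hk hm)

theorem integral_compSeries (h : Admissible bp bn) (hk : 0 < k) (hm : 0 < m) {φ : ℝ → ℂ}
    (hφ : BoundedTest φ) :
    (∑' D : ℤ, bp D * laplace φ ((Real.pi * D / (2 * m) : ℝ) : ℂ)) +
      ∑' D : ℤ, bn D * nonholTerm k m D (JacobiConverse.twist φ (5 / 2 - k)) =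
      ∫ t in Set.Ioi (0 : ℝ), compSeries k m bp bn (t * I) * φ t := by
  obtain ⟨N, hN⟩ := h.hol_support
  rw [tsum_laplace hm h.hol hN hφ, tsum_nonholTerm k hm hk h.non h.non_support hφ,
    ← integral_add (hφ.integrableOn_mul (h.holSeries_continuousOn_axis hm))
      (hφ.integrableOn_mul (h.nonSeries_continuousOn_axis hk hm))]
  simp only [compSeries, add_mul]

end Admissible

/-- The coefficients `c(l, r)` restricted to `4ml - r² < 0`. -/
def negPart (m : ℕ) (c : ℤ → ℤ → ℂ) (l r : ℤ) : ℂ := if disc m l r < 0 then c l r else 0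

/-- `(2k-1)/4 h(it) + i t ∂h/∂u (it)`. -/
def alphaAxis (k m : ℕ) (bp bn : ℤ → ℂ) (t : ℝ) : ℂ :=
  (2 * k - 1) / 4 * compSeries k m bp bn (t * I) +
    t * I * compSeries k m (derivCoeff m bp) (derivCoeff m bn) (t * I)

/-! ### The two L-series as integrals of the components along the axis. -/

section LSeries

variable {k m : ℕ} {cp cm : ℤ → ℤ → ℂ} {φ : ℝ → ℂ}

theorem LSer_eq (hk : 0 < k) (hm : 0 < m) (hcp : DiscInvariant m cp)
    (hcm : DiscInvariant m (negPart m cm)) (j : Fin (2 * m))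
    (h : Admissible (coeff m cp (label j : ZMod (2 * m)))
      (coeff m (negPart m cm) (label j : ZMod (2 * m)))) (hφ : BoundedTest φ) :
    LSer k m cp cm φ j = ∫ t in Set.Ioi (0 : ℝ),
      compSeries k m (coeff m cp (label j : ZMod (2 * m)))
        (coeff m (negPart m cm) (label j : ZMod (2 * m))) (t * I) * φ t := by
  rw [← h.integral_compSeries hk hm hφ, LSer,
    tsum_disc hm hcp (label j) fun D => laplace φ ((Real.pi * D / (2 * m) : ℝ) : ℂ),
    ← tsum_disc hm hcm (label j) fun D => nonholTerm k m D (twist φ (5 / 2 - k))]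
  congr 1
  refine tsum_congr fun l => ?_
  unfold negPart
  split_ifs <;> simp

/-- On the axis it·∂_u multiplies q^D by -2πt·D/(4m); the factor t is the twist φ_2. -/
theorem LSerAlpha_eq (hk : 0 < k) (hm : 0 < m) (hcp : DiscInvariant m cp)
    (hcm : DiscInvariant m (negPart m cm)) (j : Fin (2 * m))
    (h : Admissible (coeff m cp (label j : ZMod (2 * m)))
      (coeff m (negPart m cm) (label j : ZMod (2 * m)))) (hφ : BoundedTest φ) :
    LSerAlpha k m cp cm φ j = ∫ t in Set.Ioi (0 : ℝ),
      alphaAxis k m (coeff m cp (label j : ZMod (2 * m)))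
        (coeff m (negPart m cm) (label j : ZMod (2 * m))) t * φ t := by
  set bp := coeff m cp (label j : ZMod (2 * m))
  set bn := coeff m (negPart m cm) (label j : ZMod (2 * m))
  have h2 := h.derivCoeff m
  have hφ2 : BoundedTest (twist φ 2) := hφ.twist 2
  have e0 : twist (twist φ 2) (5 / 2 - k) = twist φ (7 / 2 - k) := by
    -- Complex powers combine only at nonzero base; for x ≤ 0 both sides vanish with φ.
    obtain ⟨a, b, ha, hs⟩ := hφ.support
    ext x
    rcases le_or_gt x 0 with hx | hx
    · have : φ x = 0 := hs x fun h => absurd (ha.trans_le h.1) (not_lt.2 hx)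
      simp [twist, this]
    · have hxc : (x : ℂ) ≠ 0 := by exact_mod_cast hx.ne'
      simp only [twist]
      rw [mul_assoc, ← cpow_add _ _ hxc]
      congr 2; ring
  have e1 := h2.integral_compSeries hk hm hφ2
  rw [e0] at e1
  have e2 : ∫ t in Set.Ioi (0 : ℝ), alphaAxis k m bp bn t * φ t =
      (2 * k - 1) / 4 * (∫ t in Set.Ioi (0 : ℝ), compSeries k m bp bn (t * I) * φ t) +
      I * ∫ t in Set.Ioi (0 : ℝ),
        compSeries k m (derivCoeff m bp) (derivCoeff m bn) (t * I) * twist φ 2 t := by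
    rw [← integral_const_mul, ← integral_const_mul, ← integral_add]
    · refine integral_congr_ae (Eventually.of_forall fun t => ?_)
      have : (2 : ℂ) - 1 = 1 := by norm_num
      simp only [alphaAxis, twist, this, cpow_one]
      ring
    · exact (hφ.integrableOn_mul (h.compSeries_continuousOn_axis hk hm)).const_mul _
    · exact (hφ2.integrableOn_mul (h2.compSeries_continuousOn_axis hk hm)).const_mul _
  rw [e2, ← LSer_eq hk hm hcp hcm j h hφ, ← e1, LSerAlpha]
  have e3 : ∑' l : ℤ, cp l (label j) * ((disc m l (label j) : ℂ) / (4 * m)) *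
        laplace (twist φ 2) ((Real.pi * disc m l (label j) / (2 * m) : ℝ) : ℂ) =
      ∑' D : ℤ, bp D * (((D : ℂ) / (4 * m)) *
        laplace (twist φ 2) ((Real.pi * D / (2 * m) : ℝ) : ℂ)) := by
    rw [← tsum_disc hm hcp (label j)]
    simp only [mul_assoc]
  have e4 : (∑' l : ℤ, if disc m l (label j) < 0 then
        cm l (label j) * ((disc m l (label j) : ℂ) / (4 * m)) *
          nonholTerm k m (disc m l (label j)) (twist φ (7 / 2 - k)) else 0) =
      ∑' D : ℤ, bn D * (((D : ℂ) / (4 * m)) * nonholTerm k m D (twist φ (7 / 2 - k))) := by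
    rw [← tsum_disc hm hcm (label j)]
    refine tsum_congr fun l => ?_
    unfold negPart
    split_ifs <;> simp [mul_assoc]
  rw [e3, e4, mul_add, ← tsum_mul_left, ← tsum_mul_left, ← tsum_mul_left, ← tsum_mul_left,
    sub_sub, sub_eq_add_neg, neg_add, ← tsum_neg, ← tsum_neg]
  congr 2
  · refine tsum_congr fun D => ?_
    rw [derivCoeff]
    linear_combination (-(2 * Real.pi * (D / (4 * m)) * bp D *
      laplace (twist φ 2) ((Real.pi * D / (2 * m) : ℝ) : ℂ)) : ℂ) * I_mul_I
  · refine tsum_congr fun D => ?_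
    rw [derivCoeff]
    linear_combination (-(2 * Real.pi * (D / (4 * m)) * bn D *
      nonholTerm k m D (twist φ (7 / 2 - k))) : ℂ) * I_mul_I

theorem alphaAxis_continuousOn {bp bn : ℤ → ℂ} (h : Admissible bp bn) (hk : 0 < k) (hm : 0 < m) :
    ContinuousOn (alphaAxis k m bp bn) (Set.Ioi 0) := by
  refine (continuousOn_const.mul (h.compSeries_continuousOn_axis hk hm)).add
    (ContinuousOn.mul (by fun_prop) ((h.derivCoeff m).compSeries_continuousOn_axis hk hm))

end LSeries

/-! ### From the imaginary axis to the upper half plane -/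

theorem neg_one_div_im (τ : ℂ) : (-1 / τ).im = τ.im / ‖τ‖ ^ 2 := by
  rw [neg_div, one_div, neg_im, inv_im, normSq_eq_norm_sq]; ring

theorem ne_zero_of_mem_upperHalf {τ : ℂ} (hτ : τ ∈ upperHalf) : τ ≠ 0 := by
  rintro rfl
  simp [upperHalf] at hτ

theorem neg_one_div_mem_upperHalf {τ : ℂ} (hτ : τ ∈ upperHalf) : -1 / τ ∈ upperHalf := by
  have h0 := ne_zero_of_mem_upperHalf hτ
  have hv : 0 < τ.im := hτ
  show 0 < (-1 / τ).im
  rw [neg_one_div_im]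
  positivity

theorem neg_I_mul_mem_slitPlane {τ : ℂ} (hτ : τ ∈ upperHalf) : -I * τ ∈ slitPlane :=
  Or.inl (by simpa [upperHalf] using hτ)

theorem hasDerivAt_neg_one_div {τ : ℂ} (h : τ ≠ 0) : HasDerivAt (fun x : ℂ => -1 / x) (1 / τ ^ 2) τ := by
  have := ((hasDerivAt_inv h).const_mul (-1))
  simpa [div_eq_mul_inv] using this

theorem hasDerivAt_neg_I_mul_cpow {τ : ℂ} (hτ : τ ∈ upperHalf) (q : ℂ) :
    HasDerivAt (fun x : ℂ => (-I * x) ^ q) (q * (-I * τ) ^ (q - 1) * -I) τ := by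
  have h1 : HasDerivAt (fun x : ℂ => -I * x) (-I) τ := by
    simpa using (hasDerivAt_id τ).const_mul (-I)
  exact h1.cpow_const (neg_I_mul_mem_slitPlane hτ)

/-- Im(-1/τ) = v/|τ|², and |τ|^{2q} is (-iτ)^q times its conjugate. Hence inversion keeps a
τ̄-derivative in the form v^q times an antiholomorphic function. -/
theorem neg_I_mul_cpow_mul_im_rpow {τ : ℂ} (hτ : τ ∈ upperHalf) (q : ℝ) :
    (-I * τ) ^ (q : ℂ) * (((-1 / τ).im ^ q : ℝ) : ℂ) =
      ((τ.im ^ q : ℝ) : ℂ) * (starRingEnd ℂ) ((-I * τ) ^ (-q : ℂ)) := by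
  have h0 := ne_zero_of_mem_upperHalf hτ
  have hv : 0 < τ.im := hτ
  have hn : 0 < ‖τ‖ := norm_pos_iff.2 h0
  set w := -I * τ with hw
  have hwn : ‖w‖ = ‖τ‖ := by simp [hw]
  have hw0 : w ≠ 0 := by rw [← norm_pos_iff, hwn]; exact hn
  have hwq : w ^ (q : ℂ) ≠ 0 := by simp [cpow_eq_zero_iff, hw0]
  have h1 : w ^ (q : ℂ) * (starRingEnd ℂ) (w ^ (q : ℂ)) = (((‖τ‖ ^ q) ^ 2 : ℝ) : ℂ) := by
    rw [mul_conj, normSq_eq_norm_sq, norm_cpow_real, hwn]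
  have h2 : (-1 / τ).im ^ q = τ.im ^ q / (‖τ‖ ^ q) ^ 2 := by
    rw [neg_one_div_im, Real.div_rpow hv.le (by positivity), ← Real.rpow_natCast,
      ← Real.rpow_natCast, ← Real.rpow_mul hn.le, ← Real.rpow_mul hn.le, mul_comm q]
  have h3 : (((‖τ‖ ^ q) ^ 2 : ℝ) : ℂ) ≠ 0 := by
    have : 0 < (‖τ‖ ^ q) ^ 2 := by positivity
    exact_mod_cast this.ne'
  have h4 : (starRingEnd ℂ) (w ^ (q : ℂ)) ≠ 0 := by simpa using hwq
  rw [h2, ofReal_div, cpow_neg, map_inv₀, ← h1]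
  field_simp

/-- The two axis equations are exactly the Cauchy data needed for the difference of both sides,
whose τ̄-derivative has the required form because each summand's does. -/
theorem modular_of_axis {ι : Type*} [Fintype ι] {k m : ℕ} (hk : 0 < k) (hm : 0 < m)
    {bp bn : ι → ℤ → ℂ} (hb : ∀ s, Admissible (bp s) (bn s)) (w : ι → ι → ℂ)
    (h1 : ∀ s, ∀ t : ℝ, 0 < t → compSeries k m (bp s) (bn s) (t * I) =
      ∑ r, w s r * ((t : ℂ) ^ ((1 / 2 : ℂ) - k) * compSeries k m (bp r) (bn r) ((1 / t : ℝ) * I)))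
    (h2 : ∀ s, ∀ t : ℝ, 0 < t → alphaAxis k m (bp s) (bn s) t =
      -∑ r, w s r * ((t : ℂ) ^ ((1 / 2 : ℂ) - k) * alphaAxis k m (bp r) (bn r) (1 / t)))
    (s : ι) {τ : ℂ} (hτ : τ ∈ upperHalf) :
    compSeries k m (bp s) (bn s) τ = ∑ r, w s r * ((-I * τ) ^ ((1 / 2 : ℂ) - k) *
      compSeries k m (bp r) (bn r) (-1 / τ)) := by
  set q : ℝ := 1 / 2 - k with hq
  have hqc : ((1 / 2 : ℂ) - k) = (q : ℂ) := by rw [hq]; push_cast; rfl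
  rw [hqc] at h1 h2 ⊢
  let h (r : ι) : ℂ → ℂ := compSeries k m (bp r) (bn r)
  let d (r : ι) : ℂ → ℂ := compSeries k m (derivCoeff m (bp r)) (derivCoeff m (bn r))
  let g (r : ι) : ℂ → ℂ := holSeries m (shadowCoeff (3 / 2 - k) m (bn r))
  let b (r : ι) (x : ℂ) : ℂ := (x.im ^ q : ℝ) * (starRingEnd ℂ) (g r x)
  have hW (r : ι) (x : ℂ) (hx : x ∈ upperHalf) : HasWirtinger (h r) (d r x - b r x) (b r x) x :=
    (hb r).hasWirtinger hk hm hx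
  have hS (r : ι) (x : ℂ) (hx : x ∈ upperHalf) :=
    (((HasWirtinger.of_hasDerivAt (hasDerivAt_neg_I_mul_cpow hx q)).mul
      ((hW r _ (neg_one_div_mem_upperHalf hx)).comp_hasDerivAt
        (hasDerivAt_neg_one_div (ne_zero_of_mem_upperHalf hx)))).const_mul (w s r))
  have hE (x : ℂ) (hx : x ∈ upperHalf) :=
    (hW s x hx).sub (HasWirtinger.sum (s := Finset.univ) fun r _ => hS r x hx)
  -- The shadow of the difference: shadows transform with (-ix)^{-q} and the derivative 1/x² of
  -- -1/x, and the weights are conjugated because the shadow enters conjugated.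
  refine sub_eq_zero.1 (eq_zero_of_cauchy_data (q := q) (g := fun x => g s x - ∑ r,
    (starRingEnd ℂ) (w s r) * ((-I * x) ^ (-q : ℂ) * (1 / x ^ 2) * g r (-1 / x)))
    hE (fun x hx => ?_) ?_ (fun t ht => ?_) (fun t ht => ?_) hτ)
  · simp only [b, zero_mul, zero_add, map_sub, map_sum, map_mul, conj_conj, mul_sub,
      Finset.mul_sum]
    congr 1
    refine Finset.sum_congr rfl fun r _ => ?_
    linear_combination (w s r * (starRingEnd ℂ) (g r (-1 / x)) * (starRingEnd ℂ) (1 / x ^ 2)) *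
      neg_I_mul_cpow_mul_im_rpow hx q
  · have hg (r : ι) : DifferentiableOn ℂ (g r) upperHalf := (hb r).differentiableOn_shadow hk hm
    refine (hg s).sub (DifferentiableOn.fun_sum fun r _ => ?_)
    refine (differentiableOn_const _).mul ((DifferentiableOn.mul ?_ ?_).mul ?_)
    · exact fun x hx => (hasDerivAt_neg_I_mul_cpow hx _).differentiableAt.differentiableWithinAt
    · exact DifferentiableOn.div (differentiableOn_const _) (by fun_prop)
        fun x hx => pow_ne_zero _ (ne_zero_of_mem_upperHalf hx)
    · exact (hg r).comp (fun x hx => (hasDerivAt_neg_one_div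
        (ne_zero_of_mem_upperHalf hx)).differentiableAt.differentiableWithinAt)
        fun x hx => neg_one_div_mem_upperHalf hx
  all_goals
    have htc : (t : ℂ) ≠ 0 := by exact_mod_cast ht.ne'
    have e1 : -I * ((t : ℂ) * I) = t := by linear_combination (-(t : ℂ)) * I_mul_I
    have e2 : -1 / ((t : ℂ) * I) = ((1 / t : ℝ) : ℂ) * I := by
      push_cast
      field_simp
      simp
  · simp only [h, e1, e2]
    exact sub_eq_zero.2 (h1 s t ht)
  · have e3 : (1 : ℂ) / ((t : ℂ) * I) ^ 2 = ((-(1 / t ^ 2) : ℝ) : ℂ) := by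
      push_cast
      rw [mul_pow, I_sq]
      field_simp
    have e4 : (t : ℂ) ^ ((q : ℂ) - 1) = (t : ℂ) ^ (q : ℂ) / t := by
      rw [cpow_sub _ _ htc, cpow_one]
    simp only [e1, e2, e3, e4, conj_ofReal]
    have A := h2 s t ht
    have B := h1 s t ht
    simp only [alphaAxis] at A
    rw [B] at A
    have hqk : (k : ℂ) = 1 / 2 - q := by rw [hq]; push_cast; ring
    rw [hqk] at A
    push_cast at A ⊢
    have hI : (t : ℂ) * I ≠ 0 := mul_ne_zero htc I_ne_zero
    refine (mul_eq_zero.1 ?_).resolve_left hI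
    simp only [h]
    -- Here (2k-1)/4 = -q/2. Eliminating h_s by the first equation adds the two halves to q,
    -- precisely the term from differentiating (-iτ)^q.
    have C : (t : ℂ) * I * d s (t * I) = ∑ r, w s r * ((t : ℂ) ^ (q : ℂ) *
        (q * compSeries k m (bp r) (bn r) (1 / t * I) - I / t * d r (1 / t * I))) := by
      rw [← eq_sub_iff_add_eq'] at A
      simp only [d]
      rw [A, Finset.mul_sum, ← Finset.sum_neg_distrib, ← Finset.sum_sub_distrib]
      refine Finset.sum_congr rfl fun r _ => ?_
      ring
    have D : ∀ x y z u : ℂ, x - y - z + (y - u) = x - (z + u) := fun x y z u => by ring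
    rw [D, mul_sub, C, ← Finset.sum_add_distrib, Finset.mul_sum, ← Finset.sum_sub_distrib]
    refine Finset.sum_eq_zero fun r _ => ?_
    field_simp
    ring_nf
    simp only [I_sq]
    ring

/-! ### Theta functions -/

/-- `e^{2πi (r² τ / 4m + r z)}`. -/
def thetaTerm (m : ℕ) (r : ℤ) (p : ℂ × ℂ) : ℂ :=
  exp (2 * Real.pi * I * (r ^ 2 / (4 * m)) * p.1 + 2 * Real.pi * I * r * p.2)

/-- The series `∑ c(r) e^{2πi (r² τ / 4m + r z)}`. -/
def thetaSeries (m : ℕ) (c : ℤ → ℂ) (p : ℂ × ℂ) : ℂ := ∑' r : ℤ, c r * thetaTerm m r p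

/-- Coefficients for which `thetaSeries` converges. -/
def GaussSummable (c : ℤ → ℂ) : Prop :=
  ∀ ε : ℝ, 0 < ε → Summable fun r : ℤ => ‖c r‖ * Real.exp (-ε * (r : ℝ) ^ 2)

theorem abs_int_le_sq (r : ℤ) : |(r : ℝ)| ≤ (r : ℝ) ^ 2 := by
  have h : |r| ≤ r ^ 2 := by
    rcases eq_or_ne r 0 with rfl | h
    · simp
    · have h1 : 1 ≤ |r| := Int.one_le_abs h
      rw [← sq_abs]
      nlinarith
  exact_mod_cast h

theorem summable_exp_neg_sq_int {ε : ℝ} (hε : 0 < ε) :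
    Summable fun r : ℤ => Real.exp (-ε * (r : ℝ) ^ 2) := by
  refine Summable.of_nonneg_of_le (fun _ => (Real.exp_pos _).le) (fun r => ?_)
    (summable_exp_neg_abs_int hε)
  have := mul_le_mul_of_nonneg_left (abs_int_le_sq r) hε.le
  exact Real.exp_le_exp.2 (by linarith)

theorem GaussSummable.of_norm_le_one {c : ℤ → ℂ} (h : ∀ r, ‖c r‖ ≤ 1) : GaussSummable c :=
  fun ε hε => Summable.of_nonneg_of_le (fun _ => by positivity)
    (fun r => (mul_le_mul_of_nonneg_right (h r) (Real.exp_pos _).le).trans_eq (one_mul _))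
    (summable_exp_neg_sq_int hε)

theorem GaussSummable.of_norm_le {c c' : ℤ → ℂ} (hc : GaussSummable c) {K : ℝ}
    (h : ∀ r : ℤ, ‖c' r‖ ≤ K * (r : ℝ) ^ 2 * ‖c r‖) : GaussSummable c' := fun ε hε => by
  refine Summable.of_nonneg_of_le (fun D => by positivity) (fun r => ?_)
    ((hc (ε / 2) (half_pos hε)).mul_left (|K| * (2 / ε)))
  have h1 : (r : ℝ) ^ 2 ≤ 2 / ε * Real.exp (ε / 2 * (r : ℝ) ^ 2) := by
    have := Real.add_one_le_exp (ε / 2 * (r : ℝ) ^ 2)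
    rw [div_mul_eq_mul_div, le_div_iff₀ hε]
    nlinarith
  calc ‖c' r‖ * Real.exp (-ε * (r : ℝ) ^ 2)
      ≤ |K| * (r : ℝ) ^ 2 * ‖c r‖ * Real.exp (-ε * (r : ℝ) ^ 2) := by
        gcongr
        refine (h r).trans ?_
        gcongr
        exact le_abs_self K
    _ ≤ |K| * (2 / ε * Real.exp (ε / 2 * (r : ℝ) ^ 2)) * ‖c r‖ * Real.exp (-ε * (r : ℝ) ^ 2) := by
        gcongr
    _ = |K| * (2 / ε) * (‖c r‖ * (Real.exp (ε / 2 * (r : ℝ) ^ 2) * Real.exp (-ε * (r : ℝ) ^ 2))) := by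
        ring
    _ = _ := by rw [← Real.exp_add]; congr 3; ring

/-- The coefficients of `∂/∂τ` of a theta series. -/
def thetaCoeffTau (m : ℕ) (c : ℤ → ℂ) (r : ℤ) : ℂ := 2 * Real.pi * I * (r ^ 2 / (4 * m)) * c r

/-- The coefficients of `∂/∂z` of a theta series. -/
def thetaCoeffZ (c : ℤ → ℂ) (r : ℤ) : ℂ := 2 * Real.pi * I * r * c r

theorem norm_thetaCoeffTau (m : ℕ) (c : ℤ → ℂ) (r : ℤ) :
    ‖thetaCoeffTau m c r‖ = 2 * Real.pi / (4 * m) * (r : ℝ) ^ 2 * ‖c r‖ := by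
  simp only [thetaCoeffTau, norm_mul, norm_div, norm_pow, Complex.norm_ofNat, Complex.norm_real,
    Complex.norm_I, Complex.norm_intCast, Complex.norm_natCast, Real.norm_eq_abs,
    abs_of_pos Real.pi_pos, sq_abs]
  ring

theorem norm_thetaCoeffZ (c : ℤ → ℂ) (r : ℤ) :
    ‖thetaCoeffZ c r‖ = 2 * Real.pi * |(r : ℝ)| * ‖c r‖ := by
  simp only [thetaCoeffZ, norm_mul, Complex.norm_ofNat, Complex.norm_real,
    Complex.norm_I, Complex.norm_intCast, Real.norm_eq_abs, abs_of_pos Real.pi_pos]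
  ring

theorem GaussSummable.tau {c : ℤ → ℂ} (hc : GaussSummable c) (m : ℕ) :
    GaussSummable (thetaCoeffTau m c) :=
  hc.of_norm_le fun r => (norm_thetaCoeffTau m c r).le

theorem GaussSummable.z {c : ℤ → ℂ} (hc : GaussSummable c) : GaussSummable (thetaCoeffZ c) :=
  hc.of_norm_le (K := 2 * Real.pi) fun r => by
    rw [norm_thetaCoeffZ]
    have := abs_int_le_sq r
    gcongr

theorem norm_thetaTerm (m : ℕ) (r : ℤ) (p : ℂ × ℂ) :
    ‖thetaTerm m r p‖ =
      Real.exp (-(Real.pi / (2 * m)) * (r : ℝ) ^ 2 * p.1.im - 2 * Real.pi * r * p.2.im) := by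
  rw [thetaTerm, Complex.norm_exp]
  congr 1
  have : (2 * Real.pi * I * (r ^ 2 / (4 * m)) * p.1 + 2 * Real.pi * I * r * p.2 : ℂ) =
      ((2 * Real.pi * (r ^ 2 / (4 * m)) : ℝ) : ℂ) * (I * p.1) +
        ((2 * Real.pi * r : ℝ) : ℂ) * (I * p.2) := by
    push_cast; ring
  rw [this, add_re, re_ofReal_mul, re_ofReal_mul, I_mul_re, I_mul_re]
  ring

/-- Half of the Gaussian absorbs the linear exponent, by completing the square. -/
theorem exp_neg_sq_add_le {ε : ℝ} (hε : 0 < ε) (B x : ℝ) :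
    Real.exp (-(2 * ε) * x ^ 2 + B * |x|) ≤ Real.exp (B ^ 2 / (4 * ε)) * Real.exp (-ε * x ^ 2) := by
  rw [← Real.exp_add]
  refine Real.exp_le_exp.2 ?_
  have h : B ^ 2 / (4 * ε) + -ε * x ^ 2 - (-(2 * ε) * x ^ 2 + B * |x|) =
      (B - 2 * ε * |x|) ^ 2 / (4 * ε) := by
    rw [← sq_abs x]; field_simp; ring
  have : 0 ≤ (B - 2 * ε * |x|) ^ 2 / (4 * ε) := by positivity
  linarith

theorem norm_thetaTerm_le {m : ℕ} (hm : 0 < m) (r : ℤ) {p : ℂ × ℂ} {δ R : ℝ} (hδ : 0 < δ)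
    (h1 : δ ≤ p.1.im) (h2 : |p.2.im| ≤ R) :
    ‖thetaTerm m r p‖ ≤ Real.exp ((2 * Real.pi * R) ^ 2 / (4 * (Real.pi / (4 * m) * δ))) *
      Real.exp (-(Real.pi / (4 * m) * δ) * (r : ℝ) ^ 2) := by
  rw [norm_thetaTerm]
  refine le_trans (Real.exp_le_exp.2 ?_)
    (exp_neg_sq_add_le (show 0 < Real.pi / (4 * m) * δ by positivity) _ _)
  have e1 : -(2 * (Real.pi / (4 * m) * δ)) * (r : ℝ) ^ 2 =
      -(Real.pi / (2 * m) * (r : ℝ) ^ 2 * δ) := by ring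
  rw [e1]
  have h3 : Real.pi / (2 * m) * (r : ℝ) ^ 2 * δ ≤ Real.pi / (2 * m) * (r : ℝ) ^ 2 * p.1.im := by
    gcongr
  have h4 : -(r * p.2.im) ≤ R * |(r : ℝ)| := by
    calc -(r * p.2.im) ≤ |(r : ℝ) * p.2.im| := neg_le_abs _
      _ = |p.2.im| * |(r : ℝ)| := by rw [abs_mul, mul_comm]
      _ ≤ _ := by gcongr
  nlinarith [mul_le_mul_of_nonneg_left h4 Real.pi_pos.le]

section ThetaSeries

variable {m : ℕ} {c : ℤ → ℂ}

theorem summable_thetaSeries (hm : 0 < m) (hc : GaussSummable c) {p : ℂ × ℂ} (hp : p ∈ domain) :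
    Summable fun r => ‖c r * thetaTerm m r p‖ := by
  have hv : 0 < p.1.im := hp
  have hs := (hc (Real.pi / (4 * m) * p.1.im) (by positivity)).mul_left
    (Real.exp ((2 * Real.pi * |p.2.im|) ^ 2 / (4 * (Real.pi / (4 * m) * p.1.im))))
  refine Summable.of_nonneg_of_le (fun _ => norm_nonneg _) (fun r => ?_) hs
  rw [norm_mul, mul_left_comm]
  gcongr
  exact norm_thetaTerm_le hm r hv le_rfl le_rfl

/-- The linear form in the exponent of `thetaTerm`. -/
def thetaForm (m : ℕ) (r : ℤ) : ℂ × ℂ →L[ℂ] ℂ :=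
  (2 * Real.pi * I * (r ^ 2 / (4 * m)) : ℂ) • ContinuousLinearMap.fst ℂ ℂ ℂ +
    (2 * Real.pi * I * r : ℂ) • ContinuousLinearMap.snd ℂ ℂ ℂ

theorem norm_thetaForm_le (m : ℕ) (r : ℤ) :
    ‖thetaForm m r‖ ≤ Real.pi / (2 * m) * (r : ℝ) ^ 2 + 2 * Real.pi * |(r : ℝ)| := by
  have hτ : ‖(2 * Real.pi * I * (r ^ 2 / (4 * m)) : ℂ)‖ = Real.pi / (2 * m) * (r : ℝ) ^ 2 := by
    have := norm_thetaCoeffTau m 1 r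
    simp only [thetaCoeffTau, Pi.one_apply, mul_one, norm_one] at this
    rw [this]; ring
  have hz : ‖(2 * Real.pi * I * r : ℂ)‖ = 2 * Real.pi * |(r : ℝ)| := by
    have := norm_thetaCoeffZ 1 r
    simpa only [thetaCoeffZ, Pi.one_apply, mul_one, norm_one] using this
  refine (norm_add_le _ _).trans ?_
  rw [norm_smul, norm_smul, hτ, hz]
  have h1 := ContinuousLinearMap.norm_fst_le ℂ ℂ ℂ
  have h2 := ContinuousLinearMap.norm_snd_le ℂ ℂ ℂ
  refine add_le_add ?_ ?_
  · exact mul_le_of_le_one_right (by positivity) h1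
  · exact mul_le_of_le_one_right (by positivity) h2

theorem thetaTerm_eq (m : ℕ) (r : ℤ) (p : ℂ × ℂ) : thetaTerm m r p = exp (thetaForm m r p) := by
  simp [thetaTerm, thetaForm]

theorem hasFDerivAt_thetaSeries (hm : 0 < m) (hc : GaussSummable c) {p : ℂ × ℂ} (hp : p ∈ domain) :
    HasFDerivAt (𝕜 := ℂ) (thetaSeries m c)
      (thetaSeries m (thetaCoeffTau m c) p • ContinuousLinearMap.fst ℂ ℂ ℂ +
        thetaSeries m (thetaCoeffZ c) p • ContinuousLinearMap.snd ℂ ℂ ℂ) p := by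
  have hv : 0 < p.1.im := hp
  let δ := p.1.im / 2
  let R := ‖p.2‖ + 1
  have hδ : 0 < δ := half_pos hv
  let U : Set (ℂ × ℂ) := {x | δ < x.im} ×ˢ Metric.ball 0 R
  have hUo : IsOpen U := (isOpen_lt continuous_const continuous_im).prod Metric.isOpen_ball
  have hUc : IsPreconnected U :=
    ((convex_halfSpace_im_gt δ).prod (convex_ball 0 R)).isPreconnected
  have hpU : p ∈ U := ⟨by show δ < p.1.im; simp only [δ]; linarith, by simp [R]⟩
  let K := Real.exp ((2 * Real.pi * R) ^ 2 / (4 * (Real.pi / (4 * m) * δ)))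
  let L (r : ℤ) (x : ℂ × ℂ) : ℂ × ℂ →L[ℂ] ℂ :=
    (thetaCoeffTau m c r * thetaTerm m r x) • ContinuousLinearMap.fst ℂ ℂ ℂ +
      (thetaCoeffZ c r * thetaTerm m r x) • ContinuousLinearMap.snd ℂ ℂ ℂ
  have hterm (r : ℤ) (x : ℂ × ℂ) (_ : x ∈ U) :
      HasFDerivAt (𝕜 := ℂ) (fun x => c r * thetaTerm m r x) (L r x) x := by
    have h1 := ((thetaForm m r).hasFDerivAt (x := x)).cexp.const_mul (c r)
    simp only [← thetaTerm_eq] at h1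
    refine h1.congr_fderiv ?_
    ext <;> simp [L, thetaForm, thetaCoeffTau, thetaCoeffZ] <;> ring
  let ε := Real.pi / (4 * m) * δ
  have hε : 0 < ε := by positivity
  have hT (c' : ℤ → ℂ) (r : ℤ) (x : ℂ × ℂ) (hx : x ∈ U) : ‖c' r * thetaTerm m r x‖ ≤
      K * (‖c' r‖ * Real.exp (-ε * (r : ℝ) ^ 2)) := by
    rw [norm_mul, mul_left_comm]
    gcongr
    refine norm_thetaTerm_le hm r hδ (le_of_lt hx.1) ((abs_im_le_norm _).trans ?_)
    exact (mem_ball_zero_iff.1 hx.2).le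
  have hu := ((hc.tau m ε hε).mul_left K).add ((hc.z ε hε).mul_left K)
  have hbd (r : ℤ) (x : ℂ × ℂ) (hx : x ∈ U) : ‖L r x‖ ≤
      K * (‖thetaCoeffTau m c r‖ * Real.exp (-ε * (r : ℝ) ^ 2)) +
        K * (‖thetaCoeffZ c r‖ * Real.exp (-ε * (r : ℝ) ^ 2)) := by
    refine (norm_add_le _ _).trans ?_
    rw [norm_smul, norm_smul]
    refine add_le_add ?_ ?_
    · exact (mul_le_of_le_one_right (norm_nonneg _) (ContinuousLinearMap.norm_fst_le ℂ ℂ ℂ)).trans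
        (hT _ r x hx)
    · exact (mul_le_of_le_one_right (norm_nonneg _) (ContinuousLinearMap.norm_snd_le ℂ ℂ ℂ)).trans
        (hT _ r x hx)
  have main := hasFDerivAt_tsum_of_isPreconnected hu hUo hUc hterm hbd hpU
    (summable_thetaSeries hm hc hp).of_norm hpU
  refine main.congr_fderiv ?_
  have s1 : Summable fun r => thetaCoeffTau m c r * thetaTerm m r p :=
    (summable_thetaSeries hm (hc.tau m) hp).of_norm
  have s2 : Summable fun r => thetaCoeffZ c r * thetaTerm m r p :=
    (summable_thetaSeries hm hc.z hp).of_norm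
  simp only [L]
  rw [(s1.smul_const _).tsum_add (s2.smul_const _), s1.tsum_smul_const, s2.tsum_smul_const]
  rfl

theorem analyticAt_thetaSeries (hm : 0 < m) (hc : GaussSummable c) {p : ℂ × ℂ} (hp : p ∈ domain) :
    AnalyticAt ℝ (thetaSeries m c) p := by
  have hv : 0 < p.1.im := hp
  have h := analyticAt_tsum_exp (c := c) (L := fun r => (thetaForm m r).restrictScalars ℝ) (x := p)
    (half_pos hv) (fun y hy => ?_) ?_
  · simp only [ContinuousLinearMap.coe_restrictScalars', ← thetaTerm_eq] at h
    exact h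
  · simp only [ContinuousLinearMap.coe_restrictScalars', ← thetaTerm_eq]
    refine summable_thetaSeries hm hc ?_
    have h1 : ‖y.1 - p.1‖ < p.1.im / 2 :=
      (norm_fst_le (y - p)).trans_lt (mem_ball_iff_norm.1 hy)
    have h2 := (abs_im_le_norm (y.1 - p.1)).trans_lt h1
    rw [sub_im, abs_lt] at h2
    show 0 < y.1.im
    linarith [h2.1]
  · let δ := p.1.im / 2
    let R := |p.2.im| + δ
    have hδ : 0 < δ := half_pos hv
    let ε := Real.pi / (4 * m) * δ
    have hε : 0 < ε := by positivity
    refine Summable.of_nonneg_of_le (fun _ => by positivity) (fun r => ?_)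
      ((hc ε hε).mul_left (Real.exp ((2 * Real.pi * R) ^ 2 / (4 * ε))))
    rw [mul_left_comm]
    gcongr
    refine le_trans (Real.exp_le_exp.2 ?_) (exp_neg_sq_add_le hε _ _)
    have h1 : (thetaForm m r p).re =
        -(Real.pi / (2 * m)) * (r : ℝ) ^ 2 * p.1.im - 2 * Real.pi * r * p.2.im := by
      apply Real.exp_injective
      rw [← norm_thetaTerm, ← Complex.norm_exp, thetaTerm_eq]
    have h2 := norm_thetaForm_le m r
    rw [ContinuousLinearMap.norm_restrictScalars, ContinuousLinearMap.coe_restrictScalars', h1]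
    have h3 : p.1.im / 2 * ‖thetaForm m r‖ ≤
        p.1.im / 2 * (Real.pi / (2 * m) * (r : ℝ) ^ 2 + 2 * Real.pi * |(r : ℝ)|) := by gcongr
    have h4 : -(r * p.2.im) ≤ |p.2.im| * |(r : ℝ)| := by
      calc -(r * p.2.im) ≤ |(r : ℝ) * p.2.im| := neg_le_abs _
        _ = |p.2.im| * |(r : ℝ)| := by rw [abs_mul, mul_comm]
    -- With radius v/2 the norm of the linear form uses up only half of the Gaussian decay.
    have h5 : -(2 * ε) * (r : ℝ) ^ 2 = -(Real.pi / (2 * m)) * (r : ℝ) ^ 2 * p.1.im +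
        p.1.im / 2 * (Real.pi / (2 * m) * (r : ℝ) ^ 2) := by
      simp only [ε, δ]; field_simp; ring
    rw [h5]
    simp only [R, δ]
    nlinarith [mul_le_mul_of_nonneg_left h4 Real.pi_pos.le]

/-- Termwise, (2πir)² = 8πim · 2πi r²/(4m). -/
theorem heat_equation (hm : 0 < m) (p : ℂ × ℂ) :
    thetaSeries m (thetaCoeffZ (thetaCoeffZ c)) p =
      8 * Real.pi * I * m * thetaSeries m (thetaCoeffTau m c) p := by
  have hm' : (m : ℂ) ≠ 0 := by exact_mod_cast hm.ne'
  rw [thetaSeries, thetaSeries, ← tsum_mul_left]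
  refine tsum_congr fun r => ?_
  simp only [thetaCoeffZ, thetaCoeffTau]
  field_simp
  ring

end ThetaSeries

/-! ### The theta functions of a residue class -/

/-- The indicator function of the residue class `s mod 2m`. -/
def residueCoeff (m : ℕ) (s : ZMod (2 * m)) (r : ℤ) : ℂ := if (r : ZMod (2 * m)) = s then 1 else 0

/-- `θ_{m,s}(τ, z) = ∑_{r ≡ s mod 2m} e^{2πi (r² τ / 4m + r z)}`. -/
def theta (m : ℕ) (s : ZMod (2 * m)) : ℂ × ℂ → ℂ := thetaSeries m (residueCoeff m s)

theorem norm_residueCoeff_le (m : ℕ) (s : ZMod (2 * m)) (r : ℤ) : ‖residueCoeff m s r‖ ≤ 1 := by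
  unfold residueCoeff
  split_ifs <;> simp

theorem gaussSummable_residueCoeff (m : ℕ) (s : ZMod (2 * m)) : GaussSummable (residueCoeff m s) :=
  GaussSummable.of_norm_le_one (norm_residueCoeff_le m s)

section Theta

variable {m : ℕ}

theorem residueCoeff_add (s : ZMod (2 * m)) (r a : ℤ) :
    residueCoeff m s (r + 2 * m * a) = residueCoeff m s r := by
  have : ((r + 2 * m * a : ℤ) : ZMod (2 * m)) = (r : ZMod (2 * m)) := by
    have h := ZMod.natCast_self (2 * m)
    push_cast at h ⊢
    rw [h]; ring
  rw [residueCoeff, this, residueCoeff]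

/-- The shift r ↦ r + 2ma preserves the residue class and completes the square in the exponent. -/
theorem theta_heisenberg (hm : 0 < m) (s : ZMod (2 * m)) (a b : ℤ) (p : ℂ × ℂ) :
    exp (2 * Real.pi * I * m * ((a : ℂ) ^ 2 * p.1 + 2 * a * p.2)) *
      theta m s (p.1, p.2 + a * p.1 + b) = theta m s p := by
  have hm' : (m : ℂ) ≠ 0 := by exact_mod_cast hm.ne'
  rw [theta, thetaSeries, thetaSeries, ← tsum_mul_left,
    ← (Equiv.addRight (2 * m * a : ℤ)).tsum_eq fun r => residueCoeff m s r * thetaTerm m r p]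
  refine tsum_congr fun r => ?_
  simp only [Equiv.coe_addRight, residueCoeff_add]
  rw [mul_left_comm, thetaTerm, thetaTerm, ← exp_add]
  congr 1
  rw [exp_eq_exp_iff_exists_int]
  -- Translating z by the integer b changes the exponent by 2πi·rb.
  refine ⟨r * b, ?_⟩
  push_cast
  field_simp
  ring

theorem theta_eq_jacobiTheta₂ (hm : 0 < m) (j : ℤ) (p : ℂ × ℂ) :
    theta m (j : ZMod (2 * m)) p =
      exp (2 * Real.pi * I * (j ^ 2 / (4 * m)) * p.1 + 2 * Real.pi * I * j * p.2) *
        jacobiTheta₂ (j * p.1 + 2 * m * p.2) (2 * m * p.1) := by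
  have hm' : (m : ℂ) ≠ 0 := by exact_mod_cast hm.ne'
  have hinj : Function.Injective fun n : ℤ => j + 2 * m * n := by
    intro n n' h
    have h' : (2 * m : ℤ) * n = 2 * m * n' := by simpa using h
    exact mul_left_cancel₀ (by positivity) h'
  rw [theta, thetaSeries, ← hinj.tsum_eq (f := fun r => residueCoeff m _ r * thetaTerm m r p),
    jacobiTheta₂, ← tsum_mul_left]
  · refine tsum_congr fun n => ?_
    rw [residueCoeff_add, residueCoeff, if_pos rfl, one_mul, thetaTerm, jacobiTheta₂_term, ← exp_add]
    congr 1
    push_cast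
    field_simp
    ring
  · intro r hr
    have h1 : residueCoeff m (j : ZMod (2 * m)) r ≠ 0 := left_ne_zero_of_mul hr
    have h2 : (r : ZMod (2 * m)) = j := by
      by_contra h
      exact h1 (if_neg h)
    rw [eq_comm, ZMod.intCast_eq_intCast_iff_dvd_sub] at h2
    obtain ⟨n, hn⟩ := h2
    push_cast at hn
    exact ⟨n, by simp only; linarith⟩

/-- The sum is 1-periodic in x, so only fractional parts matter and the bound is uniform. -/
theorem summable_exp_neg_sq_add {ε : ℝ} (hε : 0 < ε) : ∃ K : ℝ, ∀ x : ℝ,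
    (Summable fun r : ℤ => Real.exp (-ε * (r + x) ^ 2)) ∧
    ∑' r : ℤ, Real.exp (-ε * (r + x) ^ 2) ≤ K := by
  have hs := (summable_exp_neg_sq_int (half_pos hε)).mul_left (Real.exp ε)
  refine ⟨∑' r : ℤ, Real.exp ε * Real.exp (-(ε / 2) * (r : ℝ) ^ 2), fun x => ?_⟩
  have hle (r : ℤ) : Real.exp (-ε * (r + Int.fract x) ^ 2) ≤
      Real.exp ε * Real.exp (-(ε / 2) * (r : ℝ) ^ 2) := by
    rw [← Real.exp_add]
    refine Real.exp_le_exp.2 ?_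
    have h1 := Int.fract_nonneg x
    have h2 := (Int.fract_lt_one x).le
    have h3 : (r : ℝ) ^ 2 / 2 - 1 ≤ (r + Int.fract x) ^ 2 := by
      nlinarith [sq_nonneg ((r : ℝ) + 2 * Int.fract x)]
    nlinarith [mul_le_mul_of_nonneg_left h3 hε.le]
  have hs' : Summable fun r : ℤ => Real.exp (-ε * (r + Int.fract x) ^ 2) :=
    Summable.of_nonneg_of_le (fun _ => (Real.exp_pos _).le) hle hs
  have hfun : (fun r : ℤ => Real.exp (-ε * (r + x) ^ 2)) =
      (fun r : ℤ => Real.exp (-ε * (r + Int.fract x) ^ 2)) ∘ Equiv.addRight ⌊x⌋ := by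
    ext r
    simp only [Function.comp_apply, Equiv.coe_addRight]
    push_cast
    rw [add_assoc, Int.floor_add_fract]
  rw [hfun]
  refine ⟨(Equiv.addRight ⌊x⌋).summable_iff.2 hs', ?_⟩
  have := (Equiv.addRight ⌊x⌋).tsum_eq fun r : ℤ => Real.exp (-ε * (r + Int.fract x) ^ 2)
  exact this.le.trans (hs'.tsum_le_tsum hle hs)

/-- Completing the square around r = -2my/v extracts the factor e^{2πmy²/v}; for v ≥ 1 the remaining
Gaussian sum is bounded uniformly in its centre. -/
theorem exists_norm_theta_le (hm : 0 < m) : ∃ K : ℝ, 0 ≤ K ∧ ∀ s : ZMod (2 * m), ∀ p : ℂ × ℂ,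
    1 ≤ p.1.im → ‖theta m s p‖ ≤ K * Real.exp (2 * Real.pi * m * p.2.im ^ 2 / p.1.im) := by
  have hε : 0 < Real.pi / (2 * m) := by positivity
  obtain ⟨K, hK⟩ := summable_exp_neg_sq_add hε
  have hK0 : 0 ≤ K := (tsum_nonneg fun r : ℤ => (Real.exp_pos _).le).trans (hK 0).2
  refine ⟨K, hK0, fun s p hp => ?_⟩
  have hv : 0 < p.1.im := one_pos.trans_le hp
  have hm' : (0 : ℝ) < m := by exact_mod_cast hm
  set E := Real.exp (2 * Real.pi * m * p.2.im ^ 2 / p.1.im)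
  set x := 2 * m * p.2.im / p.1.im with hx
  have hterm (r : ℤ) : ‖residueCoeff m s r * thetaTerm m r p‖ ≤
      E * Real.exp (-(Real.pi / (2 * m)) * (r + x) ^ 2) := by
    rw [norm_mul]
    refine (mul_le_of_le_one_left (norm_nonneg _) (norm_residueCoeff_le m s r)).trans ?_
    rw [norm_thetaTerm, ← Real.exp_add]
    refine Real.exp_le_exp.2 ?_
    have e1 : -(Real.pi / (2 * m)) * (r : ℝ) ^ 2 * p.1.im - 2 * Real.pi * r * p.2.im =
        2 * Real.pi * m * p.2.im ^ 2 / p.1.im - Real.pi / (2 * m) * (p.1.im * (r + x) ^ 2) := by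
      rw [hx]; field_simp; ring
    rw [e1]
    have h2 : (r + x) ^ 2 ≤ p.1.im * (r + x) ^ 2 := le_mul_of_one_le_left (sq_nonneg _) hp
    nlinarith [mul_le_mul_of_nonneg_left h2 hε.le]
  have hs := (hK x).1.mul_left E
  calc ‖theta m s p‖ ≤ ∑' r : ℤ, E * Real.exp (-(Real.pi / (2 * m)) * (r + x) ^ 2) :=
        tsum_of_norm_bounded hs.hasSum hterm
    _ = E * ∑' r : ℤ, Real.exp (-(Real.pi / (2 * m)) * (r + x) ^ 2) := tsum_mul_left
    _ ≤ E * K := by gcongr; exact (hK x).2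
    _ = K * E := mul_comm _ _

variable [NeZero (2 * m)]

/-- Splitting a sum over `ℤ` into residue classes. -/
theorem tsum_eq_sum_theta (hm : 0 < m) (g : ZMod (2 * m) → ℂ) {p : ℂ × ℂ} (hp : p ∈ domain) :
    ∑' r : ℤ, g r * thetaTerm m r p = ∑ s, g s * theta m s p := by
  simp only [theta, thetaSeries, ← tsum_mul_left]
  rw [← Summable.tsum_finsetSum fun s _ =>
    (summable_thetaSeries hm (gaussSummable_residueCoeff m s) hp).of_norm.mul_left (g s)]
  refine tsum_congr fun r => ?_
  simp [residueCoeff]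

theorem neg_I_mul_div_cpow {τ : ℂ} (hτ : τ ∈ upperHalf) {x : ℝ} (hx : 0 < x) (q : ℂ) :
    (-I * (τ / x)) ^ q = (-I * τ) ^ q * (x : ℂ) ^ (-q) := by
  have h0 : -I * τ ≠ 0 := slitPlane_ne_zero (neg_I_mul_mem_slitPlane hτ)
  have hx' : (x : ℂ) ≠ 0 := by exact_mod_cast hx.ne'
  have hxi : (0 : ℝ) < x⁻¹ := inv_pos.2 hx
  have e1 : -I * (τ / x) = ((x⁻¹ : ℝ) : ℂ) * (-I * τ) := by push_cast; field_simp
  rw [e1, cpow_def_of_ne_zero (mul_ne_zero (by exact_mod_cast hxi.ne') h0), cpow_def_of_ne_zero h0,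
    cpow_def_of_ne_zero hx', log_ofReal_mul hxi h0, Real.log_inv, ← exp_add, ← ofReal_log hx.le]
  congr 1
  push_cast
  ring

/-- Poisson summation, through the functional equation of `jacobiTheta₂`. At (z - j/(2m), τ/(2m))
its series runs over all r with the character e^{-2πijr/(2m)}, which splits into theta functions,
while the inverted side is the single class j. -/
theorem theta_S (hm : 0 < m) (s : ZMod (2 * m)) {p : ℂ × ℂ} (hp : p ∈ domain) :
    theta m s (-1 / p.1, p.2 / p.1) = (-I * p.1) ^ (1 / 2 : ℂ) *
      ((2 * m : ℝ) : ℂ) ^ (-(1 / 2) : ℂ) *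
      exp (2 * Real.pi * I * m * (p.2 ^ 2 / p.1)) *
      ∑ r, ZMod.stdAddChar (-(s * r)) * theta m r p := by
  have hτ : p.1 ∈ upperHalf := hp
  have h0 := ne_zero_of_mem_upperHalf hτ
  have hm' : (m : ℂ) ≠ 0 := by exact_mod_cast hm.ne'
  have hmr : (0 : ℝ) < 2 * m := by positivity
  obtain ⟨j, rfl⟩ := ZMod.intCast_surjective s
  rw [theta_eq_jacobiTheta₂ hm]
  have h1 := jacobiTheta₂_functional_equation (p.2 - j / (2 * m)) (p.1 / ((2 * m : ℝ) : ℂ))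
  have e1 : (p.2 - j / (2 * m)) / (p.1 / ((2 * m : ℝ) : ℂ)) =
      j * (-1 / p.1) + 2 * m * (p.2 / p.1) := by
    push_cast; field_simp; ring
  have e2 : -1 / (p.1 / ((2 * m : ℝ) : ℂ)) = 2 * m * (-1 / p.1) := by
    push_cast; field_simp
  rw [e1, e2] at h1
  have hne : (-I * (p.1 / ((2 * m : ℝ) : ℂ))) ^ (1 / 2 : ℂ) ≠ 0 := by
    rw [Ne, cpow_eq_zero_iff, not_and_or]
    left
    have : ((2 * m : ℝ) : ℂ) ≠ 0 := by exact_mod_cast hmr.ne'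
    simp [h0, hm']
  have h2 : jacobiTheta₂ (p.2 - j / (2 * m)) (p.1 / ((2 * m : ℝ) : ℂ)) =
      ∑ r, ZMod.stdAddChar (-((j : ZMod (2 * m)) * r)) * theta m r p := by
    rw [← tsum_eq_sum_theta hm (fun r => ZMod.stdAddChar (-((j : ZMod (2 * m)) * r))) hp,
      jacobiTheta₂]
    refine tsum_congr fun n => ?_
    have : -((j : ZMod (2 * m)) * (n : ZMod (2 * m))) = ((-(j * n) : ℤ) : ZMod (2 * m)) := by
      push_cast; ring
    rw [this, ZMod.stdAddChar_coe, thetaTerm, ← exp_add, jacobiTheta₂_term]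
    congr 1
    push_cast
    field_simp
    ring
  rw [← h2, ← neg_I_mul_div_cpow hτ hmr, h1]
  simp only
  set J := jacobiTheta₂ (j * (-1 / p.1) + 2 * m * (p.2 / p.1)) (2 * m * (-1 / p.1))
  set W := (-I * (p.1 / ((2 * m : ℝ) : ℂ))) ^ (1 / 2 : ℂ)
  have e3 : exp (2 * Real.pi * I * (j ^ 2 / (4 * m)) * (-1 / p.1) + 2 * Real.pi * I * j * (p.2 / p.1)) =
      exp (2 * Real.pi * I * m * (p.2 ^ 2 / p.1)) *
        exp (-Real.pi * I * (p.2 - j / (2 * m)) ^ 2 / (p.1 / ((2 * m : ℝ) : ℂ))) := by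
    rw [← exp_add]
    congr 1
    push_cast
    field_simp
    ring
  rw [e3]
  field_simp

end Theta

/-! ### The theta decomposition -/

section Decomposition

variable {m : ℕ}

theorem monomial_eq (hm : 0 < m) (l r : ℤ) (p : ℂ × ℂ) :
    monomial l r p = qExp m (disc m l r) p.1 * thetaTerm m r p := by
  have hm' : (m : ℂ) ≠ 0 := by exact_mod_cast hm.ne'
  rw [monomial, qExp, thetaTerm, ← exp_add, ← exp_add, disc]
  congr 1
  push_cast
  field_simp
  ring

theorem two_mul_cpow_neg_half_sq (hm : 0 < m) :
    ((2 * m : ℝ) : ℂ) ^ (-(1 / 2) : ℂ) * ((2 * m : ℝ) : ℂ) ^ (-(1 / 2) : ℂ) * (2 * m) = 1 := by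
  have hmr : (0 : ℝ) < 2 * m := by positivity
  have hmc : ((2 * m : ℝ) : ℂ) ≠ 0 := by exact_mod_cast hmr.ne'
  rw [← cpow_add _ _ hmc]
  have : (-(1 / 2) + -(1 / 2) : ℂ) = -1 := by norm_num
  rw [this, cpow_neg_one]
  push_cast at hmc ⊢
  exact inv_mul_cancel₀ hmc

variable [NeZero (2 * m)]

/-- Once the residue class of r is fixed, the sums over D and r are independent and factor as an
absolutely convergent product. -/
theorem tsum_prod_theta (hm : 0 < m) {p : ℂ × ℂ} (hp : p ∈ domain) {f : ZMod (2 * m) → ℤ → ℂ}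
    (hf : ∀ s, Summable fun D => ‖f s D‖) :
    ∑' x : ℤ × ℤ, f (x.2 : ZMod (2 * m)) x.1 * thetaTerm m x.2 p =
      ∑ s, (∑' D, f s D) * theta m s p := by
  have hr (s : ZMod (2 * m)) : Summable fun r => ‖residueCoeff m s r * thetaTerm m r p‖ :=
    summable_thetaSeries hm (gaussSummable_residueCoeff m s) hp
  have h1 (s : ZMod (2 * m)) : (∑' D, f s D) * theta m s p =
      ∑' x : ℤ × ℤ, f s x.1 * (residueCoeff m s x.2 * thetaTerm m x.2 p) :=
    tsum_mul_tsum_of_summable_norm (hf s) (hr s)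
  simp only [h1]
  rw [← Summable.tsum_finsetSum fun s _ => (summable_mul_of_summable_norm (hf s) (hr s))]
  refine tsum_congr fun x => ?_
  simp [residueCoeff]

theorem fourierSeries_eq {k : ℕ} (hk : 0 < k) (hm : 0 < m) {cp cm : ℤ → ℤ → ℂ}
    (hcp : DiscInvariant m cp) (hcm : DiscInvariant m (negPart m cm))
    (hadm : ∀ s, Admissible (coeff m cp s) (coeff m (negPart m cm) s)) {p : ℂ × ℂ}
    (hp : p ∈ domain) :
    fourierSeries k m cp cm p = ∑ s, compSeries k m (coeff m cp s) (coeff m (negPart m cm) s) p.1 *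
      theta m s p := by
  have e1 : ∑' a : ℤ × ℤ, cp a.1 a.2 * monomial a.1 a.2 p =
      ∑ s, holSeries m (coeff m cp s) p.1 * theta m s p := by
    simp only [monomial_eq hm]
    rw [tsum_disc_prod hm hcp fun D r => qExp m D p.1 * thetaTerm m r p]
    simp only [← mul_assoc]
    refine tsum_prod_theta hm hp (f := fun s D => coeff m cp s D * qExp m D p.1) fun s => ?_
    obtain ⟨N, hN⟩ := (hadm s).hol_support
    exact summable_holSeries hm (hadm s).hol hN hp
  have e2 : (∑' a : ℤ × ℤ, if disc m a.1 a.2 < 0 then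
      cm a.1 a.2 *
        (incGamma (3 / 2 - k) (-(disc m a.1 a.2 : ℝ) * Real.pi * p.1.im / m) : ℂ) *
        monomial a.1 a.2 p else 0) =
      ∑ s, nonSeries (3 / 2 - k) m (coeff m (negPart m cm) s) p.1 * theta m s p := by
    have e3 : ∀ a : ℤ × ℤ, (if disc m a.1 a.2 < 0 then
      cm a.1 a.2 *
        (incGamma (3 / 2 - k) (-(disc m a.1 a.2 : ℝ) * Real.pi * p.1.im / m) : ℂ) *
        monomial a.1 a.2 p else 0) = negPart m cm a.1 a.2 *
        ((incGamma (3 / 2 - k) (-(disc m a.1 a.2 : ℝ) * Real.pi * p.1.im / m) : ℂ) *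
          qExp m (disc m a.1 a.2) p.1 * thetaTerm m a.2 p) := fun a => by
      rw [monomial_eq hm, negPart]
      split_ifs
      · ring
      · simp
    simp only [e3]
    rw [tsum_disc_prod hm hcm fun D r => (incGamma (3 / 2 - k)
      (-(D : ℝ) * Real.pi * p.1.im / m) : ℂ) * qExp m D p.1 * thetaTerm m r p]
    simp only [← mul_assoc]
    refine tsum_prod_theta hm hp (f := fun s D => coeff m (negPart m cm) s D *
      (incGamma (3 / 2 - k) (-(D : ℝ) * Real.pi * p.1.im / m) : ℂ) * qExp m D p.1) fun s => ?_
    exact summable_nonSeries (Admissible.weight_le hk) hm (hadm s).non (hadm s).non_support hp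
  rw [fourierSeries, e1, e2, ← Finset.sum_add_distrib]
  simp only [compSeries, add_mul]

/-! ### The transformation under `S` -/

theorem label_bijective :
    Function.Bijective fun j : Fin (2 * m) => ((label j : ℤ) : ZMod (2 * m)) := by
  rw [Fintype.bijective_iff_injective_and_card]
  refine ⟨fun i j h => ?_, by simp [ZMod.card]⟩
  have h' := (ZMod.intCast_eq_intCast_iff_dvd_sub _ _ _).1 h
  simp only [label] at h'
  obtain ⟨n, hn⟩ := h'
  have hi := i.2
  have hj := j.2
  have hn0 : n = 0 := by
    by_contra hne
    rcases lt_or_gt_of_ne hne with hlt | hgt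
    · have : n ≤ -1 := by omega
      push_cast at hn
      nlinarith
    · have : 1 ≤ n := by omega
      push_cast at hn
      nlinarith
  rw [hn0, mul_zero] at hn
  exact Fin.ext (by omega)

/-- Conjugation turns i^{-1/2} into i^{1/2}, which combines with i^{k-1/2} to an integral power of
i. -/
theorem weil_weight (k : ℕ) (hm : 0 < m) (j l : Fin (2 * m)) :
    I ^ ((k : ℂ) - 1 / 2) * weilSBar m j l = I ^ k * ((2 * m : ℝ) : ℂ) ^ (-(1 / 2) : ℂ) *
      ZMod.stdAddChar ((label j : ZMod (2 * m)) * (label l : ZMod (2 * m))) := by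
  have hmr : (0 : ℝ) < 2 * m := by positivity
  have hmc : ((2 * m : ℝ) : ℂ) ≠ 0 := by exact_mod_cast hmr.ne'
  have e1 : (2 * I * m : ℂ) = ((2 * m : ℝ) : ℂ) * I := by push_cast; ring
  have e2 : (2 * I * m : ℂ) ^ (1 / 2 : ℂ) = ((2 * m : ℝ) : ℂ) ^ (1 / 2 : ℂ) * I ^ (1 / 2 : ℂ) := by
    rw [e1, cpow_def_of_ne_zero (mul_ne_zero hmc I_ne_zero), cpow_def_of_ne_zero hmc,
      cpow_def_of_ne_zero I_ne_zero, log_ofReal_mul hmr I_ne_zero, ← exp_add, ← ofReal_log hmr.le]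
    congr 1; ring
  have e3 : (starRingEnd ℂ) (1 / I ^ (1 / 2 : ℂ)) = I ^ (1 / 2 : ℂ) := by
    rw [cpow_def_of_ne_zero I_ne_zero, log_I, one_div, ← exp_neg, ← exp_conj]
    congr 1
    simp only [map_neg, map_mul, map_div₀, conj_ofReal, conj_I, map_ofNat, map_one]
    ring
  have e4 : (starRingEnd ℂ) (1 / ((2 * m : ℝ) : ℂ) ^ (1 / 2 : ℂ)) =
      ((2 * m : ℝ) : ℂ) ^ (-(1 / 2) : ℂ) := by
    rw [one_div, ← cpow_neg]
    have : ((2 * m : ℝ) : ℂ) ^ (-(1 / 2) : ℂ) = (((2 * m : ℝ) ^ (-(1 / 2) : ℝ) : ℝ) : ℂ) := by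
      rw [ofReal_cpow hmr.le]; push_cast; rfl
    rw [this, conj_ofReal]
  have e5 : I ^ ((k : ℂ) - 1 / 2) * I ^ (1 / 2 : ℂ) = I ^ k := by
    rw [← cpow_add _ _ I_ne_zero, sub_add_cancel, cpow_natCast]
  have e6 : ((label j : ZMod (2 * m)) * (label l : ZMod (2 * m))) =
      ((label j * label l : ℤ) : ZMod (2 * m)) := by push_cast; ring
  rw [weilSBar, Matrix.map_apply, weilS, Matrix.of_apply, e2, map_mul, ← one_div_mul_one_div,
    map_mul, e3, e4, ← exp_conj, e6, ZMod.stdAddChar_coe, ← e5]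
  have e7 : (starRingEnd ℂ) (-(2 * Real.pi * I * (label l * label j : ℂ) / (2 * m))) =
      2 * Real.pi * I * ((label j * label l : ℤ) : ℂ) / ((2 * m : ℕ) : ℂ) := by
    simp only [map_neg, map_mul, map_div₀, conj_ofReal, conj_I, map_ofNat, map_natCast, map_intCast]
    push_cast
    ring
  rw [e7]
  ring

/-- Functional equation of the component functions. -/
def ComponentsModular (k m : ℕ) [NeZero (2 * m)] (h : ZMod (2 * m) → ℂ → ℂ) : Prop :=
  ∀ s, ∀ τ ∈ upperHalf, h s τ = ∑ r, I ^ k * ((2 * m : ℝ) : ℂ) ^ (-(1 / 2) : ℂ) *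
    ZMod.stdAddChar (s * r) * ((-I * τ) ^ ((1 / 2 : ℂ) - k) * h r (-1 / τ))

theorem componentsModular {k : ℕ} (hk : 0 < k) (hm : 0 < m) {cp cm : ℤ → ℤ → ℂ}
    (hcp : DiscInvariant m cp) (hcm : DiscInvariant m (negPart m cm))
    (hadm : ∀ s, Admissible (coeff m cp s) (coeff m (negPart m cm) s)) {Sc : Set (ℝ → ℂ)}
    (hSc : ∀ φ ∈ Sc, IsTestFunction φ)
    (hSc_twist : ∀ φ ∈ Sc, ∀ s : ℂ, twist φ s ∈ Sc)
    (hSc_ne : ∀ y : ℝ, 0 < y → ∃ φ ∈ Sc, φ y ≠ 0)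
    (hL : ∀ φ ∈ Sc, LSer k m cp cm φ =
      I ^ ((k : ℂ) - 1 / 2) • (weilSBar m).mulVec (LSer k m cp cm (slashS k φ)))
    (hLα : ∀ φ ∈ Sc, LSerAlpha k m cp cm φ =
      -I ^ ((k : ℂ) - 1 / 2) • (weilSBar m).mulVec (LSerAlpha k m cp cm (slashS k φ))) :
    ComponentsModular k m fun s => compSeries k m (coeff m cp s) (coeff m (negPart m cm) s) := by
  let bp (j : Fin (2 * m)) : ℤ → ℂ := coeff m cp ((label j : ℤ) : ZMod (2 * m))
  let bn (j : Fin (2 * m)) : ℤ → ℂ := coeff m (negPart m cm) ((label j : ℤ) : ZMod (2 * m))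
  have hb (j : Fin (2 * m)) : Admissible (bp j) (bn j) := hadm _
  let w (j l : Fin (2 * m)) : ℂ := I ^ ((k : ℂ) - 1 / 2) * weilSBar m j l
  have h1 := functional_equation_of_integrals k hSc hSc_twist hSc_ne
    (H := fun j t => compSeries k m (bp j) (bn j) (t * I))
    (fun j => (hb j).compSeries_continuousOn_axis hk hm) w fun φ hφ j => by
      have hφb := (hSc φ hφ).boundedTest
      have := congrFun (hL φ hφ) j
      rw [LSer_eq hk hm hcp hcm j (hb j) hφb] at this
      refine this.trans ?_
      simp only [Pi.smul_apply, smul_eq_mul, Matrix.mulVec, dotProduct, Finset.mul_sum, w]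
      refine Finset.sum_congr rfl fun l _ => ?_
      rw [LSer_eq hk hm hcp hcm l (hb l) (hφb.slashS k), mul_assoc]
  have h2 := functional_equation_of_integrals k hSc hSc_twist hSc_ne
    (H := fun j t => alphaAxis k m (bp j) (bn j) t)
    (fun j => alphaAxis_continuousOn (hb j) hk hm) (fun j l => -w j l) fun φ hφ j => by
      have hφb := (hSc φ hφ).boundedTest
      have := congrFun (hLα φ hφ) j
      rw [LSerAlpha_eq hk hm hcp hcm j (hb j) hφb] at this
      refine this.trans ?_
      simp only [Pi.smul_apply, smul_eq_mul, Matrix.mulVec, dotProduct, Finset.mul_sum, w]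
      refine Finset.sum_congr rfl fun l _ => ?_
      rw [LSerAlpha_eq hk hm hcp hcm l (hb l) (hφb.slashS k)]
      ring
  -- The negative sign in the second functional equation reflects that S reverses the normal
  -- direction; it sits in the weights of `h2`.
  have main := modular_of_axis hk hm hb w (fun s t ht => by simpa using h1 s ht)
    (fun s t ht => by simpa using h2 s ht)
  intro s τ hτ
  obtain ⟨j, rfl⟩ := label_bijective.2 s
  refine (main j hτ).trans ?_
  refine Fintype.sum_bijective _ label_bijective _ _ fun l => ?_
  simp only [w, weil_weight k hm]
  rfl

theorem neg_I_mul_cpow_mul_cpow_neg_one_div {τ : ℂ} (hτ : τ ∈ upperHalf) (q : ℂ) :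
    (-I * τ) ^ q * (-I * (-1 / τ)) ^ q = 1 := by
  have h0 := ne_zero_of_mem_upperHalf hτ
  have e : -I * (-1 / τ) = (-I * τ)⁻¹ := by
    rw [mul_inv, inv_neg, inv_I]; field_simp
  have harg : arg (-I * τ) ≠ Real.pi := slitPlane_arg_ne_pi (neg_I_mul_mem_slitPlane hτ)
  rw [e, inv_cpow _ _ harg, mul_inv_cancel₀]
  rw [Ne, cpow_eq_zero_iff, not_and_or]
  left
  simp [h0]

/-- Apply S twice. The automorphy factors cancel, (i^k)² = 1 because k is even, and orthogonality of
characters leaves only the class -s. -/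
theorem ComponentsModular.neg {k : ℕ} (hk2 : Even k) (hm : 0 < m) {h : ZMod (2 * m) → ℂ → ℂ}
    (hh : ComponentsModular k m h) (s : ZMod (2 * m)) {τ : ℂ} (hτ : τ ∈ upperHalf) :
    h (-s) τ = h s τ := by
  have h0 := ne_zero_of_mem_upperHalf hτ
  have hτ' := neg_one_div_mem_upperHalf hτ
  have hττ : -1 / (-1 / τ) = τ := by field_simp
  rw [hh s τ hτ]
  set S0 := ((2 * m : ℝ) : ℂ) ^ (-(1 / 2) : ℂ) with hS0
  set q : ℂ := (1 / 2 : ℂ) - k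
  have e1 (r : ZMod (2 * m)) : I ^ k * S0 * ZMod.stdAddChar (s * r) * ((-I * τ) ^ q * h r (-1 / τ)) =
      ∑ u, S0 * S0 * h u τ * ZMod.stdAddChar (r * (s + u)) := by
    rw [hh r _ hτ', hττ, Finset.mul_sum, Finset.mul_sum]
    refine Finset.sum_congr rfl fun u _ => ?_
    have hI : (I ^ k : ℂ) * I ^ k = 1 := by
      rw [← mul_pow, I_mul_I]; exact hk2.neg_one_pow
    have hadd : ZMod.stdAddChar (r * (s + u)) =
        ZMod.stdAddChar (s * r) * (ZMod.stdAddChar (r * u) : ℂ) := by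
      rw [← AddChar.map_add_eq_mul]; congr 1; ring
    rw [hadd]
    have hX := neg_I_mul_cpow_mul_cpow_neg_one_div hτ q
    set X := S0 * S0 * ZMod.stdAddChar (s * r) * ZMod.stdAddChar (r * u) * h u τ with hXdef
    linear_combination (X * ((-I * τ) ^ q * (-I * (-1 / τ)) ^ q)) * hI + X * hX
  simp only [e1]
  rw [Finset.sum_comm]
  simp only [← Finset.mul_sum]
  have e2 (u : ZMod (2 * m)) : ∑ r, (ZMod.stdAddChar (r * (s + u)) : ℂ) =
      if u = -s then (2 * m : ℂ) else 0 := by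
    rw [AddChar.sum_mulShift _ (ZMod.isPrimitive_stdAddChar (2 * m)), ZMod.card]
    have : s + u = 0 ↔ u = -s := by rw [add_comm]; exact add_eq_zero_iff_eq_neg
    simp only [this]
    split_ifs <;> simp
  simp only [e2, mul_ite, mul_zero, Finset.sum_ite_eq', Finset.mem_univ, if_true]
  linear_combination (-h (-s) τ) * two_mul_cpow_neg_half_sq hm

/-- The symmetry h_{-s} = h_s flips the character in the law for h, so h and θ transform with the
same symmetric matrix; expanding h at τ and θ at -1/τ then gives the same double sum, without
inverting the matrix. -/
theorem sum_theta_S {k : ℕ} (hk2 : Even k) (hm : 0 < m) {h : ZMod (2 * m) → ℂ → ℂ}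
    (hh : ComponentsModular k m h) {p : ℂ × ℂ} (hp : p ∈ domain) :
    p.1 ^ (-(k : ℤ)) * exp (-(2 * Real.pi * I * m * (p.2 ^ 2 / p.1))) *
      ∑ s, h s (-1 / p.1) * theta m s (-1 / p.1, p.2 / p.1) = ∑ s, h s p.1 * theta m s p := by
  have hτ : p.1 ∈ upperHalf := hp
  have h0 := ne_zero_of_mem_upperHalf hτ
  have hw0 : -I * p.1 ≠ 0 := slitPlane_ne_zero (neg_I_mul_mem_slitPlane hτ)
  set S0 := ((2 * m : ℝ) : ℂ) ^ (-(1 / 2) : ℂ) with hS0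
  have e1 (s : ZMod (2 * m)) : h s p.1 = (-I * p.1) ^ (1 / 2 : ℂ) * p.1 ^ (-(k : ℤ)) * S0 *
      ∑ r, ZMod.stdAddChar (-(r * s)) * h r (-1 / p.1) := by
    rw [← hh.neg hk2 hm s hτ, hh (-s) _ hτ, Finset.mul_sum]
    refine Finset.sum_congr rfl fun r _ => ?_
    -- For even k the powers of ±i cancel, leaving τ^{-k} times the factor of weight 1/2 that theta
    -- contributes.
    have e2 : I ^ k * (-I * p.1) ^ ((1 / 2 : ℂ) - k) = (-I * p.1) ^ (1 / 2 : ℂ) * p.1 ^ (-(k : ℤ)) := by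
      rw [cpow_sub _ _ hw0, cpow_natCast, mul_pow, zpow_neg, zpow_natCast, hk2.neg_pow]
      have : (I ^ k : ℂ) ≠ 0 := pow_ne_zero _ I_ne_zero
      field_simp
    have e3 : -s * r = -(r * s) := by ring
    rw [e3]
    linear_combination (S0 * ZMod.stdAddChar (-(r * s)) * h r (-1 / p.1)) * e2
  have e4 : exp (-(2 * Real.pi * I * m * (p.2 ^ 2 / p.1))) *
      exp (2 * Real.pi * I * m * (p.2 ^ 2 / p.1)) = 1 := by
    rw [← exp_add]; simp
  simp only [e1, theta_S hm _ hp, Finset.mul_sum, Finset.sum_mul]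
  rw [Finset.sum_comm]
  refine Finset.sum_congr rfl fun s _ => Finset.sum_congr rfl fun r _ => ?_
  linear_combination (p.1 ^ (-(k : ℤ)) * h r (-1 / p.1) * (-I * p.1) ^ (1 / 2 : ℂ) * S0 *
    ZMod.stdAddChar (-(r * s)) * theta m s p) * e4

end Decomposition

/-! ### The action of `SL₂(ℤ)` -/

section Slash

variable {k m : ℕ}

/-- The automorphy factor `cτ + d`. -/
def autFactor (γ : Matrix.SpecialLinearGroup (Fin 2) ℤ) (τ : ℂ) : ℂ := (γ 1 0 : ℂ) * τ + (γ 1 1 : ℂ)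

/-- The action of `SL₂(ℤ)` on `ℍ × ℂ`. -/
def moebius (γ : Matrix.SpecialLinearGroup (Fin 2) ℤ) (p : ℂ × ℂ) : ℂ × ℂ :=
  (((γ 0 0 : ℂ) * p.1 + (γ 0 1 : ℂ)) / autFactor γ p.1, p.2 / autFactor γ p.1)

theorem slash_def (k m : ℕ) (F : ℂ × ℂ → ℂ) (γ : Matrix.SpecialLinearGroup (Fin 2) ℤ)
    (p : ℂ × ℂ) : slash k m F γ p = autFactor γ p.1 ^ (-(k : ℤ)) *
      exp (-(2 * Real.pi * I * m * ((γ 1 0 : ℂ) * p.2 ^ 2 / autFactor γ p.1))) *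
        F (moebius γ p) := rfl

theorem det_eq (γ : Matrix.SpecialLinearGroup (Fin 2) ℤ) :
    (γ 0 0 : ℂ) * γ 1 1 - γ 0 1 * γ 1 0 = 1 := by
  have := γ.det_coe
  rw [Matrix.det_fin_two] at this
  exact_mod_cast this

theorem autFactor_ne_zero (γ : Matrix.SpecialLinearGroup (Fin 2) ℤ) {τ : ℂ} (hτ : τ ∈ upperHalf) :
    autFactor γ τ ≠ 0 := by
  intro h
  have him := congrArg im h
  have hre := congrArg re h
  have hv : 0 < τ.im := hτ
  simp [autFactor] at him hre
  have hc : γ 1 0 = 0 := him.resolve_right hv.ne'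
  have hd : γ 1 1 = 0 := by
    rw [hc] at hre
    simpa using hre
  have := det_eq γ
  simp [hc, hd] at this

theorem moebius_mem_domain (γ : Matrix.SpecialLinearGroup (Fin 2) ℤ) {p : ℂ × ℂ}
    (hp : p ∈ domain) : moebius γ p ∈ domain := by
  have hv : 0 < p.1.im := hp
  have hj := autFactor_ne_zero γ (show p.1 ∈ upperHalf from hp)
  show 0 < (((γ 0 0 : ℂ) * p.1 + (γ 0 1 : ℂ)) / autFactor γ p.1).im
  have hdet : (γ 0 0 : ℝ) * γ 1 1 - γ 0 1 * γ 1 0 = 1 := by exact_mod_cast det_eq γ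
  have e : (((γ 0 0 : ℂ) * p.1 + (γ 0 1 : ℂ)) / autFactor γ p.1).im =
      p.1.im / normSq (autFactor γ p.1) := by
    rw [div_im, ← sub_div]
    congr 1
    simp [autFactor]
    linear_combination p.1.im * hdet
  rw [e]
  exact div_pos hv (normSq_pos.2 hj)

theorem autFactor_mul (γ γ' : Matrix.SpecialLinearGroup (Fin 2) ℤ) {p : ℂ × ℂ} (hp : p ∈ domain) :
    autFactor (γ * γ') p.1 = autFactor γ (moebius γ' p).1 * autFactor γ' p.1 := by
  have hj := autFactor_ne_zero γ' (show p.1 ∈ upperHalf from hp)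
  simp only [moebius]
  have : autFactor γ (((γ' 0 0 : ℂ) * p.1 + (γ' 0 1 : ℂ)) / autFactor γ' p.1) * autFactor γ' p.1 =
      (γ 1 0 : ℂ) * ((γ' 0 0 : ℂ) * p.1 + (γ' 0 1 : ℂ)) + (γ 1 1 : ℂ) * autFactor γ' p.1 := by
    rw [autFactor]; field_simp
  rw [this]
  simp [autFactor, Matrix.mul_apply, Fin.sum_univ_two]
  ring

theorem moebius_mul (γ γ' : Matrix.SpecialLinearGroup (Fin 2) ℤ) {p : ℂ × ℂ} (hp : p ∈ domain) :
    moebius (γ * γ') p = moebius γ (moebius γ' p) := by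
  have hj := autFactor_ne_zero γ' (show p.1 ∈ upperHalf from hp)
  have hj2 := autFactor_ne_zero γ (show (moebius γ' p).1 ∈ upperHalf from moebius_mem_domain γ' hp)
  have h1 : (moebius (γ * γ') p).1 = (moebius γ (moebius γ' p)).1 := by
    have e : (moebius γ (moebius γ' p)).1 = ((γ 0 0 : ℂ) *
        (((γ' 0 0 : ℂ) * p.1 + (γ' 0 1 : ℂ)) / autFactor γ' p.1) + (γ 0 1 : ℂ)) /
          autFactor γ (moebius γ' p).1 := rfl
    rw [e, moebius, autFactor_mul γ γ' hp]
    simp only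
    rw [div_eq_div_iff (mul_ne_zero hj2 hj) hj2]
    have e2 : ((γ 0 0 : ℂ) * (((γ' 0 0 : ℂ) * p.1 + (γ' 0 1 : ℂ)) / autFactor γ' p.1) +
        (γ 0 1 : ℂ)) * autFactor γ' p.1 = (((γ * γ') 0 0 : ℤ) : ℂ) * p.1 +
          (((γ * γ') 0 1 : ℤ) : ℂ) := by
      rw [add_mul, mul_assoc, div_mul_cancel₀ _ hj]
      simp [autFactor, Matrix.mul_apply, Fin.sum_univ_two]
      ring
    rw [← e2]
    ring
  refine Prod.ext h1 ?_
  show p.2 / autFactor (γ * γ') p.1 = p.2 / autFactor γ' p.1 / autFactor γ (moebius γ' p).1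
  rw [autFactor_mul γ γ' hp, div_mul_eq_div_div_swap]

theorem slash_mul (F : ℂ × ℂ → ℂ) (γ γ' : Matrix.SpecialLinearGroup (Fin 2) ℤ) {p : ℂ × ℂ}
    (hp : p ∈ domain) : slash k m F (γ * γ') p = slash k m (slash k m F γ) γ' p := by
  have hj := autFactor_ne_zero γ' (show p.1 ∈ upperHalf from hp)
  have hj2 := autFactor_ne_zero γ (show (moebius γ' p).1 ∈ upperHalf from moebius_mem_domain γ' hp)
  rw [slash_def, slash_def, slash_def, ← moebius_mul γ γ' hp, autFactor_mul γ γ' hp, mul_zpow]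
  have hfac := autFactor_mul γ γ' hp
  set J := autFactor γ (moebius γ' p).1 with hJ
  set j := autFactor γ' p.1 with hjdef
  have e2 : (moebius γ' p).2 = p.2 / j := rfl
  -- The cocycle identity for the exponential factor; it rests on det γ' = 1.
  have key : (((γ * γ') 1 0 : ℤ) : ℂ) * p.2 ^ 2 / (J * j) =
      (γ 1 0 : ℂ) * (p.2 / j) ^ 2 / J + (γ' 1 0 : ℂ) * p.2 ^ 2 / j := by
    have hc : (((γ * γ') 1 0 : ℤ) : ℂ) * j = γ 1 0 + γ' 1 0 * (J * j) := by
      rw [← hfac]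
      simp [hjdef, autFactor, Matrix.mul_apply, Fin.sum_univ_two]
      linear_combination (γ 1 0 : ℂ) * det_eq γ'
    field_simp
    linear_combination p.2 ^ 2 * hc
  rw [key, e2, mul_add, neg_add, exp_add]
  ring

theorem slash_one (F : ℂ × ℂ → ℂ) (p : ℂ × ℂ) : slash k m F 1 p = F p := by
  simp [slash]

theorem slash_congr {F G : ℂ × ℂ → ℂ} (h : ∀ p ∈ domain, F p = G p)
    (γ : Matrix.SpecialLinearGroup (Fin 2) ℤ) {p : ℂ × ℂ} (hp : p ∈ domain) :
    slash k m F γ p = slash k m G γ p := by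
  rw [slash_def, slash_def, h _ (moebius_mem_domain γ hp)]

/-- Invariance passes to products and inverses by the cocycle relation, and S, T generate SL₂(ℤ). -/
theorem slash_eq_of_generators {F : ℂ × ℂ → ℂ}
    (hS : ∀ p ∈ domain, slash k m F ModularGroup.S p = F p)
    (hT : ∀ p ∈ domain, slash k m F ModularGroup.T p = F p)
    (γ : Matrix.SpecialLinearGroup (Fin 2) ℤ) : ∀ p ∈ domain, slash k m F γ p = F p := by
  have hγ : γ ∈ Subgroup.closure {ModularGroup.S, ModularGroup.T} := by
    rw [_root_.SpecialLinearGroup.SL2Z_generators]; trivial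
  induction hγ using Subgroup.closure_induction with
  | mem x hx =>
    rcases hx with rfl | rfl
    · exact hS
    · exact hT
  | one => exact fun p _ => slash_one F p
  | mul x y _ _ hx hy =>
    intro p hp
    rw [slash_mul F x y hp, slash_congr hx y hp, hy p hp]
  | inv x _ hx =>
    intro p hp
    rw [← slash_congr hx x⁻¹ hp, ← slash_mul F x x⁻¹ hp, mul_inv_cancel, slash_one]

theorem fourierSeries_T (cp cm : ℤ → ℤ → ℂ) (p : ℂ × ℂ) :
    slash k m (fourierSeries k m cp cm) ModularGroup.T p = fourierSeries k m cp cm p := by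
  have hmon (l r : ℤ) : monomial l r (p.1 + 1, p.2) = monomial l r p := by
    rw [monomial, monomial]
    congr 1
    rw [exp_eq_exp_iff_exists_int]
    exact ⟨l, by simp only; ring⟩
  have : slash k m (fourierSeries k m cp cm) ModularGroup.T p =
      fourierSeries k m cp cm (p.1 + 1, p.2) := by
    simp [slash, ModularGroup.T]
  rw [this]
  simp [fourierSeries, hmon]

end Slash

/-! ### The Casimir operator -/

/-- `F` is real differentiable at `p` with `∂F/∂τ = A`, `∂F/∂τ̄ = B`, `∂F/∂z = C` and
`∂F/∂z̄ = 0`. -/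
def HasWirtinger₂ (F : ℂ × ℂ → ℂ) (A B C : ℂ) (p : ℂ × ℂ) : Prop :=
  HasFDerivAt F ((wirtingerCLM A B).comp (ContinuousLinearMap.fst ℝ ℂ ℂ) +
    (wirtingerCLM C 0).comp (ContinuousLinearMap.snd ℝ ℂ ℂ)) p

namespace HasWirtinger₂

variable {F : ℂ × ℂ → ℂ} {A B C : ℂ} {p : ℂ × ℂ}

theorem dTau_eq (h : HasWirtinger₂ F A B C p) : dTau F p = A := by
  rw [dTau, HasFDerivAt.fderiv h]
  simp
  linear_combination (-(A - B) / 2) * I_mul_I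

theorem dTauBar_eq (h : HasWirtinger₂ F A B C p) : dTauBar F p = B := by
  rw [dTauBar, HasFDerivAt.fderiv h]
  simp
  linear_combination ((A - B) / 2) * I_mul_I

theorem dZ_eq (h : HasWirtinger₂ F A B C p) : dZ F p = C := by
  rw [dZ, HasFDerivAt.fderiv h]
  simp
  linear_combination (-C / 2) * I_mul_I

theorem dZBar_eq (h : HasWirtinger₂ F A B C p) : dZBar F p = 0 := by
  rw [dZBar, HasFDerivAt.fderiv h]
  simp
  linear_combination C * I_mul_I

theorem congr_of_eqOn {G : ℂ × ℂ → ℂ} {U : Set (ℂ × ℂ)} (h : HasWirtinger₂ F A B C p)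
    (hU : IsOpen U) (hp : p ∈ U) (hG : ∀ x ∈ U, G x = F x) : HasWirtinger₂ G A B C p :=
  HasFDerivAt.congr_of_eventuallyEq h (by filter_upwards [hU.mem_nhds hp] with x hx using hG x hx)

theorem sum {ι : Type*} {s : Finset ι} {F : ι → ℂ × ℂ → ℂ} {A B C : ι → ℂ}
    (h : ∀ i ∈ s, HasWirtinger₂ (F i) (A i) (B i) (C i) p) :
    HasWirtinger₂ (fun x => ∑ i ∈ s, F i x) (∑ i ∈ s, A i) (∑ i ∈ s, B i) (∑ i ∈ s, C i) p := by
  refine (HasFDerivAt.fun_sum h).congr_fderiv ?_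
  ext <;> simp [Finset.sum_add_distrib, Finset.sum_mul]

theorem mul {f : ℂ → ℂ} {θ : ℂ × ℂ → ℂ} {a b a' c' : ℂ} (hf : HasWirtinger f a b p.1)
    (hθ : HasFDerivAt (𝕜 := ℂ) θ
      (a' • ContinuousLinearMap.fst ℂ ℂ ℂ + c' • ContinuousLinearMap.snd ℂ ℂ ℂ) p) :
    HasWirtinger₂ (fun x => f x.1 * θ x) (a * θ p + f p.1 * a') (b * θ p) (f p.1 * c') p := by
  have h1 : HasFDerivAt (fun x : ℂ × ℂ => f x.1) _ p :=
    HasFDerivAt.comp p hf (ContinuousLinearMap.fst ℝ ℂ ℂ).hasFDerivAt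
  refine (h1.mul (hθ.restrictScalars ℝ)).congr_fderiv ?_
  ext <;> simp <;> ring

theorem zero : HasWirtinger₂ (fun _ => 0) 0 0 0 p := by
  refine (hasFDerivAt_const (0 : ℂ) p).congr_fderiv ?_
  ext <;> simp

end HasWirtinger₂

theorem isOpen_domain : IsOpen domain := isOpen_lt continuous_const (by fun_prop)

/-- Holomorphy in z kills the seven terms containing ∂_z̄. With b = ∂h/∂τ̄ and T = τ - τ̄, the heat
equation turns the ∂_{τ̄zz} term into 2T² b θ_τ, cancelling the theta part of -2T²∂_τ(bθ). The rest
cancels because ∂_τ b = (1/2 - k) b/T. -/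
theorem casimir_sum_theta {ι : Type*} [Fintype ι] {k m : ℕ} (hm : 0 < m) {F : ℂ × ℂ → ℂ}
    {h g : ι → ℂ → ℂ} {c : ι → ℤ → ℂ} {d : ι → ℂ → ℂ}
    (hF : ∀ p ∈ domain, F p = ∑ s, h s p.1 * thetaSeries m (c s) p)
    (hc : ∀ s, GaussSummable (c s))
    (hh : ∀ s, ∀ τ ∈ upperHalf, HasWirtinger (h s) (d s τ)
      ((τ.im ^ (1 / 2 - k : ℝ) : ℝ) * (starRingEnd ℂ) (g s τ)) τ)
    (hg : ∀ s, DifferentiableOn ℂ (g s) upperHalf) {p : ℂ × ℂ} (hp : p ∈ domain) :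
    casimir k m F p = 0 := by
  let b (s : ι) (τ : ℂ) : ℂ := (τ.im ^ (1 / 2 - k : ℝ) : ℝ) * (starRingEnd ℂ) (g s τ)
  let θ (s : ι) : ℂ × ℂ → ℂ := thetaSeries m (c s)
  let θτ (s : ι) : ℂ × ℂ → ℂ := thetaSeries m (thetaCoeffTau m (c s))
  let θz (s : ι) : ℂ × ℂ → ℂ := thetaSeries m (thetaCoeffZ (c s))
  let θzz (s : ι) : ℂ × ℂ → ℂ := thetaSeries m (thetaCoeffZ (thetaCoeffZ (c s)))
  -- The conjugate of g has no τ-derivative, so only the power of v is differentiated. The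
  -- τ̄-derivative of b never enters the operator.
  have hb (s : ι) (τ : ℂ) (hτ : τ ∈ upperHalf) : ∃ b', HasWirtinger (b s)
      ((1 / 2 - k : ℂ) / (2 * I * τ.im) * b s τ) b' τ := by
    have hv : 0 < τ.im := hτ
    have h1 := HasWirtinger.comp_im (τ := τ)
      (Real.hasDerivAt_rpow_const (p := (1 / 2 - k : ℝ)) (Or.inl hv.ne')).ofReal_comp
    have h2 := (HasWirtinger.of_hasDerivAt
      ((hg s).differentiableAt (isOpen_upperHalf.mem_nhds hτ)).hasDerivAt).conj
    refine ⟨_, (h1.mul h2).congr_coeff ?_ rfl⟩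
    have hvc : (τ.im : ℂ) ≠ 0 := by exact_mod_cast hv.ne'
    rw [Real.rpow_sub_one hv.ne']
    simp only [b, map_zero, mul_zero, add_zero]
    push_cast
    field_simp
  have hF1 (x : ℂ × ℂ) (hx : x ∈ domain) : HasWirtinger₂ F
      (∑ s, (d s x.1 * θ s x + h s x.1 * θτ s x)) (∑ s, b s x.1 * θ s x)
      (∑ s, h s x.1 * θz s x) x :=
    (HasWirtinger₂.sum fun s _ => HasWirtinger₂.mul (hh s _ hx)
      (hasFDerivAt_thetaSeries hm (hc s) hx)).congr_of_eqOn isOpen_domain hx hF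
  have hZ (x : ℂ × ℂ) (hx : x ∈ domain) := (HasWirtinger₂.sum (s := Finset.univ) fun s _ =>
    HasWirtinger₂.mul (hh s _ hx) (hasFDerivAt_thetaSeries hm (hc s).z hx)).congr_of_eqOn
      isOpen_domain hx fun y hy => (hF1 y hy).dZ_eq
  have hZZ (x : ℂ × ℂ) (hx : x ∈ domain) := (HasWirtinger₂.sum (s := Finset.univ) fun s _ =>
    HasWirtinger₂.mul (hh s _ hx) (hasFDerivAt_thetaSeries hm (hc s).z.z hx)).congr_of_eqOn
      isOpen_domain hx fun y hy => (hZ y hy).dZ_eq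
  choose! b' hb' using hb
  have hB := (HasWirtinger₂.sum (s := Finset.univ) fun s _ =>
    HasWirtinger₂.mul (hb' s _ hp) (hasFDerivAt_thetaSeries hm (hc s) hp)).congr_of_eqOn
      isOpen_domain hp fun y hy => (hF1 y hy).dTauBar_eq
  have h0 (x : ℂ × ℂ) (hx : x ∈ domain) : HasWirtinger₂ (dZBar F) 0 0 0 x :=
    HasWirtinger₂.zero.congr_of_eqOn isOpen_domain hx fun y hy => (hF1 y hy).dZBar_eq
  have h00 : HasWirtinger₂ (dZ (dZBar F)) 0 0 0 p :=
    HasWirtinger₂.zero.congr_of_eqOn isOpen_domain hp fun y hy => (h0 y hy).dZ_eq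
  have h01 : HasWirtinger₂ (dZBar (dZBar F)) 0 0 0 p :=
    HasWirtinger₂.zero.congr_of_eqOn isOpen_domain hp fun y hy => (h0 y hy).dZBar_eq
  have hv : 0 < p.1.im := hp
  have hvc : (p.1.im : ℂ) ≠ 0 := by exact_mod_cast hv.ne'
  have hm' : (m : ℂ) ≠ 0 := by exact_mod_cast hm.ne'
  have hpi : (Real.pi : ℂ) ≠ 0 := by exact_mod_cast Real.pi_ne_zero
  have hT : p.1 - (starRingEnd ℂ) p.1 = 2 * I * p.1.im := by
    rw [sub_conj]; push_cast; ring
  simp only [casimir, hB.dTau_eq, (hF1 p hp).dTauBar_eq, (hZZ p hp).dTauBar_eq, (h0 p hp).dZ_eq,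
    (hF1 p hp).dZBar_eq, h00.dZ_eq, h01.dZ_eq, h01.dTau_eq, (h0 p hp).dTau_eq, (h0 p hp).dZBar_eq,
    hT, heat_equation hm, mul_zero, add_zero, sub_zero, Finset.mul_sum]
  rw [← Finset.sum_sub_distrib, ← Finset.sum_add_distrib]
  refine Finset.sum_eq_zero fun s _ => ?_
  simp only [b, θ]
  field_simp
  ring

/-! ### Growth -/

section Growth

variable {k m : ℕ}

/-- With D = 0 absent, v|D| ≥ (v + |D|)/2: half of the exponent gives decay in v, the other half
keeps the sum over D finite. -/
theorem norm_tsum_le_of_exp_tail {f b : ℤ → ℂ} (hb : Subexp b) {α K v : ℝ} (hα : 0 < α)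
    (hv : 1 ≤ v) (hK : 0 ≤ K) (h0 : f 0 = 0)
    (h : ∀ D : ℤ, ‖f D‖ ≤ K * (‖b D‖ * Real.exp (-(α * v) * |(D : ℝ)|))) :
    ‖∑' D, f D‖ ≤ (K * ∑' D : ℤ, ‖b D‖ * Real.exp (-(α / 2) * |(D : ℝ)|)) *
      Real.exp (-(α / 2) * v) := by
  have hs := (hb (α / 2) (half_pos hα)).mul_left (K * Real.exp (-(α / 2) * v))
  refine (tsum_of_norm_bounded hs.hasSum fun D => ?_).trans_eq (by rw [tsum_mul_left]; ring)
  rcases eq_or_ne D 0 with rfl | hD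
  · rw [h0, norm_zero]; positivity
  refine (h D).trans ?_
  have h1 : (1 : ℝ) ≤ |(D : ℝ)| := by exact_mod_cast Int.one_le_abs hD
  have h2 : Real.exp (-(α * v) * |(D : ℝ)|) ≤
      Real.exp (-(α / 2) * v) * Real.exp (-(α / 2) * |(D : ℝ)|) := by
    rw [← Real.exp_add]
    gcongr
    have h3 : v + |(D : ℝ)| ≤ 2 * (v * |(D : ℝ)|) := by
      nlinarith [mul_nonneg (sub_nonneg.2 hv) (sub_nonneg.2 h1)]
    nlinarith
  calc K * (‖b D‖ * Real.exp (-(α * v) * |(D : ℝ)|)) ≤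
      K * (‖b D‖ * (Real.exp (-(α / 2) * v) * Real.exp (-(α / 2) * |(D : ℝ)|))) := by gcongr
    _ = _ := by ring

theorem Admissible.summable_principal {bp bn : ℤ → ℂ} (h : Admissible bp bn) (hm : 0 < m) {τ : ℂ}
    (hτ : τ ∈ upperHalf) :
    Summable fun D : ℤ => ‖if D ≤ 0 then bp D * qExp m D τ else 0‖ := by
  obtain ⟨N, hN⟩ := h.hol_support
  refine (summable_holSeries hm h.hol hN hτ).of_nonneg_of_le (fun _ => norm_nonneg _) fun D => ?_
  split_ifs
  · exact le_rfl
  · rw [norm_zero]; exact norm_nonneg _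

theorem Admissible.exists_norm_sub_principal_le {bp bn : ℤ → ℂ} (h : Admissible bp bn) (hk : 0 < k)
    (hm : 0 < m) : ∃ A : ℝ, ∀ τ : ℂ, 1 ≤ τ.im →
      ‖compSeries k m bp bn τ - ∑' D : ℤ, (if D ≤ 0 then bp D * qExp m D τ else 0)‖ ≤
        A * Real.exp (-(Real.pi / (2 * m) / 2) * τ.im) := by
  have hα : 0 < Real.pi / (2 * m) := by positivity
  have ha := weight_le hk
  refine ⟨1 * (∑' D : ℤ, ‖bp D‖ * Real.exp (-(Real.pi / (2 * m) / 2) * |(D : ℝ)|)) +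
    (Real.pi / m) ^ ((3 / 2 - k : ℝ) - 1) *
      ∑' D : ℤ, ‖bn D‖ * Real.exp (-(Real.pi / (2 * m) / 2) * |(D : ℝ)|), fun τ hτ => ?_⟩
  have hmem : τ ∈ upperHalf := one_pos.trans_le hτ
  have hv : 0 < τ.im := hmem
  obtain ⟨N, hN⟩ := h.hol_support
  -- What remains is the positive discriminants and the gamma series, both without a D = 0 term.
  have e : compSeries k m bp bn τ - ∑' D : ℤ, (if D ≤ 0 then bp D * qExp m D τ else 0) =
      (∑' D : ℤ, if D ≤ 0 then 0 else bp D * qExp m D τ) + nonSeries (3 / 2 - k) m bn τ := by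
    rw [compSeries, add_sub_right_comm, holSeries,
      ← (summable_holSeries hm h.hol hN hmem).of_norm.tsum_sub
        (h.summable_principal hm hmem).of_norm]
    congr 1
    refine tsum_congr fun D => ?_
    split_ifs <;> simp
  rw [e, add_mul]
  refine (norm_add_le _ _).trans (add_le_add ?_ ?_)
  · refine norm_tsum_le_of_exp_tail h.hol hα hτ zero_le_one (by simp) fun D => ?_
    split_ifs with hD
    · rw [norm_zero]; positivity
    · rw [norm_mul, norm_qExp, one_mul, abs_of_pos (by exact_mod_cast not_le.1 hD)]
      refine le_of_eq ?_
      ring_nf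
  · refine norm_tsum_le_of_exp_tail h.non hα hτ (by positivity) (by simp [h.non_support]) fun D => ?_
    refine (norm_nonSeries_term_le ha hm h.non_support hv le_rfl D).trans ?_
    gcongr ?_ * _
    refine Real.rpow_le_rpow_of_nonpos (by positivity) ?_ (by linarith)
    gcongr
    nlinarith [Real.pi_pos]

theorem principalPart_eq [NeZero (2 * m)] (hm : 0 < m) {cp : ℤ → ℤ → ℂ} (hcp : DiscInvariant m cp)
    {bn : ZMod (2 * m) → ℤ → ℂ} (hadm : ∀ s, Admissible (coeff m cp s) (bn s)) {p : ℂ × ℂ}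
    (hp : p ∈ domain) :
    principalPart m (fun D s => coeff m cp s D) p =
      ∑ s, (∑' D : ℤ, if D ≤ 0 then coeff m cp s D * qExp m D p.1 else 0) * theta m s p := by
  rw [← tsum_prod_theta hm hp fun s => (hadm s).summable_principal hm hp]
  have e := tsum_disc_prod hm hcp fun D r => if D ≤ 0 then qExp m D p.1 * thetaTerm m r p else 0
  rw [principalPart]
  refine Eq.trans (tsum_congr fun a => ?_) (e.trans (tsum_congr fun x => ?_))
  · rw [coeff_disc hcp, monomial_eq hm, mul_ite, mul_zero]
  · split_ifs
    · ring
    · simp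

end Growth

/-! ### From the hypotheses on coefficients to admissible components. -/

section Coefficients

variable {m : ℕ} {cp cm : ℤ → ℤ → ℂ}

/-- Extending by zero is consistent, since the sign condition itself depends only on the
discriminant. -/
theorem discInvariant_negPart
    (h : ∀ l r l' r' : ℤ, disc m l r < 0 → disc m l r = disc m l' r' →
      r ≡ r' [ZMOD (2 * m)] → cm l r = cm l' r') : DiscInvariant m (negPart m cm) := by
  intro l r l' r' h1 h2
  rw [negPart, negPart, ← h1]
  split_ifs with h0
  · exact h l r l' r' h0 h1 h2
  · rfl

theorem admissible_coeff {D₀ : ℤ} (hD₀ : ∀ l r : ℤ, disc m l r < -D₀ → cp l r = 0) {A C N : ℝ}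
    (hp : ∀ l r : ℤ, N ≤ |(disc m l r : ℝ)| →
      ‖cp l r‖ ≤ A * Real.exp (C * √|(disc m l r : ℝ)|))
    (hn : ∀ l r : ℤ, N ≤ |(disc m l r : ℝ)| → disc m l r < 0 →
      ‖cm l r‖ ≤ A * Real.exp (C * √|(disc m l r : ℝ)|)) (s : ZMod (2 * m)) :
    Admissible (coeff m cp s) (coeff m (negPart m cm) s) := by
  -- A may be negative; |A| keeps the bound valid where the coefficient was set to 0.
  refine ⟨subexp_coeff hp s, subexp_coeff (A := |A|) (C := C) (N := N) (fun l r h => ?_) s,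
    ⟨D₀.toNat, fun D hD => ?_⟩, fun D hD => ?_⟩
  · rw [negPart]
    split_ifs with h0
    · exact (hn l r h h0).trans (by gcongr; exact le_abs_self A)
    · rw [norm_zero]; positivity
  · by_contra h
    obtain ⟨l, r, h1, -, h3⟩ := exists_of_coeff_ne_zero h
    exact h (h3.trans (hD₀ l r (by lia)))
  · by_contra h
    obtain ⟨l, r, h1, -, h3⟩ := exists_of_coeff_ne_zero h
    exact h (h3.trans (if_neg (by lia)))

end Coefficients

/-- The Fourier series is a harmonic Maass-Jacobi form if its components are modular. -/
theorem isHarmonicMaassJacobiForm_fourierSeries {k m : ℕ} [NeZero (2 * m)] (hk : 0 < k)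
    (hk2 : Even k) (hm : 0 < m) {cp cm : ℤ → ℤ → ℂ} (hcp : DiscInvariant m cp)
    (hcm : DiscInvariant m (negPart m cm)) {D₀ : ℤ}
    (hD₀ : ∀ l r : ℤ, disc m l r < -D₀ → cp l r = 0)
    (hadm : ∀ s, Admissible (coeff m cp s) (coeff m (negPart m cm) s))
    (hmod : ComponentsModular k m fun s => compSeries k m (coeff m cp s) (coeff m (negPart m cm) s)) :
    IsHarmonicMaassJacobiForm k m (fourierSeries k m cp cm) := by
  have hF (p : ℂ × ℂ) (hp : p ∈ domain) := fourierSeries_eq (k := k) hk hm hcp hcm hadm hp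
  refine ⟨fun p hp => ?_, fun τ hτ => ?_, fun γ => ?_, fun a b p hp => ?_, fun p hp => ?_, ?_⟩
  · have h1 : AnalyticAt ℝ (fun p : ℂ × ℂ => ∑ s,
        compSeries k m (coeff m cp s) (coeff m (negPart m cm) s) p.1 * theta m s p) p :=
      Finset.analyticAt_fun_sum _ fun s _ =>
        (((hadm s).analyticAt hk hm hp).fun_comp analyticAt_fst).mul
          (analyticAt_thetaSeries hm (gaussSummable_residueCoeff m s) hp)
    exact h1.congr (by filter_upwards [isOpen_domain.mem_nhds hp] with x hx using (hF x hx).symm)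
  · rw [funext fun z => hF (τ, z) hτ]
    refine Differentiable.fun_sum fun s _ => ?_
    simp only
    refine Differentiable.const_mul (fun z => ?_) _
    exact (hasFDerivAt_thetaSeries hm (gaussSummable_residueCoeff m s)
      (p := (τ, z)) hτ).differentiableAt.comp z (by fun_prop)
  · refine slash_eq_of_generators (fun p hp => ?_) (fun p _ => fourierSeries_T cp cm p) γ
    have h0 := ne_zero_of_mem_upperHalf (show p.1 ∈ upperHalf from hp)
    have hmem : (-1 / p.1, p.2 / p.1) ∈ domain := by
      simpa [moebius, autFactor, ModularGroup.S] using moebius_mem_domain ModularGroup.S hp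
    rw [hF p hp, ← sum_theta_S hk2 hm hmod hp, ← hF _ hmem]
    simp [slash, ModularGroup.S]
  · have hmem : (p.1, p.2 + a * p.1 + b) ∈ domain := hp
    rw [heisenberg, hF _ hmem, hF p hp, Finset.mul_sum]
    refine Finset.sum_congr rfl fun s _ => ?_
    rw [mul_left_comm, theta_heisenberg hm]
  · exact casimir_sum_theta hm hF (fun s => gaussSummable_residueCoeff m s)
      (fun s τ hτ => (hadm s).hasWirtinger hk hm hτ)
      (fun s => (hadm s).differentiableOn_shadow hk hm) hp
  · refine ⟨fun D s => coeff m cp s D, ?_, Real.pi / (2 * m) / 2, by positivity, ?_⟩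
    · refine (Set.finite_Icc (-D₀) 0).subset ?_
      rintro D ⟨h0, s, hs⟩
      obtain ⟨l, r, h1, -, h3⟩ := exists_of_coeff_ne_zero hs
      refine ⟨not_lt.1 fun hlt => hs ?_, h0⟩
      exact h3.trans (hD₀ l r (h1 ▸ hlt))
    -- The factor e^{-hv} comes from the components and e^{2πmy²/v} from the theta functions,
    -- uniformly in u and z.
    · choose A hA using fun s => (hadm s).exists_norm_sub_principal_le (k := k) hk hm
      obtain ⟨K, -, hK⟩ := exists_norm_theta_le hm
      refine ⟨∑ s, A s * K, 1, fun p hp hv => ?_⟩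
      rw [hF p hp, principalPart_eq hm hcp hadm hp, ← Finset.sum_sub_distrib, Finset.sum_mul]
      refine (norm_sum_le _ _).trans (Finset.sum_le_sum fun s _ => ?_)
      rw [← sub_mul, norm_mul]
      calc _ ≤ _ := mul_le_mul (hA s p.1 hv) (hK s p hv) (norm_nonneg _)
            ((norm_nonneg _).trans (hA s p.1 hv))
        _ = _ := by ring

end JacobiConverse

end

/-! ### The converse theorem. -/

open JacobiConverse in
theorem mainTheorem3 (k m : ℕ) (hk : 0 < k) (hk2 : Even k) (hm : 0 < m)
    (cp cm : ℤ → ℤ → ℂ)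
    (hcp : ∀ l r l' r' : ℤ, disc m l r = disc m l' r' → r ≡ r' [ZMOD (2 * m)] →
      cp l r = cp l' r')
    (hcm : ∀ l r l' r' : ℤ, disc m l r < 0 → disc m l r = disc m l' r' →
      r ≡ r' [ZMOD (2 * m)] → cm l r = cm l' r')
    (D₀ : ℤ) (hD₀ : ∀ l r : ℤ, disc m l r < -D₀ → cp l r = 0)
    (hgrowth : ∃ C : ℝ, 0 < C ∧ ∃ A N : ℝ, ∀ l r : ℤ, N ≤ |(disc m l r : ℝ)| →
      ‖cp l r‖ ≤ A * Real.exp (C * √|(disc m l r : ℝ)|) ∧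
      (disc m l r < 0 → ‖cm l r‖ ≤ A * Real.exp (C * √|(disc m l r : ℝ)|)))
    (Sc : Set (ℝ → ℂ)) (hSc : ∀ φ ∈ Sc, IsTestFunction φ)
    (hSc_twist : ∀ φ ∈ Sc, ∀ s : ℂ, twist φ s ∈ Sc)
    (hSc_ne : ∀ y : ℝ, 0 < y → ∃ φ ∈ Sc, φ y ≠ 0)
    (hL : ∀ φ ∈ Sc, LSer k m cp cm φ =
      I ^ ((k : ℂ) - 1 / 2) • (weilSBar m).mulVec (LSer k m cp cm (slashS k φ)))
    (hLα : ∀ φ ∈ Sc, LSerAlpha k m cp cm φ =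
      -I ^ ((k : ℂ) - 1 / 2) • (weilSBar m).mulVec (LSerAlpha k m cp cm (slashS k φ))) :
    IsHarmonicMaassJacobiForm k m (fourierSeries k m cp cm) := by
  have : NeZero (2 * m) := ⟨by lia⟩
  obtain ⟨C, -, A, N, hCA⟩ := hgrowth
  have hneg := discInvariant_negPart hcm
  have hadm := admissible_coeff hD₀ (fun l r h => (hCA l r h).1) fun l r h => (hCA l r h).2
  exact isHarmonicMaassJacobiForm_fourierSeries hk hk2 hm hcp hneg hD₀ hadm
    (componentsModular hk hm hcp hneg hadm hSc hSc_twist hSc_ne hL hLα)
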